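/- **Model.** All quantities are in linear scale. Base stations (BSs) form a homogeneous Poisson point process $\Phi=\{x_i\}_{i\in\mathbb N}$ of intensity $\lambda>0$ on $\mathbb{R}^2$; the typical user is at the origin $o$. Given $\Phi$, the links to the BSs are line-of-sight (LOS) independently of each other, a link of length $r$ with probability $h(r)$, where $h:[0,\infty)\to[0,1]$ is measurable; the other links are NLOS. The path loss of a link of length $r$ is $l_L(r)=\beta r^{\alpha_L}$ if it is LOS and $l_N(r)=\beta r^{\alpha_N}$ if it is NLOS, with $\beta,\alpha_L,\alpha_N>0$; put $l_L^{-1}(z)=(z/\beta)^{1/\alpha_L}$ and $l_N^{-1}(z)=(z/\beta)^{1/\alpha_N}$. The fading powers $F_i$ of the links are i.i.d. exponential with mean $1$, independent of the locations and of the LOS states. Let $M_{cs},N_{cs}\ge 1$ be integers (numbers of BS and user beam directions in cell search), $K_{cs}=\max(M_{cs},N_{cs})$, $P_b>0$ the BS power, $\sigma^2>0$ the noise power, $\Gamma_{cs}>0$ the detection threshold, and $C_0>0$. For $0<\theta<2\pi$ let $G(\theta)=\frac{2\pi}{\theta}\frac{\gamma}{\gamma+1}$ with $\gamma=\frac{2\pi}{C_0(2\pi-\theta)}$,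 and let $G(2\pi)=1$. For $1\le j\le K_{cs}$ the $j$-th BS sector $S_j$ is the set of points $x\ne o$ whose polar angle lies in $[\frac{2\pi(j-1)}{K_{cs}},\frac{2\pi j}{K_{cs}})$. Let $Z^{(j)}$ be the minimum path loss from the user to the BSs in $S_j$. Sector $S_j$ is *detected* if the BS $x_i\in S_j$ with the smallest path loss $Z^{(j)}$ satisfies $$\mathrm{SINR}=\frac{F_i/Z^{(j)}}{\sum_k F_k/l(x_k)+\frac{\sigma^2}{P_bM_{cs}G(2\pi/N_{cs})}}>\Gamma_{cs},$$ where $l(x_k)$ is the path loss of the link to $x_k$ and the sum is over the LOS BSs $x_k\in S_j$ with $\|x_k\|>l_L^{-1}(Z^{(j)})$ and the NLOS BSs $x_k\in S_j$ with $\|x_k\|>l_N^{-1}(Z^{(j)})$. The path loss $Z_0\in[0,\infty]$ to the tagged (serving) BS is the minimum of $Z^{(j)}$ over the detected sectors $S_j$, and $Z_0=\infty$ if no sector is detected. **Functions.** Let $$V(z,T,\ell)=\exp\Bigl\{-2\pi \ell\Bigl(\int_{l_L^{-1}(z)}^{\infty}\frac{Tz\,h(r)\,r}{Tz+l_L(r)}dr+\int_{l_N^{-1}(z)}^{\infty}\frac{Tz\,(1-h(r))\,r}{Tz+l_N(r)}dr\Bigr)\Bigr\}$$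 (integrals in $[0,\infty]$, $e^{-\infty}=0$), $$\tilde P(z,\Gamma_{cs})=\exp\Bigl(-\frac{\Gamma_{cs}z\sigma^2}{P_bM_{cs}G(2\pi/N_{cs})}\Bigr)V\Bigl(z,\Gamma_{cs},\frac{\lambda}{K_{cs}}\Bigr),$$ $$f_{Z_1}(z)=\frac{2\pi\lambda}{K_{cs}}\Bigl[\frac{1}{\alpha_L}\beta^{-2/\alpha_L}z^{\frac{2}{\alpha_L}-1}h(l_L^{-1}(z))+\frac{1}{\alpha_N}\beta^{-2/\alpha_N}z^{\frac{2}{\alpha_N}-1}\bigl(1-h(l_N^{-1}(z))\bigr)\Bigr]\exp\Bigl(-\frac{2\pi\lambda}{K_{cs}}\Bigl[\int_0^{l_L^{-1}(z)}h(r)r\,dr+\int_0^{l_N^{-1}(z)}(1-h(r))r\,dr\Bigr]\Bigr).$$ **Lemma.** $Z_0$ is a random variable, $\tilde P(\cdot,\Gamma_{cs})f_{Z_1}$ is integrable on $(0,\infty)$, and with $P(z_0,\Gamma_{cs})=\int_{z_0}^{\infty}\tilde P(z,\Gamma_{cs})f_{Z_1}(z)\,dz$ and $P(\Gamma_{cs})=P(0,\Gamma_{cs})$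 the following hold. 1. For every real $z_0\ge 0$, $$\mathbb P(Z_0\ge z_0)=\bigl(P(z_0,\Gamma_{cs})+1-P(\Gamma_{cs})\bigr)^{K_{cs}}.$$ 2. The function $$f_{Z_0}(z_0)=K_{cs}\bigl(P(z_0,\Gamma_{cs})+1-P(\Gamma_{cs})\bigr)^{K_{cs}-1}\tilde P(z_0,\Gamma_{cs})f_{Z_1}(z_0)$$ is nonnegative for $z_0>0$ and is the density of the finite part of $Z_0$: $\mathbb P(Z_0<\infty,\ Z_0\in A)=\int_{A\cap(0,\infty)}f_{Z_0}(z)\,dz$ for every Borel set $A\subseteq\mathbb R$. -/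

import Mathlib

open MeasureTheory ProbabilityTheory

open scoped ENNReal NNReal

noncomputable section

namespace MmWave

/-! The plane `ℝ²` is identified with `ℂ` (same norm, same Lebesgue measure). The typical user is at
the origin. All powers, gains and losses are in linear scale. -/

/-- System parameters. -/
structure Params where
  /-- intensity of the base station (BS) process -/
  lam : ℝ
  /-- path loss at the reference distance -/
  beta : ℝ
  /-- LOS path loss exponent -/
  alphaL : ℝ
  /-- NLOS path loss exponent -/
  alphaN : ℝ
  /-- `h r` is the probability that a link of length `r` is LOS -/
  h : ℝ → ℝ
  /-- BS transmit power `P_b` -/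
  Pb : ℝ
  /-- thermal noise power `σ²` -/
  noise : ℝ
  /-- constant of the user antenna pattern -/
  C0 : ℝ
  /-- detection threshold of the synchronization signal -/
  Gam : ℝ
  /-- number of BS beam directions in cell search -/
  Mcs : ℕ
  /-- number of user beam directions in cell search -/
  Ncs : ℕ

/-- Standing assumptions on the parameters. -/
structure Params.Admissible (p : Params) : Prop where
  lam_pos : 0 < p.lam
  beta_pos : 0 < p.beta
  alphaL_pos : 0 < p.alphaL
  alphaN_pos : 0 < p.alphaN
  h_measurable : Measurable p.h
  h_nonneg : ∀ r, 0 ≤ r → 0 ≤ p.h r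
  h_le_one : ∀ r, 0 ≤ r → p.h r ≤ 1
  Pb_pos : 0 < p.Pb
  noise_pos : 0 < p.noise
  C0_pos : 0 < p.C0
  Gam_pos : 0 < p.Gam
  Mcs_pos : 0 < p.Mcs
  Ncs_pos : 0 < p.Ncs

/-- Number of BS sectors. -/
def Params.K (p : Params) : ℕ := max p.Mcs p.Ncs

/-- LOS path loss at distance `r`. -/
def Params.lossL (p : Params) (r : ℝ) : ℝ := p.beta * r ^ p.alphaL

/-- NLOS path loss at distance `r`. -/
def Params.lossN (p : Params) (r : ℝ) : ℝ := p.beta * r ^ p.alphaN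

/-- Inverse of the LOS path loss function. -/
def Params.invLossL (p : Params) (z : ℝ) : ℝ := (z / p.beta) ^ (1 / p.alphaL)

/-- Inverse of the NLOS path loss function. -/
def Params.invLossN (p : Params) (z : ℝ) : ℝ := (z / p.beta) ^ (1 / p.alphaN)

/-- Front-back power ratio of the user antenna with beamwidth `θ`. -/
def Params.frontBack (p : Params) (θ : ℝ) : ℝ := 2 * Real.pi / (p.C0 * (2 * Real.pi - θ))

/-- Main lobe gain of the user antenna with beamwidth `θ`. For an omni-directional antenna
(`θ = 2π`) the front-back ratio is infinite and the gain is the limit value `1`. -/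
def Params.gain (p : Params) (θ : ℝ) : ℝ :=
  open Classical in
  if θ = 2 * Real.pi then 1
  else 2 * Real.pi / θ * (p.frontBack θ / (p.frontBack θ + 1))

/-- Noise power normalized by transmit power and antenna gains. The BS antenna has no side lobe and
main lobe gain `M_cs`. -/
def Params.effNoise (p : Params) : ℝ :=
  p.noise / (p.Pb * p.Mcs * p.gain (2 * Real.pi / p.Ncs))

/-- The infinite sector `S(u, θ₁, θ₂)` of the points `x` whose direction seen from `u` has
an angle in `[θ₁, θ₂)`. -/
def sector (u : ℂ) (θ₁ θ₂ : ℝ) : Set ℂ :=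
  {x | x ≠ u ∧ ∃ θ ∈ Set.Ico θ₁ θ₂, x - u = ‖x - u‖ * Complex.exp (θ * Complex.I)}

/-- The BS sectors; here they are numbered from `0`. -/
def Params.bsSector (p : Params) (j : Fin p.K) : Set ℂ :=
  sector 0 (2 * Real.pi * (j : ℝ) / p.K) (2 * Real.pi * ((j : ℝ) + 1) / p.K)

variable {Ω : Type*}

/-- Number of points of the point process `{X i}` in the set `A`. -/
def countIn (X : ℕ → Ω → ℂ) (A : Set ℂ) (ω : Ω) : ℝ≥0∞ :=
  ∑' i, A.indicator (fun _ => (1 : ℝ≥0∞)) (X i ω)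

/-- `X` is an enumeration of a Poisson point process with intensity measure `Λ`. -/
structure IsPoissonProcess [MeasurableSpace Ω] (P : Measure Ω) (X : ℕ → Ω → ℂ)
    (Λ : Measure ℂ) : Prop where
  measurable : ∀ i, Measurable (X i)
  law : ∀ A : Set ℂ, MeasurableSet A → Λ A < ∞ →
    P.map (countIn X A) = (poissonMeasure (Λ A).toNNReal).map (fun n : ℕ => (n : ℝ≥0∞))
  indep : ∀ (n : ℕ) (A : Fin n → Set ℂ), (∀ k, MeasurableSet (A k)) →
    Pairwise (fun k l => Disjoint (A k) (A l)) → iIndepFun (fun k => countIn X (A k)) P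

/-- The network seen by the typical user: BS `i` is at `X i`, its link is LOS iff `los i = true`,
and its fading power is `F i`. -/
structure IsNetwork [MeasurableSpace Ω] (P : Measure Ω) (p : Params) (X : ℕ → Ω → ℂ)
    (los : ℕ → Ω → Bool) (F : ℕ → Ω → ℝ) : Prop where
  /-- the BSs form a homogeneous Poisson point process of intensity `lam` -/
  poisson : IsPoissonProcess P X (ENNReal.ofReal p.lam • volume)
  los_measurable : ∀ i, Measurable (los i)
  /-- conditionally on the BS locations, the links are LOS independently of each other,
  with probability `h r` for a link of length `r` -/
  los_law : ∀ (B : Set (ℕ → ℂ)) (s : Finset ℕ), MeasurableSet B →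
    P {ω | (fun i => X i ω) ∈ B ∧ ∀ i ∈ s, los i ω = true} =
      ∫⁻ ω in {ω | (fun i => X i ω) ∈ B}, ∏ i ∈ s, ENNReal.ofReal (p.h ‖X i ω‖) ∂P
  fading_measurable : ∀ i, Measurable (F i)
  /-- Rayleigh fading: unit mean exponential powers, i.i.d. over the links -/
  fading_law : ∀ i, P.map (F i) = expMeasure 1
  fading_indep : iIndepFun F P
  /-- the fading is independent of the locations and of the LOS states -/
  fading_indep_network :
    IndepFun (fun ω (i : ℕ) => F i ω) (fun ω (i : ℕ) => (X i ω, los i ω)) P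

section Model

variable (p : Params) (X : ℕ → Ω → ℂ) (los : ℕ → Ω → Bool) (F : ℕ → Ω → ℝ)

/-- Path loss of the link to BS `i`. -/
def pathLoss (i : ℕ) (ω : Ω) : ℝ≥0∞ :=
  ENNReal.ofReal (if los i ω = true then p.lossL ‖X i ω‖ else p.lossN ‖X i ω‖)

/-- Minimum path loss to the BSs inside sector `j`. -/
def minLoss (j : Fin p.K) (ω : Ω) : ℝ≥0∞ :=
  ⨅ (i : ℕ) (_ : X i ω ∈ p.bsSector j), pathLoss p X los i ω

/-- Interference in sector `j` when the serving path loss is `z`: it comes from the LOS and NLOS BSs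
of the sector at distance larger than `l_L⁻¹(z)` and `l_N⁻¹(z)` respectively, that is, from
those whose path loss is larger than `z`. -/
def interference (j : Fin p.K) (z : ℝ≥0∞) (ω : Ω) : ℝ≥0∞ :=
  open Classical in
  ∑' k, if X k ω ∈ p.bsSector j ∧ z < pathLoss p X los k ω then
    ENNReal.ofReal (F k ω) / pathLoss p X los k ω else 0

/-- SINR of the synchronization signal of BS `i` if it provides the smallest path loss of
sector `j`. -/
def sinr (j : Fin p.K) (i : ℕ) (ω : Ω) : ℝ≥0∞ :=
  (ENNReal.ofReal (F i ω) / pathLoss p X los i ω) /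
    (interference p X los F j (pathLoss p X los i ω) ω + ENNReal.ofReal p.effNoise)

/-- Sector `j` is detected: the SINR of the BS with the smallest path loss in the sector exceeds the
threshold. -/
def Detected (j : Fin p.K) (ω : Ω) : Prop :=
  ∃ i, X i ω ∈ p.bsSector j ∧ pathLoss p X los i ω = minLoss p X los j ω ∧
    ENNReal.ofReal p.Gam < sinr p X los F j i ω

/-- Path loss `Z₀` to the tagged BS: the minimum path loss to the BSs of the detected sectors; it is
`∞` if no sector is detected. -/
def taggedLoss (ω : Ω) : ℝ≥0∞ :=
  ⨅ (j : Fin p.K) (_ : Detected p X los F j ω), minLoss p X los j ω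

end Model

/-- The function `V(z, T, λ)`. The integrals take values in `[0, ∞]`, and `exp (-∞) = 0`. -/
def Params.V (p : Params) (z T l : ℝ) : ℝ :=
  (EReal.exp (-((ENNReal.ofReal (2 * Real.pi * l) *
    ((∫⁻ r in Set.Ioi (p.invLossL z),
        ENNReal.ofReal (T * z * p.h r * r / (T * z + p.lossL r))) +
      ∫⁻ r in Set.Ioi (p.invLossN z),
        ENNReal.ofReal (T * z * (1 - p.h r) * r / (T * z + p.lossN r))) : ℝ≥0∞) : EReal))).toReal

/-- The function `f_{Z₁}`. -/
def Params.fZ1 (p : Params) (z : ℝ) : ℝ :=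
  2 * Real.pi * p.lam / p.K * (1 / p.alphaL) * (1 / p.beta) ^ (2 / p.alphaL) *
      z ^ (2 / p.alphaL - 1) * p.h (p.invLossL z) *
      Real.exp (-(2 * Real.pi * p.lam / p.K * ∫ r in (0 : ℝ)..p.invLossL z, p.h r * r)) *
      Real.exp (-(2 * Real.pi * p.lam / p.K * ∫ r in (0 : ℝ)..p.invLossN z, (1 - p.h r) * r)) +
  2 * Real.pi * p.lam / p.K * (1 / p.alphaN) * (1 / p.beta) ^ (2 / p.alphaN) *
      z ^ (2 / p.alphaN - 1) * (1 - p.h (p.invLossN z)) *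
      Real.exp (-(2 * Real.pi * p.lam / p.K * ∫ r in (0 : ℝ)..p.invLossN z, (1 - p.h r) * r)) *
      Real.exp (-(2 * Real.pi * p.lam / p.K * ∫ r in (0 : ℝ)..p.invLossL z, p.h r * r))

/-- The function `P̃(z, Γ)`. -/
def Params.Ptilde (p : Params) (z : ℝ) : ℝ :=
  Real.exp (-(p.Gam * z * p.effNoise)) * p.V z p.Gam (p.lam / p.K)

/-- The function `P(z₀, Γ) = ∫_{z₀}^∞ P̃(z, Γ) f_{Z₁}(z) dz`. -/
def Params.Ptail (p : Params) (z₀ : ℝ) : ℝ := ∫ z in Set.Ioi z₀, p.Ptilde z * p.fZ1 z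

/-- The number `P(Γ) = ∫_0^∞ P̃(z, Γ) f_{Z₁}(z) dz`. -/
def Params.Pdet (p : Params) : ℝ := ∫ z in Set.Ioi (0 : ℝ), p.Ptilde z * p.fZ1 z

/-- The function `f_{Z₀}`. -/
def Params.fZ0 (p : Params) (z₀ : ℝ) : ℝ :=
  p.K * (p.Ptail z₀ + 1 - p.Pdet) ^ (p.K - 1) * p.Ptilde z₀ * p.fZ1 z₀

end MmWave

end

namespace MmWave

open Filter Topology

/-! Fix the base stations and their LOS states. If the smallest path loss `z` of a sector is
attained by exactly one station `i`, clearing denominators in the SINR condition turns detection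
into `F i > Γ z N + ∑ Γ z F k / l k`, where `N` is the effective noise and the sum runs over the
losses `l k > z` of the sector. As `F i` is exponential and independent of the right-hand side, this
has conditional probability `exp (-Γ z N) ∏ 1 / (1 + Γ z / l k)`, which is `detectWeight`. Different
sectors involve disjoint sets of fading variables, so conditionally the sectors fail independently,
and `P (Z₀ ≥ t)` is the mean of `∏ j, (1 - successProb t j)`.

The path losses of one sector form a Poisson process with mean measure `cumMass`, independently over
the sectors. The smallest one has density `fZ1`; given its value `z`, the losses above `z` are still
Poisson, so the mean of the detection weight is `Ptilde z`. A sector is therefore detected with loss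
below `t` with probability `∫₀ᵗ Ptilde fZ1`, and independence of the sectors gives the power `K`.

Conditioning on the minimum is replaced by a Riemann sum. For a cell `[s, t)`, the difference
`gapLaplace s t - gapLaplace t t` is the detection weight at `t` on the event that the smallest loss
lies in the cell. Both terms are exponentials of sums over the process, so the Laplace functional
(`IsNetwork.integral_prod_en_sectorSum`) gives the mean `(exp (-cumMass s) - exp (-cumMass t))
Ptilde t`. Refining the cells, dominated convergence on both sides yields
`IsNetwork.measureReal_le_taggedLoss_eq`. The limit needs two facts: almost surely the losses in a
sector are distinct and locally finite (`IsNetwork.ae_separated`), and the detection weight is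
right-continuous in the threshold (`tendsto_detectWeight`).

The density statement follows by differentiating `-(1 - ∫₀ᶻ Ptilde fZ1) ^ K`. Since `h` is only
measurable, this is the chain rule for absolutely continuous functions,
`integral_comp_integral_mul`. -/

/-- The function `x ↦ exp (-x)` from `[0, ∞]` to `[0, 1]`. -/
noncomputable def en (x : ℝ≥0∞) : ℝ := (EReal.exp (-(x : EReal))).toReal

/-! ### Calculus of `x ↦ exp (-x)` on `[0, ∞]`. -/

lemma en_ofReal {x : ℝ} (hx : 0 ≤ x) : en (ENNReal.ofReal x) = Real.exp (-x) := by
  unfold en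
  rw [EReal.coe_ennreal_ofReal, max_eq_left hx, ← EReal.coe_neg, EReal.exp_coe,
    ENNReal.toReal_ofReal (Real.exp_pos _).le]

lemma en_of_ne_top {x : ℝ≥0∞} (hx : x ≠ ∞) : en x = Real.exp (-x.toReal) := by
  conv_lhs => rw [← ENNReal.ofReal_toReal hx]
  exact en_ofReal ENNReal.toReal_nonneg

@[simp] lemma en_top : en ∞ = 0 := by simp [en]

@[simp] lemma en_zero : en 0 = 1 := by simp [en]

lemma en_nonneg (x : ℝ≥0∞) : 0 ≤ en x := ENNReal.toReal_nonneg

lemma exp_neg_coe_le_one (x : ℝ≥0∞) : EReal.exp (-(x : EReal)) ≤ 1 := by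
  rw [EReal.exp_le_one_iff]
  simpa using EReal.coe_ennreal_nonneg x

lemma exp_neg_coe_ne_top (x : ℝ≥0∞) : EReal.exp (-(x : EReal)) ≠ ∞ :=
  ((exp_neg_coe_le_one x).trans_lt ENNReal.one_lt_top).ne

lemma en_le_one (x : ℝ≥0∞) : en x ≤ 1 := by
  unfold en
  simpa using ENNReal.toReal_mono ENNReal.one_ne_top (exp_neg_coe_le_one x)

lemma en_antitone : Antitone en := by
  intro x y h
  apply ENNReal.toReal_mono (exp_neg_coe_ne_top _)
  rw [EReal.exp_le_exp_iff, EReal.neg_le_neg_iff]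
  exact_mod_cast h

lemma en_add (x y : ℝ≥0∞) : en (x + y) = en x * en y := by
  by_cases hx : x = ∞
  · simp [hx]
  by_cases hy : y = ∞
  · simp [hy]
  rw [en_of_ne_top hx, en_of_ne_top hy, en_of_ne_top (ENNReal.add_ne_top.2 ⟨hx, hy⟩),
    ENNReal.toReal_add hx hy, neg_add, Real.exp_add]

lemma continuous_en : Continuous en := by
  have h : Continuous fun x : ℝ≥0∞ => EReal.exp (-(x : EReal)) :=
    ENNReal.continuous_exp.comp (continuous_neg.comp continuous_coe_ennreal_ereal)
  exact continuous_iff_continuousAt.2 fun x =>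
    (ENNReal.tendsto_toReal (exp_neg_coe_ne_top x)).comp h.continuousAt

lemma measurable_en : Measurable en := continuous_en.measurable

lemma en_sum {ι : Type*} (s : Finset ι) (a : ι → ℝ≥0∞) :
    en (∑ i ∈ s, a i) = ∏ i ∈ s, en (a i) := by
  classical
  induction s using Finset.induction_on with
  | empty => simp
  | insert i s hi ih => rw [Finset.sum_insert hi, Finset.prod_insert hi, en_add, ih]

lemma en_mul_natCast (c : ℝ≥0∞) (n : ℕ) : en (c * n) = en c ^ n := by
  induction n with
  | zero => simp
  | succ n ih => rw [Nat.cast_succ, mul_add, mul_one, en_add, ih, pow_succ]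

/-- The inverse of `en` on `[0, 1]`. -/
noncomputable def enInv (u : ℝ) : ℝ≥0∞ := if u ≤ 0 then ∞ else ENNReal.ofReal (-Real.log u)

lemma en_enInv {u : ℝ} (h0 : 0 ≤ u) (h1 : u ≤ 1) : en (enInv u) = u := by
  unfold enInv
  split_ifs with h
  · rw [en_top]; exact le_antisymm h0 h
  · rw [en_ofReal, neg_neg, Real.exp_log (not_le.1 h)]
    exact neg_nonneg.2 (Real.log_nonpos h0 h1)

lemma measurable_enInv : Measurable enInv :=
  Measurable.ite measurableSet_Iic measurable_const
    (Real.measurable_log.neg.ennreal_ofReal)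

lemma abs_en_le (x : ℝ≥0∞) : |en x| ≤ 1 := by
  rw [abs_of_nonneg (en_nonneg x)]; exact en_le_one x

lemma integrable_en_comp {Ω : Type*} [MeasurableSpace Ω] {P : Measure Ω} [IsFiniteMeasure P]
    {f : Ω → ℝ≥0∞} (hf : Measurable f) : Integrable (fun ω => en (f ω)) P :=
  Integrable.of_bound (measurable_en.comp hf).aestronglyMeasurable 1
    (Eventually.of_forall fun _ => abs_en_le _)

/-- `en` is bounded by 1 and continuous even at `∞`, so convergence in `[0, ∞]` suffices and the
sums need not be finite. -/
lemma tendsto_integral_en {Ω : Type*} [MeasurableSpace Ω] {P : Measure Ω} [IsFiniteMeasure P]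
    {f : ℕ → Ω → ℝ≥0∞} {g : Ω → ℝ≥0∞} (hf : ∀ n, Measurable (f n))
    (h : ∀ᵐ ω ∂P, Tendsto (fun n => f n ω) atTop (𝓝 (g ω))) :
    Tendsto (fun n => ∫ ω, en (f n ω) ∂P) atTop (𝓝 (∫ ω, en (g ω) ∂P)) := by
  refine tendsto_integral_of_dominated_convergence (fun _ => 1)
    (fun n => (measurable_en.comp (hf n)).aestronglyMeasurable) (integrable_const _)
    (fun n => Eventually.of_forall fun _ => abs_en_le _) ?_
  filter_upwards [h] with ω hω
  exact (continuous_en.tendsto _).comp hω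

/-! ### Laplace functional of a Poisson process. -/

section Poisson

variable {Ω : Type*} [MeasurableSpace Ω] {P : Measure Ω} {X : ℕ → Ω → ℂ} {Λ : Measure ℂ}

lemma measurable_countIn (hX : ∀ i, Measurable (X i)) {A : Set ℂ} (hA : MeasurableSet A) :
    Measurable (countIn X A) :=
  Measurable.tsum fun i => (measurable_const.indicator hA).comp (hX i)

/-- The generating function of the Poisson law at `en c`: the exponential series sums to `exp (r *
en c)`. -/
lemma integral_en_mul_natCast_poissonMeasure (r : ℝ≥0) (c : ℝ≥0∞) :
    ∫ n : ℕ, en (c * n) ∂(poissonMeasure r) = en (ENNReal.ofReal (1 - en c) * r) := by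
  rw [integral_poissonMeasure]
  simp_rw [en_mul_natCast, smul_eq_mul]
  have h1 : (0 : ℝ) ≤ 1 - en c := sub_nonneg.2 (en_le_one c)
  have h2 : ENNReal.ofReal (1 - en c) * r = ENNReal.ofReal ((1 - en c) * r) := by
    rw [ENNReal.ofReal_mul h1, ENNReal.ofReal_coe_nnreal]
  rw [h2, en_ofReal (by positivity)]
  have h3 : ∀ n : ℕ, Real.exp (-r) * (r : ℝ) ^ n / n.factorial * en c ^ n =
      Real.exp (-r) * ((r * en c) ^ n / n.factorial) := fun n => by
    rw [mul_pow]; ring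
  simp_rw [h3]
  rw [tsum_mul_left, ← congrFun NormedSpace.exp_eq_tsum_div, ← Real.exp_eq_exp_ℝ, ← Real.exp_add]
  congr 1
  ring

lemma IsPoissonProcess.integral_en_mul_countIn (hX : IsPoissonProcess P X Λ) {A : Set ℂ}
    (hA : MeasurableSet A) (hfin : Λ A ≠ ∞) (c : ℝ≥0∞) :
    ∫ ω, en (c * countIn X A ω) ∂P = en (ENNReal.ofReal (1 - en c) * Λ A) := by
  have hm : Measurable fun x : ℝ≥0∞ => en (c * x) :=
    measurable_en.comp (measurable_const.mul measurable_id)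
  have h := integral_map (μ := P) (measurable_countIn hX.measurable hA).aemeasurable
    (f := fun x => en (c * x)) hm.aestronglyMeasurable
  rw [← h, hX.law A hA hfin.lt_top, integral_map (measurable_of_countable _).aemeasurable
    hm.aestronglyMeasurable, integral_en_mul_natCast_poissonMeasure, ENNReal.coe_toNNReal hfin]

-- Grouping the points by the value of `v` leaves only counts in finitely many disjoint sets, the
-- objects governed by `law` and `indep`.
omit [MeasurableSpace Ω] in
lemma tsum_simpleFunc_eq (v : SimpleFunc ℂ ℝ≥0∞) (ω : Ω) :
    ∑' i, v (X i ω) = ∑ c ∈ v.range, c * countIn X (v ⁻¹' {c}) ω := by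
  classical
  have h : ∀ x, v x = ∑ c ∈ v.range, c * (v ⁻¹' {c}).indicator (fun _ => (1 : ℝ≥0∞)) x := by
    intro x
    rw [Finset.sum_eq_single (v x)]
    · simp
    · intro c _ hc
      simp [Set.indicator, hc.symm]
    · intro hx
      exact absurd (v.mem_range_self x) hx
  simp_rw [countIn, ← ENNReal.tsum_mul_left]
  rw [← Summable.tsum_finsetSum fun _ _ => ENNReal.summable]
  exact tsum_congr fun i => h _

lemma IsPoissonProcess.integral_en_tsum_simpleFunc [IsProbabilityMeasure P]
    (hX : IsPoissonProcess P X Λ)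
    (v : SimpleFunc ℂ ℝ≥0∞) (hv : ∀ c, c ≠ 0 → Λ (v ⁻¹' {c}) ≠ ∞) :
    ∫ ω, en (∑' i, v (X i ω)) ∂P = en (∫⁻ x, ENNReal.ofReal (1 - en (v x)) ∂Λ) := by
  classical
  -- `indep` speaks of families over `Fin n`, so the fibres of `v` are enumerated.
  let n := v.range.card
  let e : Fin n ≃ v.range := v.range.equivFin.symm
  have hprod : ∀ {M : Type} [CommMonoid M] (f : ℝ≥0∞ → M),
      ∏ c ∈ v.range, f c = ∏ k : Fin n, f (e k) := by
    intro M _ f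
    rw [← Finset.prod_coe_sort]
    exact (Equiv.prod_comp e fun c => f c).symm
  have hmeas : ∀ k : Fin n, MeasurableSet (v ⁻¹' {(e k : ℝ≥0∞)}) :=
    fun k => v.measurableSet_fiber _
  have hind := hX.indep n (fun k => v ⁻¹' {(e k : ℝ≥0∞)}) hmeas (by
    intro k l hkl
    apply Disjoint.preimage
    rw [Set.disjoint_singleton]
    exact fun h => hkl (e.injective (Subtype.ext h)))
  have hind2 := hind.comp (fun k x => en ((e k : ℝ≥0∞) * x)) fun k =>
    measurable_en.comp (measurable_const.mul measurable_id)
  have hm : ∀ k, AEStronglyMeasurable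
      ((fun x => en ((e k : ℝ≥0∞) * x)) ∘ countIn X (v ⁻¹' {(e k : ℝ≥0∞)})) P := fun k =>
    ((measurable_en.comp (measurable_const.mul measurable_id)).comp
      (measurable_countIn hX.measurable (hmeas k))).aestronglyMeasurable
  have h1 := hind2.integral_fun_prod_eq_prod_integral hm
  simp_rw [tsum_simpleFunc_eq, en_sum, hprod]
  simp only [Function.comp_apply] at h1
  rw [h1]
  have h2 : ∫⁻ x, ENNReal.ofReal (1 - en (v x)) ∂Λ =
      ∑ c ∈ v.range, ENNReal.ofReal (1 - en c) * Λ (v ⁻¹' {c}) := by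
    rw [← SimpleFunc.map_lintegral (fun c => ENNReal.ofReal (1 - en c)),
      ← SimpleFunc.lintegral_eq_lintegral]
    rfl
  rw [h2, en_sum, hprod]
  refine Finset.prod_congr rfl fun k _ => ?_
  -- The fibre over `0` may have infinite measure, but its factor is 1 on both sides.
  by_cases hc : (e k : ℝ≥0∞) = 0
  · simp [hc]
  · exact hX.integral_en_mul_countIn (hmeas k) (hv _ hc) _

lemma tendsto_tsum_of_monotone {a : ℕ → ℕ → ℝ≥0∞} {b : ℕ → ℝ≥0∞}
    (hmono : ∀ i, Monotone fun n => a n i)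
    (h : ∀ i, Tendsto (fun n => a n i) atTop (𝓝 (b i))) :
    Tendsto (fun n => ∑' i, a n i) atTop (𝓝 (∑' i, b i)) := by
  simp_rw [← lintegral_count]
  exact lintegral_tendsto_of_tendsto_of_monotone
    (fun n => (measurable_of_countable _).aemeasurable)
    (Eventually.of_forall hmono) (Eventually.of_forall h)

/-- The Laplace functional of a Poisson point process. -/
theorem IsPoissonProcess.integral_en_tsum [IsProbabilityMeasure P] [IsLocallyFiniteMeasure Λ]
    (hX : IsPoissonProcess P X Λ) {v : ℂ → ℝ≥0∞} (hv : Measurable v) :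
    ∫ ω, en (∑' i, v (X i ω)) ∂P = en (∫⁻ x, ENNReal.ofReal (1 - en (v x)) ∂Λ) := by
  -- Cutting off outside a ball gives all nonzero fibres finite measure.
  let vn : ℕ → SimpleFunc ℂ ℝ≥0∞ := fun n =>
    (SimpleFunc.eapprox v n).restrict (Metric.ball 0 n)
  have hvn : ∀ n x, vn n x = (Metric.ball (0 : ℂ) n).indicator (SimpleFunc.eapprox v n) x := by
    intro n x
    exact SimpleFunc.restrict_apply _ measurableSet_ball x
  have hmono : ∀ x, Monotone fun n => vn n x := by
    intro x m n hmn
    simp only [hvn]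
    refine (Set.indicator_le_indicator_of_subset 
      (Metric.ball_subset_ball (Nat.cast_le.2 hmn)) (fun _ => zero_le) x).trans ?_
    exact Set.indicator_le_indicator (SimpleFunc.monotone_eapprox v hmn x)
  have hlim : ∀ x, Tendsto (fun n => vn n x) atTop (𝓝 (v x)) := by
    intro x
    refine (SimpleFunc.tendsto_eapprox hv x).congr' ?_
    obtain ⟨N, hN⟩ := exists_nat_gt ‖x‖
    filter_upwards [eventually_ge_atTop N] with n hn
    rw [hvn, Set.indicator_of_mem]
    simpa using hN.trans_le (by exact_mod_cast hn)
  have hfin : ∀ n c, c ≠ 0 → Λ (vn n ⁻¹' {c}) ≠ ∞ := by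
    intro n c hc
    refine ((measure_mono ?_).trans_lt (measure_ball_lt_top (x := (0 : ℂ)) (r := n))).ne
    intro x hx
    by_contra h
    rw [Set.mem_preimage, hvn, Set.indicator_of_notMem h] at hx
    exact hc hx.symm
  have hL : Tendsto (fun n => ∫ ω, en (∑' i, vn n (X i ω)) ∂P) atTop
      (𝓝 (∫ ω, en (∑' i, v (X i ω)) ∂P)) := by
    refine tendsto_integral_en
      (fun n => Measurable.tsum fun i => (vn n).measurable.comp (hX.measurable i)) ?_
    exact Eventually.of_forall fun ω =>
      tendsto_tsum_of_monotone (fun i => hmono _) fun i => hlim _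
  have hR : Tendsto (fun n => en (∫⁻ x, ENNReal.ofReal (1 - en (vn n x)) ∂Λ)) atTop
      (𝓝 (en (∫⁻ x, ENNReal.ofReal (1 - en (v x)) ∂Λ))) := by
    refine (continuous_en.tendsto _).comp (lintegral_tendsto_of_tendsto_of_monotone
      (fun n => ((measurable_const.sub
        (measurable_en.comp (vn n).measurable)).ennreal_ofReal).aemeasurable)
      (Eventually.of_forall fun x m n hmn => ?_) (Eventually.of_forall fun x => ?_))
    · exact ENNReal.ofReal_le_ofReal (sub_le_sub_left (en_antitone (hmono x hmn)) _)
    · exact (ENNReal.continuous_ofReal.tendsto _).comp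
        (((continuous_en.tendsto _).comp (hlim x)).const_sub 1)
  refine tendsto_nhds_unique hL (hR.congr fun n => ?_)
  exact (hX.integral_en_tsum_simpleFunc (vn n) (hfin n)).symm

end Poisson

/-! ### Laplace functional of the base stations marked by their LOS states. -/

section Marks

variable {Ω : Type*} [MeasurableSpace Ω] {P : Measure Ω} [IsProbabilityMeasure P] {p : Params}
  {X : ℕ → Ω → ℂ} {los : ℕ → Ω → Bool} {F : ℕ → Ω → ℝ}

omit [IsProbabilityMeasure P] in
lemma IsNetwork.measurable_locations (hnet : IsNetwork P p X los F) :
    Measurable fun ω i => X i ω :=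
  measurable_pi_lambda _ hnet.poisson.measurable

lemma Params.Admissible.measurable_h_norm (hp : p.Admissible) : Measurable fun x : ℂ => p.h ‖x‖ :=
  hp.h_measurable.comp measurable_norm

omit [IsProbabilityMeasure P] in
lemma IsNetwork.integral_mul_prod_los (hnet : IsNetwork P p X los F) (hp : p.Admissible)
    {φ : (ℕ → ℂ) → ℝ} (hφ : Measurable φ) (s : Finset ℕ) :
    ∫ ω, φ (fun i => X i ω) * ∏ i ∈ s, (if los i ω = true then 1 else 0) ∂P =
      ∫ ω, φ (fun i => X i ω) * ∏ i ∈ s, p.h ‖X i ω‖ ∂P := by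
  have hX := hnet.measurable_locations
  have hE : MeasurableSet {ω | ∀ i ∈ s, los i ω = true} := by
    have : {ω | ∀ i ∈ s, los i ω = true} = ⋂ i ∈ s, los i ⁻¹' {true} := by
      ext; simp
    rw [this]
    exact Finset.measurableSet_biInter _ fun i _ => hnet.los_measurable i (measurableSet_singleton _)
  have hD : Measurable fun ω => ∏ i ∈ s, ENNReal.ofReal (p.h ‖X i ω‖) :=
    Finset.measurable_fun_prod _ fun i _ =>
      (hp.measurable_h_norm.comp (hnet.poisson.measurable i)).ennreal_ofReal
  -- `los_law`, read as an equality of measures on location sequences: restricting to the LOS event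
  -- has the effect of a density. It then passes from sets to the function `φ`.
  have key : (P.restrict {ω | ∀ i ∈ s, los i ω = true}).map (fun ω i => X i ω) =
      (P.withDensity fun ω => ∏ i ∈ s, ENNReal.ofReal (p.h ‖X i ω‖)).map (fun ω i => X i ω) := by
    ext B hB
    rw [Measure.map_apply hX hB, Measure.map_apply hX hB, Measure.restrict_apply (hX hB),
      withDensity_apply _ (hX hB)]
    exact hnet.los_law B s hB
  have h1 := congrArg (fun μ => ∫ y, φ y ∂μ) key
  beta_reduce at h1
  rw [integral_map hX.aemeasurable hφ.aestronglyMeasurable,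
    integral_map hX.aemeasurable hφ.aestronglyMeasurable,
    integral_withDensity_eq_integral_toReal_smul hD
      (Eventually.of_forall fun ω => ENNReal.prod_lt_top fun i _ => ENNReal.ofReal_lt_top),
    ← integral_indicator hE] at h1
  convert h1 using 2 with ω
  · funext ω
    by_cases h : ω ∈ {ω | ∀ i ∈ s, los i ω = true}
    · rw [Set.indicator_of_mem h, Finset.prod_eq_one fun i hi => if_pos (h i hi), mul_one]
    · rw [Set.indicator_of_notMem h]
      simp only [Set.mem_ofPred_eq, not_forall] at h
      obtain ⟨i, hi, hi'⟩ := h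
      rw [Finset.prod_eq_zero hi (if_neg hi'), mul_zero]
  · funext ω
    rw [ENNReal.toReal_prod, smul_eq_mul, mul_comm]
    congr 1
    exact Finset.prod_congr rfl fun i _ =>
      (ENNReal.toReal_ofReal (hp.h_nonneg _ (norm_nonneg _))).symm

/-- The mean of `exp (-v)` over the LOS state of a link to `x`. -/
noncomputable def Params.markMean (p : Params) (v : ℂ × Bool → ℝ≥0∞) (x : ℂ) : ℝ :=
  p.h ‖x‖ * en (v (x, true)) + (1 - p.h ‖x‖) * en (v (x, false))

lemma measurable_markMean (hp : p.Admissible) {v : ℂ × Bool → ℝ≥0∞} (hv : Measurable v) :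
    Measurable (p.markMean v) :=
  (hp.measurable_h_norm.mul (measurable_en.comp (hv.comp (by fun_prop)))).add
    ((measurable_const.sub hp.measurable_h_norm).mul
      (measurable_en.comp (hv.comp (by fun_prop))))

lemma markMean_nonneg (hp : p.Admissible) (v : ℂ × Bool → ℝ≥0∞) (x : ℂ) : 0 ≤ p.markMean v x :=
  add_nonneg (mul_nonneg (hp.h_nonneg _ (norm_nonneg _)) (en_nonneg _))
    (mul_nonneg (sub_nonneg.2 (hp.h_le_one _ (norm_nonneg _))) (en_nonneg _))

lemma markMean_le_one (hp : p.Admissible) (v : ℂ × Bool → ℝ≥0∞) (x : ℂ) : p.markMean v x ≤ 1 := by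
  have h0 := hp.h_nonneg _ (norm_nonneg x)
  have h1 := hp.h_le_one _ (norm_nonneg x)
  unfold Params.markMean
  nlinarith [en_le_one (v (x, true)), en_le_one (v (x, false))]

/-- Each factor is affine in the LOS indicator, `a (X i) * 1_LOS + b (X i)`. Expanding over subsets
leaves products of LOS indicators only, whose conditional means are products of `h`; the right-hand
side has the same expansion with `h` in place of the indicator. -/
lemma IsNetwork.integral_prod_en (hnet : IsNetwork P p X los F) (hp : p.Admissible)
    {v : ℂ × Bool → ℝ≥0∞} (hv : Measurable v) (s : Finset ℕ) :
    ∫ ω, ∏ i ∈ s, en (v (X i ω, los i ω)) ∂P = ∫ ω, ∏ i ∈ s, p.markMean v (X i ω) ∂P := by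
  classical
  let a : ℂ → ℝ := fun x => en (v (x, true)) - en (v (x, false))
  let b : ℂ → ℝ := fun x => en (v (x, false))
  have hb : Measurable b := measurable_en.comp (hv.comp (by fun_prop))
  have ha : Measurable a := (measurable_en.comp (hv.comp (by fun_prop))).sub hb
  have ha1 : ∀ x, |a x| ≤ 1 := fun x => by
    rw [abs_le]
    constructor <;> simp only [a] <;>
      linarith [en_nonneg (v (x, true)), en_nonneg (v (x, false)), en_le_one (v (x, true)),
        en_le_one (v (x, false))]
  have hb1 : ∀ x, |b x| ≤ 1 := fun x => abs_en_le _
  let φ : Finset ℕ → (ℕ → ℂ) → ℝ := fun t y => (∏ i ∈ t, a (y i)) * ∏ i ∈ s \ t, b (y i)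
  have hφ : ∀ t, Measurable (φ t) := fun t =>
    (Finset.measurable_fun_prod _ fun i _ => ha.comp (measurable_pi_apply i)).mul
      (Finset.measurable_fun_prod _ fun i _ => hb.comp (measurable_pi_apply i))
  have hprod1 : ∀ (t : Finset ℕ) (f : ℕ → ℝ), (∀ i, |f i| ≤ 1) → |∏ i ∈ t, f i| ≤ 1 := by
    intro t f hf
    rw [Finset.abs_prod]
    exact Finset.prod_le_one (fun _ _ => abs_nonneg _) fun i _ => hf i
  have hφ1 : ∀ t y, |φ t y| ≤ 1 := fun t y => by
    rw [abs_mul]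
    exact mul_le_one₀ (hprod1 _ _ fun i => ha1 _) (abs_nonneg _) (hprod1 _ _ fun i => hb1 _)
  have hX := hnet.measurable_locations
  have hexp : ∀ (u : ℕ → Ω → ℝ) (f : ℕ → Ω → ℝ),
      (∀ i ω, f i ω = a (X i ω) * u i ω + b (X i ω)) → (∀ i, Measurable (u i)) →
      (∀ i ω, |u i ω| ≤ 1) →
      ∫ ω, ∏ i ∈ s, f i ω ∂P =
        ∑ t ∈ s.powerset, ∫ ω, φ t (fun i => X i ω) * ∏ i ∈ t, u i ω ∂P := by
    intro u f hf hu hu1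
    rw [← integral_finsetSum]
    · congr 1
      funext ω
      simp_rw [hf, Finset.prod_add]
      refine Finset.sum_congr rfl fun t _ => ?_
      rw [Finset.prod_mul_distrib]
      simp only [φ]
      ring
    · intro t _
      refine Integrable.of_bound (((hφ t).comp hX).mul
        (Finset.measurable_fun_prod _ fun i _ => hu i)).aestronglyMeasurable 1
        (Eventually.of_forall fun ω => ?_)
      rw [Real.norm_eq_abs, abs_mul]
      exact mul_le_one₀ (hφ1 _ _) (abs_nonneg _) (hprod1 _ _ fun i => hu1 _ _)
  rw [hexp (fun i ω => if los i ω = true then 1 else 0), hexp (fun i ω => p.h ‖X i ω‖)]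
  · exact Finset.sum_congr rfl fun t _ => hnet.integral_mul_prod_los hp (hφ t) t
  · intro i ω
    simp only [a, b, Params.markMean]
    ring
  · exact fun i => hp.measurable_h_norm.comp (hnet.poisson.measurable i)
  · intro i ω
    rw [abs_of_nonneg (hp.h_nonneg _ (norm_nonneg _))]
    exact hp.h_le_one _ (norm_nonneg _)
  · intro i ω
    cases h : los i ω <;> simp [a, b]
  · exact fun i => Measurable.ite (hnet.los_measurable i (measurableSet_singleton _))
      measurable_const measurable_const
  · intro i ω
    split_ifs <;> simp

omit [IsProbabilityMeasure P] in
lemma measurable_marked (hnet : IsNetwork P p X los F) (i : ℕ) :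
    Measurable fun ω => (X i ω, los i ω) :=
  (hnet.poisson.measurable i).prodMk (hnet.los_measurable i)

/-- The Laplace functional of the base stations marked by their LOS states. -/
theorem IsNetwork.integral_en_tsum (hnet : IsNetwork P p X los F) (hp : p.Admissible)
    {v : ℂ × Bool → ℝ≥0∞} (hv : Measurable v) :
    ∫ ω, en (∑' i, v (X i ω, los i ω)) ∂P =
      en (ENNReal.ofReal p.lam * ∫⁻ x, ENNReal.ofReal (1 - p.markMean v x)) := by
  -- Averaging over the mark replaces the marked weight by the unmarked weight `-log (markMean v
  -- x)`, with value `∞` where the mean vanishes; the unmarked Laplace functional then applies.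
  have hm : Measurable fun x => enInv (p.markMean v x) :=
    measurable_enInv.comp (measurable_markMean hp hv)
  have hen : ∀ x, en (enInv (p.markMean v x)) = p.markMean v x := fun x =>
    en_enInv (markMean_nonneg hp v x) (markMean_le_one hp v x)
  have : IsLocallyFiniteMeasure (ENNReal.ofReal p.lam • (volume : Measure ℂ)) :=
    ⟨fun x => ⟨Metric.ball x 1, Metric.ball_mem_nhds x one_pos, by
      rw [Measure.smul_apply, smul_eq_mul]
      exact ENNReal.mul_lt_top ENNReal.ofReal_lt_top measure_ball_lt_top⟩⟩
  have h1 := hnet.poisson.integral_en_tsum hm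
  simp_rw [hen] at h1
  rw [lintegral_smul_measure, smul_eq_mul] at h1
  rw [← h1]
  -- Conditional independence is available for finitely many links, so both sides are taken as
  -- limits of partial sums along the enumeration.
  have hL := tendsto_integral_en (P := P) (f := fun n ω => ∑ i ∈ Finset.range n, v (X i ω, los i ω))
    (g := fun ω => ∑' i, v (X i ω, los i ω))
    (fun n => Finset.measurable_fun_sum _ fun i _ => hv.comp (measurable_marked hnet i))
    (Eventually.of_forall fun ω => ENNReal.tendsto_nat_tsum _)
  have hR := tendsto_integral_en (P := P)
    (f := fun n ω => ∑ i ∈ Finset.range n, enInv (p.markMean v (X i ω)))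
    (g := fun ω => ∑' i, enInv (p.markMean v (X i ω)))
    (fun n => Finset.measurable_fun_sum _ fun i _ => hm.comp (hnet.poisson.measurable i))
    (Eventually.of_forall fun ω => ENNReal.tendsto_nat_tsum _)
  refine tendsto_nhds_unique hL (hR.congr fun n => ?_)
  simp_rw [en_sum, hen]
  exact (hnet.integral_prod_en hp hv _).symm

end Marks

/-! ### Geometry of the sectors and integration over them. -/

section Sectors

variable {p : Params}

lemma Params.Admissible.K_pos (hp : p.Admissible) : 0 < p.K := lt_max_of_lt_left hp.Mcs_pos

/-- The polar angle in `[0, 2π)`. -/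
noncomputable def polarAngle (x : ℂ) : ℝ :=
  if x.arg < 0 then x.arg + 2 * Real.pi else x.arg

lemma polarAngle_mem (x : ℂ) : polarAngle x ∈ Set.Ico 0 (2 * Real.pi) := by
  have h1 := Complex.neg_pi_lt_arg x
  have h2 := Complex.arg_le_pi x
  have h3 := Real.pi_pos
  unfold polarAngle
  split_ifs with h <;> constructor <;> linarith

lemma measurable_polarAngle : Measurable polarAngle :=
  Measurable.ite (measurableSet_lt Complex.measurable_arg measurable_const)
    (Complex.measurable_arg.add_const _) Complex.measurable_arg

lemma norm_mul_exp_polarAngle (x : ℂ) :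
    (‖x‖ : ℂ) * Complex.exp (polarAngle x * Complex.I) = x := by
  have h : Complex.exp (polarAngle x * Complex.I) = Complex.exp (x.arg * Complex.I) := by
    unfold polarAngle
    split_ifs
    · push_cast
      rw [add_mul, Complex.exp_add, Complex.exp_two_pi_mul_I, mul_one]
    · rfl
  rw [h, Complex.norm_mul_exp_arg_mul_I]

/-- Two admissible angles differ by a multiple of `2π` while both lie in an interval of length `2π`.
-/
lemma eq_polarAngle {x : ℂ} (hx : x ≠ 0) {θ : ℝ} (hθ : θ ∈ Set.Ico 0 (2 * Real.pi))
    (h : x = ‖x‖ * Complex.exp (θ * Complex.I)) : θ = polarAngle x := by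
  have hn : (‖x‖ : ℂ) ≠ 0 := by simpa using hx
  have h1 := (norm_mul_exp_polarAngle x).trans h
  have h2 := mul_left_cancel₀ hn h1
  rw [Complex.exp_eq_exp_iff_exists_int] at h2
  obtain ⟨n, hn⟩ := h2
  have h3 : (polarAngle x : ℂ) = θ + n * (2 * Real.pi) := by
    apply mul_right_cancel₀ Complex.I_ne_zero
    rw [hn]; ring
  have h4 : polarAngle x = θ + n * (2 * Real.pi) := by exact_mod_cast h3
  have h5 := polarAngle_mem x
  have hpi := Real.pi_pos
  have h6 : n = 0 := by
    rcases lt_trichotomy n 0 with hneg | h0 | hpos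
    · have : (n : ℝ) ≤ -1 := by exact_mod_cast Int.le_sub_one_of_lt hneg
      nlinarith [h5.1, hθ.2]
    · exact h0
    · have : (1 : ℝ) ≤ n := by exact_mod_cast hpos
      nlinarith [h5.2, hθ.1]
  rw [h4, h6]; simp

lemma mem_bsSector_iff {j : Fin p.K} {x : ℂ} :
    x ∈ p.bsSector j ↔ x ≠ 0 ∧ polarAngle x ∈
      Set.Ico (2 * Real.pi * (j : ℝ) / p.K) (2 * Real.pi * ((j : ℝ) + 1) / p.K) := by
  have hK : (0 : ℝ) < p.K := by exact_mod_cast (Nat.zero_le _).trans_lt j.2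
  have hpi := Real.pi_pos
  have hj : ((j : ℕ) : ℝ) + 1 ≤ p.K := by exact_mod_cast j.2
  have h2 : 2 * Real.pi * ((j : ℝ) + 1) / p.K ≤ 2 * Real.pi := by
    rw [div_le_iff₀ hK]
    exact mul_le_mul_of_nonneg_left hj (by positivity)
  simp only [Params.bsSector, sector, Set.mem_ofPred_eq, sub_zero]
  refine and_congr_right fun hx => ⟨?_, fun h => ⟨_, h, (norm_mul_exp_polarAngle x).symm⟩⟩
  rintro ⟨θ, hθ, h⟩
  rwa [← eq_polarAngle hx ⟨le_trans (by positivity) hθ.1, hθ.2.trans_le h2⟩ h]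

lemma measurableSet_bsSector (j : Fin p.K) : MeasurableSet (p.bsSector j) := by
  have : p.bsSector j = {0}ᶜ ∩ polarAngle ⁻¹'
      Set.Ico (2 * Real.pi * (j : ℝ) / p.K) (2 * Real.pi * ((j : ℝ) + 1) / p.K) := by
    ext x
    exact mem_bsSector_iff
  rw [this]
  exact (measurableSet_singleton _).compl.inter (measurable_polarAngle measurableSet_Ico)

/-- The index of the sector is a floor, hence a function of the point: this makes the sectors
disjoint and lets them cover the punctured plane. -/
lemma mem_bsSector_iff_floor {j : Fin p.K} {x : ℂ} :
    x ∈ p.bsSector j ↔ x ≠ 0 ∧ ⌊polarAngle x * p.K / (2 * Real.pi)⌋₊ = j := by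
  have hK : (0 : ℝ) < p.K := by exact_mod_cast (Nat.zero_le _).trans_lt j.2
  have hpi := Real.pi_pos
  have h0 := (polarAngle_mem x).1
  rw [mem_bsSector_iff, Nat.floor_eq_iff (by positivity)]
  refine and_congr_right fun _ => and_congr ?_ ?_
  · rw [div_le_iff₀ hK, le_div_iff₀ (by positivity), mul_comm (2 * Real.pi)]
  · rw [lt_div_iff₀ hK, div_lt_iff₀ (by positivity), mul_comm (2 * Real.pi)]

lemma bsSector_unique {i j : Fin p.K} {x : ℂ} (hi : x ∈ p.bsSector i) (hj : x ∈ p.bsSector j) :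
    i = j := by
  rw [mem_bsSector_iff_floor] at hi hj
  exact Fin.ext (hi.2.symm.trans hj.2)

lemma pairwise_disjoint_bsSector : Pairwise (Function.onFun Disjoint (p.bsSector)) :=
  fun _ _ hij => Set.disjoint_left.2 fun _ hi hj => hij (bsSector_unique hi hj)

lemma iUnion_bsSector (hK : 0 < p.K) : ⋃ j, p.bsSector j = {0}ᶜ := by
  ext x
  simp only [Set.mem_iUnion, mem_bsSector_iff_floor, Set.mem_compl_iff, Set.mem_singleton_iff]
  refine ⟨fun ⟨j, h, _⟩ => h, fun h => ⟨⟨⌊polarAngle x * p.K / (2 * Real.pi)⌋₊, ?_⟩, h, rfl⟩⟩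
  have hK' : (0 : ℝ) < p.K := by exact_mod_cast hK
  have hx := polarAngle_mem x
  have hpi := Real.pi_pos
  rw [Nat.floor_lt (by have := hx.1; positivity), div_lt_iff₀ (by positivity), mul_comm]
  exact mul_lt_mul_of_pos_left hx.2 hK'

lemma lintegral_eq_sum_bsSector (hK : 0 < p.K) (f : ℂ → ℝ≥0∞) :
    ∫⁻ x, f x = ∑ j, ∫⁻ x in p.bsSector j, f x := by
  rw [← tsum_fintype (L := .unconditional _),
    ← lintegral_iUnion measurableSet_bsSector pairwise_disjoint_bsSector,
    iUnion_bsSector hK, Measure.restrict_eq_self_of_ae_mem]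
  exact compl_mem_ae_iff.2 (measure_singleton 0)

lemma rotate_mem_bsSector_iff (hK : 0 < p.K) (j : Fin p.K) (x : ℂ) :
    Complex.exp ((2 * Real.pi * (j : ℝ) / p.K : ℝ) * Complex.I) * x ∈ p.bsSector j ↔
      x ∈ p.bsSector ⟨0, hK⟩ := by
  simp only [Params.bsSector, sector, Set.mem_ofPred_eq, sub_zero, norm_mul,
    Complex.norm_exp_ofReal_mul_I, one_mul, ne_eq, mul_eq_zero, Complex.exp_ne_zero, false_or]
  refine and_congr_right fun hx => ⟨?_, ?_⟩
  · rintro ⟨θ, hθ, h⟩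
    refine ⟨θ - 2 * Real.pi * (j : ℝ) / p.K, ?_, ?_⟩
    · simp only [Set.mem_Ico, CharP.cast_eq_zero] at hθ ⊢
      have : 2 * Real.pi * ((j : ℝ) + 1) / p.K =
        2 * Real.pi * (j : ℝ) / p.K + 2 * Real.pi * (0 + 1) / p.K := by ring
      constructor
      · have h1 := hθ.1
        simp only [mul_zero, zero_div]
        linarith
      · have h1 := hθ.2
        linarith
    · apply mul_left_cancel₀ (Complex.exp_ne_zero
        ((2 * Real.pi * (j : ℝ) / p.K : ℝ) * Complex.I))
      rw [h, mul_left_comm, ← Complex.exp_add]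
      congr 2
      push_cast
      ring
  · rintro ⟨θ, hθ, h⟩
    refine ⟨θ + 2 * Real.pi * (j : ℝ) / p.K, ?_, ?_⟩
    · simp only [Set.mem_Ico, CharP.cast_eq_zero] at hθ ⊢
      have : 2 * Real.pi * ((j : ℝ) + 1) / p.K =
        2 * Real.pi * (j : ℝ) / p.K + 2 * Real.pi * (0 + 1) / p.K := by ring
      constructor
      · have h1 := hθ.1
        simp only [mul_zero, zero_div] at h1
        linarith
      · have h1 := hθ.2
        linarith
    · conv_lhs => rw [h]
      rw [mul_left_comm, ← Complex.exp_add]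
      congr 2
      push_cast
      ring

lemma setLIntegral_bsSector_eq (hK : 0 < p.K) (j : Fin p.K) (f : ℝ → ℝ≥0∞) :
    ∫⁻ x in p.bsSector j, f ‖x‖ = ∫⁻ x in p.bsSector ⟨0, hK⟩, f ‖x‖ := by
  let R := rotation (Circle.exp (2 * Real.pi * (j : ℝ) / p.K))
  have hR := R.measurePreserving
  rw [← hR.setLIntegral_comp_preimage_emb
    (R.toHomeomorph.toMeasurableEquiv.measurableEmbedding)]
  have hpre : R ⁻¹' p.bsSector j = p.bsSector ⟨0, hK⟩ := by
    ext x
    rw [Set.mem_preimage, rotation_apply, Circle.coe_exp]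
    exact rotate_mem_bsSector_iff hK j x
  rw [hpre]
  simp_rw [LinearIsometryEquiv.norm_map]

lemma lintegral_norm_complex {f : ℝ → ℝ≥0∞} (hf : Measurable f) :
    ∫⁻ x : ℂ, f ‖x‖ = ENNReal.ofReal (2 * Real.pi) *
      ∫⁻ r in Set.Ioi (0 : ℝ), ENNReal.ofReal r * f r := by
  rw [← Complex.lintegral_comp_polarCoord_symm]
  simp_rw [Complex.norm_polarCoord_symm, smul_eq_mul]
  have ht : polarCoord.target = Set.Ioi (0 : ℝ) ×ˢ Set.Ioo (-Real.pi) Real.pi := rfl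
  rw [ht, Measure.volume_eq_prod, setLIntegral_prod _ (by fun_prop)]
  simp only [lintegral_const, Measure.restrict_apply_univ, Real.volume_Ioo]
  rw [lintegral_mul_const _ (by fun_prop), mul_comm]
  congr 1
  · congr 1; ring
  · refine setLIntegral_congr_fun measurableSet_Ioi fun r hr => ?_
    rw [abs_of_pos hr]

/-- Integration of a radial function over a sector. -/
theorem setLIntegral_bsSector_norm (j : Fin p.K) {f : ℝ → ℝ≥0∞} (hf : Measurable f) :
    ∫⁻ x in p.bsSector j, f ‖x‖ = ENNReal.ofReal (2 * Real.pi / p.K) *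
      ∫⁻ r in Set.Ioi (0 : ℝ), ENNReal.ofReal r * f r := by
  have hK : 0 < p.K := (Nat.zero_le _).trans_lt j.2
  -- The `K` sectors are rotations of each other, so each carries the fraction `1 / K` of the planar
  -- integral in polar coordinates.
  have h1 := lintegral_eq_sum_bsSector hK fun x => f ‖x‖
  rw [lintegral_norm_complex hf, Finset.sum_congr rfl fun i _ => setLIntegral_bsSector_eq hK i f,
    Finset.sum_const, Finset.card_univ, Fintype.card_fin, nsmul_eq_mul,
    ← setLIntegral_bsSector_eq hK j] at h1
  have hK0 : (p.K : ℝ≥0∞) ≠ 0 := by exact_mod_cast hK.ne'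
  rw [ENNReal.ofReal_div_of_pos (by exact_mod_cast hK), ENNReal.ofReal_natCast,
    ENNReal.div_eq_inv_mul, mul_assoc, h1, ← mul_assoc,
    ENNReal.inv_mul_cancel hK0 (ENNReal.natCast_ne_top _), one_mul]

/-! ### Joint Laplace functional of the path losses in the sectors. -/

section Laplace

variable {Ω : Type*} [MeasurableSpace Ω] {P : Measure Ω} [IsProbabilityMeasure P]
  {X : ℕ → Ω → ℂ} {los : ℕ → Ω → Bool} {F : ℕ → Ω → ℝ}

/-- Path loss, as a real number, of a link to `x` with LOS state `b`. -/
noncomputable def Params.loss (p : Params) (y : ℂ × Bool) : ℝ :=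
  if y.2 = true then p.lossL ‖y.1‖ else p.lossN ‖y.1‖

lemma measurable_lossL : Measurable p.lossL :=
  measurable_const.mul (measurable_id.pow_const _)

lemma measurable_lossN : Measurable p.lossN :=
  measurable_const.mul (measurable_id.pow_const _)

lemma measurable_loss : Measurable p.loss :=
  Measurable.ite (measurable_snd (measurableSet_singleton true))
    (measurable_lossL.comp measurable_fst.norm) (measurable_lossN.comp measurable_fst.norm)

/-- The sum of `w` over the path losses of the marked points `y` in sector `j`. -/
noncomputable def Params.sectorSum (p : Params) (j : Fin p.K) (w : ℝ → ℝ≥0∞)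
    (y : ℕ → ℂ × Bool) : ℝ≥0∞ :=
  ∑' i, (p.bsSector j).indicator (fun _ => w (p.loss (y i))) (y i).1

/-- The integral of `u` against the intensity of the path losses of all the base stations,
normalized by `2π λ`. -/
noncomputable def Params.lossIntegral (p : Params) (u : ℝ → ℝ) : ℝ≥0∞ :=
  (∫⁻ r in Set.Ioi (0 : ℝ), ENNReal.ofReal (u (p.lossL r) * p.h r * r)) +
    ∫⁻ r in Set.Ioi (0 : ℝ), ENNReal.ofReal (u (p.lossN r) * (1 - p.h r) * r)

lemma measurable_sectorSum (j : Fin p.K) {w : ℝ → ℝ≥0∞} (hw : Measurable w) :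
    Measurable (p.sectorSum j w) := by
  refine Measurable.tsum fun i => ?_
  have : (fun y : ℕ → ℂ × Bool =>
      (p.bsSector j).indicator (fun _ => w (p.loss (y i))) (y i).1) =
      {y | (y i).1 ∈ p.bsSector j}.indicator fun y => w (p.loss (y i)) := rfl
  rw [this]
  exact (hw.comp (measurable_loss.comp (measurable_pi_apply i))).indicator
    ((measurable_fst.comp (measurable_pi_apply i)) (measurableSet_bsSector j))

/-- Since `h + (1 - h) = 1`, one minus the mean over the mark splits into a LOS and an NLOS part,
the two integrals of `lossIntegral`. -/
lemma setLIntegral_bsSector_markMean (hp : p.Admissible) (j : Fin p.K) {w : ℝ → ℝ≥0∞}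
    (hw : Measurable w) :
    ∫⁻ x in p.bsSector j, ENNReal.ofReal (1 - p.markMean (fun y => w (p.loss y)) x) =
      ENNReal.ofReal (2 * Real.pi / p.K) * p.lossIntegral fun l => 1 - en (w l) := by
  have hm1 : Measurable fun r : ℝ => en (w (p.lossL r)) :=
    measurable_en.comp (hw.comp measurable_lossL)
  have hm2 : Measurable fun r : ℝ => en (w (p.lossN r)) :=
    measurable_en.comp (hw.comp measurable_lossN)
  have hh := hp.h_measurable
  have h := setLIntegral_bsSector_norm j (f := fun r => ENNReal.ofReal
    (1 - (p.h r * en (w (p.lossL r)) + (1 - p.h r) * en (w (p.lossN r))))) (by fun_prop)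
  simp only [Params.markMean, Params.loss, if_true, Bool.false_eq_true, if_false]
  rw [h, Params.lossIntegral, ← lintegral_add_left (by fun_prop)]
  congr 1
  refine setLIntegral_congr_fun measurableSet_Ioi fun r hr => ?_
  have hr0 : (0 : ℝ) < r := hr
  have h0 := hp.h_nonneg r hr0.le
  have h1 := hp.h_le_one r hr0.le
  have e1 := sub_nonneg.2 (en_le_one (w (p.lossL r)))
  have e2 := sub_nonneg.2 (en_le_one (w (p.lossN r)))
  have h1' := sub_nonneg.2 h1
  rw [← ENNReal.ofReal_mul hr0.le, ← ENNReal.ofReal_add (by positivity) (by positivity)]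
  congr 1
  ring

/-- Joint Laplace functional of the path losses in the sectors. In particular, the path losses
of different sectors are independent. -/
theorem IsNetwork.integral_prod_en_sectorSum (hnet : IsNetwork P p X los F) (hp : p.Admissible)
    {w : Fin p.K → ℝ → ℝ≥0∞} (hw : ∀ j, Measurable (w j)) :
    ∫ ω, ∏ j, en (p.sectorSum j (w j) fun i => (X i ω, los i ω)) ∂P =
      ∏ j, en (ENNReal.ofReal (2 * Real.pi * p.lam / p.K) *
        p.lossIntegral fun l => 1 - en (w j l)) := by
  -- One weight for all sectors at once: a point sees only the term of its own sector, so the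
  -- exponent splits into a sum over sectors and the expectation into a product.
  let v : ℂ × Bool → ℝ≥0∞ := fun y =>
    ∑ j, (p.bsSector j).indicator (fun _ => w j (p.loss y)) y.1
  have hv : Measurable v := by
    refine Finset.measurable_fun_sum _ fun j _ => ?_
    have : (fun y : ℂ × Bool => (p.bsSector j).indicator (fun _ => w j (p.loss y)) y.1) =
      {y | y.1 ∈ p.bsSector j}.indicator fun y => w j (p.loss y) := rfl
    rw [this]
    exact ((hw j).comp measurable_loss).indicator (measurable_fst (measurableSet_bsSector j))
  have hvj : ∀ j x b, x ∈ p.bsSector j → v (x, b) = w j (p.loss (x, b)) := by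
    intro j x b hx
    simp only [v]
    rw [Finset.sum_eq_single j, Set.indicator_of_mem hx]
    · intro i _ hij
      exact Set.indicator_of_notMem (fun hi => hij (bsSector_unique hi hx)) _
    · simp
  have h := hnet.integral_en_tsum hp hv
  rw [lintegral_eq_sum_bsSector hp.K_pos, Finset.mul_sum, en_sum] at h
  simp_rw [← en_sum]
  have hL : ∀ ω, ∑ j, p.sectorSum j (w j) (fun i => (X i ω, los i ω)) =
      ∑' i, v (X i ω, los i ω) := fun ω =>
    (Summable.tsum_finsetSum fun _ _ => ENNReal.summable).symm
  simp_rw [hL]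
  rw [h, en_sum]
  refine Finset.prod_congr rfl fun j _ => congrArg en ?_
  have hc : ∫⁻ x in p.bsSector j, ENNReal.ofReal (1 - p.markMean v x) =
      ∫⁻ x in p.bsSector j, ENNReal.ofReal (1 - p.markMean (fun y => w j (p.loss y)) x) :=
    setLIntegral_congr_fun (measurableSet_bsSector j) fun x hx => by
      simp only [Params.markMean, hvj j x _ hx]
  rw [hc, setLIntegral_bsSector_markMean hp j (hw j), ← mul_assoc,
    ← ENNReal.ofReal_mul hp.lam_pos.le]
  congr 2
  ring

end Laplace

end Sectors

end MmWave

/-! ### Chain rule for absolutely continuous functions. -/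

namespace MmWave

open Filter Topology Set

/-- A Lipschitz map enlarges each term of the defining sums by at most the factor `C`. -/
lemma absolutelyContinuousOnInterval_comp {f φ : ℝ → ℝ} {a b : ℝ} {s : Set ℝ} {C : ℝ≥0}
    (hφ : LipschitzOnWith C φ s) (hf : AbsolutelyContinuousOnInterval f a b)
    (hs : MapsTo f (uIcc a b) s) : AbsolutelyContinuousOnInterval (fun x => φ (f x)) a b := by
  unfold AbsolutelyContinuousOnInterval at hf ⊢
  refine squeeze_zero' (Eventually.of_forall fun _ => Finset.sum_nonneg fun _ _ => dist_nonneg)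
    ?_ (by simpa using hf.const_mul (C : ℝ))
  rw [eventually_inf_principal]
  refine Eventually.of_forall fun E hE => ?_
  rw [Finset.mul_sum]
  exact Finset.sum_le_sum fun i hi =>
    hφ.dist_le_mul _ (hs (hE.1 i hi).1) _ (hs (hE.1 i hi).2)

/-- Chain rule under the integral for an indefinite integral. -/
theorem integral_comp_integral_mul {φ φ' g : ℝ → ℝ} {a b c : ℝ}
    (hg : IntervalIntegrable g volume a b) (hφ : ∀ x, HasDerivAt φ (φ' x) x)
    (hφ' : Continuous φ') :
    ∫ x in a..b, φ' (c + ∫ t in a..x, g t) * g x = φ (c + ∫ t in a..b, g t) - φ c := by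
  have hI := hg.absolutelyContinuousOnInterval_intervalIntegral (left_mem_uIcc)
  have hI' : AbsolutelyContinuousOnInterval (fun x => c + ∫ t in a..x, g t) a b :=
    absolutelyContinuousOnInterval_comp (φ := fun y => c + y) (s := univ) (C := 1)
      (by apply LipschitzWith.lipschitzOnWith; exact LipschitzWith.of_dist_le_mul (by simp))
      hI (mapsTo_univ _ _)
  obtain ⟨R, hR⟩ := hI'.exists_bound
  have hC : ContDiff ℝ 1 φ := by
    rw [contDiff_one_iff_deriv]
    refine ⟨fun x => (hφ x).differentiableAt, ?_⟩
    have : deriv φ = φ' := funext fun x => (hφ x).deriv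
    rwa [this]
  -- The primitive stays in the compact interval `[-R, R]`, where the `C¹` function `φ` is
  -- Lipschitz; the composite is thus absolutely continuous and is the integral of its almost
  -- everywhere derivative.
  obtain ⟨C, hC⟩ := hC.contDiffOn.exists_lipschitzOnWith (s := Icc (-R) R) (by decide)
    (convex_Icc _ _) isCompact_Icc
  have hcomp := absolutelyContinuousOnInterval_comp hC hI' (fun x hx => by
    have := hR x hx
    rw [Real.norm_eq_abs] at this
    exact abs_le.1 this)
  have := hcomp.integral_deriv_eq_sub
  simp only [intervalIntegral.integral_same, add_zero] at this
  rw [← this]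
  apply intervalIntegral.integral_congr_ae
  filter_upwards [hg.ae_hasDerivAt_integral] with x hx hxm
  have h1 := hx (uIoc_subset_uIcc hxm) a left_mem_uIcc
  exact ((hφ _).comp x (h1.const_add c)).deriv.symm

/-! ### Change of variables from distance to path loss. -/

section PowerLaw

variable {β α : ℝ}

lemma mul_rpow_lt_iff (hβ : 0 < β) (hα : 0 < α) {r t : ℝ} (hr : 0 ≤ r) (ht : 0 ≤ t) :
    β * r ^ α < t ↔ r < (t / β) ^ (1 / α) := by
  rw [one_div, Real.lt_rpow_inv_iff_of_pos hr (by positivity) hα, lt_div_iff₀ hβ, mul_comm]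

lemma lt_mul_rpow_iff (hβ : 0 < β) (hα : 0 < α) {r t : ℝ} (hr : 0 ≤ r) (ht : 0 ≤ t) :
    t < β * r ^ α ↔ (t / β) ^ (1 / α) < r := by
  rw [one_div, Real.rpow_inv_lt_iff_of_pos (by positivity) hr hα, div_lt_iff₀ hβ, mul_comm]

lemma image_rpow_Ioo (hβ : 0 < β) (hα : 0 < α) {z : ℝ} (hz : 0 ≤ z) :
    (fun x : ℝ => (x / β) ^ (1 / α)) '' Set.Ioo 0 z = Set.Ioo 0 ((z / β) ^ (1 / α)) := by
  ext r
  constructor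
  · rintro ⟨x, hx, rfl⟩
    exact ⟨Real.rpow_pos_of_pos (div_pos hx.1 hβ) _,
      Real.rpow_lt_rpow (div_pos hx.1 hβ).le (div_lt_div_of_pos_right hx.2 hβ) (by positivity)⟩
  · intro hr
    have hr0 : 0 < r := hr.1
    refine ⟨β * r ^ α, ⟨by positivity, (mul_rpow_lt_iff hβ hα hr.1.le hz).2 hr.2⟩, ?_⟩
    simp only
    rw [mul_div_cancel_left₀ _ hβ.ne', ← Real.rpow_mul hr.1.le, mul_one_div_cancel hα.ne',
      Real.rpow_one]

lemma hasDerivAt_div_rpow (hβ : 0 < β) {x : ℝ} (hx : 0 < x) :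
    HasDerivAt (fun x : ℝ => (x / β) ^ (1 / α)) (1 / α * (x / β) ^ (1 / α - 1) / β) x := by
  have h := ((hasDerivAt_id x).div_const β).rpow_const (p := 1 / α)
    (Or.inl (div_pos hx hβ).ne')
  simp only [id] at h
  convert h using 1
  ring

lemma injOn_div_rpow (hβ : 0 < β) (hα : 0 < α) (z : ℝ) :
    Set.InjOn (fun x : ℝ => (x / β) ^ (1 / α)) (Set.Ioo 0 z) := by
  have : StrictMonoOn (fun x : ℝ => (x / β) ^ (1 / α)) (Set.Ioo 0 z) := fun x hx y _ hxy =>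
    Real.rpow_lt_rpow (div_pos hx.1 hβ).le (div_lt_div_of_pos_right hxy hβ) (by positivity)
  exact this.injOn

/-- The Jacobian: under `r = (x / β) ^ (1 / α)` the element `r dr` becomes `(1 / α) β ^ (-2 / α) x ^
(2 / α - 1) dx`. -/
lemma abs_deriv_mul_eq (hβ : 0 < β) (hα : 0 < α) (g : ℝ → ℝ) {x : ℝ} (hx : 0 < x) :
    |1 / α * (x / β) ^ (1 / α - 1) / β| • (g ((x / β) ^ (1 / α)) * (x / β) ^ (1 / α)) =
      1 / α * (1 / β) ^ (2 / α) * x ^ (2 / α - 1) * g ((x / β) ^ (1 / α)) := by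
  have hxβ := div_pos hx hβ
  rw [abs_of_pos (by positivity), smul_eq_mul]
  have h1 : (x / β) ^ (1 / α - 1) * (x / β) ^ (1 / α) / β =
      (1 / β) ^ (2 / α) * x ^ (2 / α - 1) := by
    rw [← Real.rpow_add hxβ, show 1 / α - 1 + 1 / α = 2 / α - 1 by ring, Real.rpow_sub hxβ,
      Real.rpow_one, Real.rpow_sub hx, Real.rpow_one, Real.div_rpow hx.le hβ.le,
      Real.div_rpow zero_le_one hβ.le, Real.one_rpow]
    field_simp
  calc _ = 1 / α * ((x / β) ^ (1 / α - 1) * (x / β) ^ (1 / α) / β) * g ((x / β) ^ (1 / α)) := by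
        ring
    _ = _ := by rw [h1]; ring

lemma integrableOn_mul_id {g : ℝ → ℝ} (hg : Measurable g) (h0 : ∀ r, 0 ≤ r → 0 ≤ g r)
    (h1 : ∀ r, 0 ≤ r → g r ≤ 1) (b : ℝ) : IntegrableOn (fun r => g r * r) (Set.Ioo 0 b) := by
  refine Measure.integrableOn_of_bounded (M := b) (by simp) (by fun_prop) ?_
  refine (ae_restrict_iff' measurableSet_Ioo).2 (Eventually.of_forall fun r hr => ?_)
  rw [Real.norm_eq_abs, abs_of_nonneg (mul_nonneg (h0 r hr.1.le) hr.1.le)]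
  exact (mul_le_of_le_one_left hr.1.le (h1 r hr.1.le)).trans hr.2.le

/-- The density of the path loss intensity of one type of links in one sector, without
the constant factor. -/
lemma integrableOn_powerLaw_density (hβ : 0 < β) (hα : 0 < α) {g : ℝ → ℝ} (hg : Measurable g)
    (h0 : ∀ r, 0 ≤ r → 0 ≤ g r) (h1 : ∀ r, 0 ≤ r → g r ≤ 1) {z : ℝ} (hz : 0 ≤ z) :
    IntegrableOn (fun x => 1 / α * (1 / β) ^ (2 / α) * x ^ (2 / α - 1) * g ((x / β) ^ (1 / α)))
      (Set.Ioo 0 z) := by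
  have h := integrableOn_mul_id hg h0 h1 ((z / β) ^ (1 / α))
  rw [← image_rpow_Ioo hβ hα hz, integrableOn_image_iff_integrableOn_abs_deriv_smul
    measurableSet_Ioo (fun x hx => (hasDerivAt_div_rpow hβ hx.1).hasDerivWithinAt)
    (injOn_div_rpow hβ hα z)] at h
  exact h.congr_fun (fun x hx => abs_deriv_mul_eq hβ hα g hx.1) measurableSet_Ioo

lemma integral_powerLaw_density (hβ : 0 < β) (hα : 0 < α) (g : ℝ → ℝ) {z : ℝ} (hz : 0 ≤ z) :
    ∫ x in (0 : ℝ)..z, 1 / α * (1 / β) ^ (2 / α) * x ^ (2 / α - 1) * g ((x / β) ^ (1 / α)) =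
      ∫ r in (0 : ℝ)..(z / β) ^ (1 / α), g r * r := by
  rw [intervalIntegral.integral_of_le hz, intervalIntegral.integral_of_le (by positivity),
    integral_Ioc_eq_integral_Ioo, integral_Ioc_eq_integral_Ioo, ← image_rpow_Ioo hβ hα hz,
    integral_image_eq_integral_abs_deriv_smul
      measurableSet_Ioo (fun x hx => (hasDerivAt_div_rpow hβ hx.1).hasDerivWithinAt)
      (injOn_div_rpow hβ hα z)]
  exact setIntegral_congr_fun measurableSet_Ioo fun x hx =>
    (abs_deriv_mul_eq hβ hα g hx.1).symm

lemma lintegral_ite_mul_id {g f : ℝ → ℝ} {s b : ℝ} (hg : Measurable g)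
    (h0 : ∀ r, 0 ≤ r → 0 ≤ g r) (h1 : ∀ r, 0 ≤ r → g r ≤ 1) (hb : 0 ≤ b)
    (hf : ∀ r, 0 ≤ r → (f r < s ↔ r < b)) :
    ∫⁻ r in Set.Ioi (0 : ℝ), ENNReal.ofReal ((if f r < s then 1 else 0) * g r * r) =
      ENNReal.ofReal (∫ r in (0 : ℝ)..b, g r * r) := by
  rw [intervalIntegral.integral_of_le hb, integral_Ioc_eq_integral_Ioo,
    ofReal_integral_eq_lintegral_ofReal (integrableOn_mul_id hg h0 h1 b)
      ((ae_restrict_iff' measurableSet_Ioo).2 (Eventually.of_forall fun r hr =>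
        mul_nonneg (h0 r hr.1.le) hr.1.le)),
    ← lintegral_indicator measurableSet_Ioo, ← lintegral_indicator measurableSet_Ioi]
  congr 1
  funext r
  by_cases hr : 0 < r
  · have hr' := hf r hr.le
    by_cases hrb : r < b
    · rw [Set.indicator_of_mem (Set.mem_Ioi.2 hr), Set.indicator_of_mem (Set.mem_Ioo.2 ⟨hr, hrb⟩),
        if_pos (hr'.2 hrb), one_mul]
    · rw [Set.indicator_of_mem (Set.mem_Ioi.2 hr),
        Set.indicator_of_notMem (fun h => hrb h.2), if_neg (fun h => hrb (hr'.1 h))]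
      simp
  · rw [Set.indicator_of_notMem (fun h => hr (Set.mem_Ioi.1 h)),
      Set.indicator_of_notMem (fun h => hr (Set.mem_Ioo.1 h).1)]

end PowerLaw

/-! ### Mean measure and smallest path loss of one sector. -/

section Mass

variable {p : Params}

/-- Mean number of base stations with path loss below `s` in one sector. -/
noncomputable def Params.cumMass (p : Params) (s : ℝ) : ℝ :=
  2 * Real.pi * p.lam / p.K *
    ((∫ r in (0 : ℝ)..p.invLossL s, p.h r * r) + ∫ r in (0 : ℝ)..p.invLossN s, (1 - p.h r) * r)

/-- The derivative of `Params.cumMass`. -/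
noncomputable def Params.massDensity (p : Params) (z : ℝ) : ℝ :=
  2 * Real.pi * p.lam / p.K *
    (1 / p.alphaL * (1 / p.beta) ^ (2 / p.alphaL) * z ^ (2 / p.alphaL - 1) * p.h (p.invLossL z) +
      1 / p.alphaN * (1 / p.beta) ^ (2 / p.alphaN) * z ^ (2 / p.alphaN - 1) *
        (1 - p.h (p.invLossN z)))

/-- Both summands of `fZ1` carry the void probability `exp (-cumMass z)`, so `fZ1` has the form of
the density of the smallest path loss in a sector. -/
lemma fZ1_eq (z : ℝ) : p.fZ1 z = Real.exp (-p.cumMass z) * p.massDensity z := by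
  unfold Params.fZ1 Params.cumMass Params.massDensity
  rw [mul_add, neg_add, Real.exp_add]
  ring

lemma Params.Admissible.rate_nonneg (hp : p.Admissible) : 0 ≤ 2 * Real.pi * p.lam / p.K := by
  have := hp.lam_pos
  positivity

lemma invLossL_nonneg (hp : p.Admissible) {z : ℝ} (hz : 0 ≤ z) : 0 ≤ p.invLossL z :=
  Real.rpow_nonneg (div_nonneg hz hp.beta_pos.le) _

lemma invLossN_nonneg (hp : p.Admissible) {z : ℝ} (hz : 0 ≤ z) : 0 ≤ p.invLossN z :=
  Real.rpow_nonneg (div_nonneg hz hp.beta_pos.le) _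

lemma lossL_lt_iff (hp : p.Admissible) {r t : ℝ} (hr : 0 ≤ r) (ht : 0 ≤ t) :
    p.lossL r < t ↔ r < p.invLossL t := mul_rpow_lt_iff hp.beta_pos hp.alphaL_pos hr ht

lemma lossN_lt_iff (hp : p.Admissible) {r t : ℝ} (hr : 0 ≤ r) (ht : 0 ≤ t) :
    p.lossN r < t ↔ r < p.invLossN t := mul_rpow_lt_iff hp.beta_pos hp.alphaN_pos hr ht

lemma lt_lossL_iff (hp : p.Admissible) {r t : ℝ} (hr : 0 ≤ r) (ht : 0 ≤ t) :
    t < p.lossL r ↔ p.invLossL t < r := lt_mul_rpow_iff hp.beta_pos hp.alphaL_pos hr ht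

lemma lt_lossN_iff (hp : p.Admissible) {r t : ℝ} (hr : 0 ≤ r) (ht : 0 ≤ t) :
    t < p.lossN r ↔ p.invLossN t < r := lt_mul_rpow_iff hp.beta_pos hp.alphaN_pos hr ht

lemma massDensity_nonneg (hp : p.Admissible) {z : ℝ} (hz : 0 < z) : 0 ≤ p.massDensity z := by
  have h1 := hp.h_nonneg _ (invLossL_nonneg hp hz.le)
  have h2 := sub_nonneg.2 (hp.h_le_one _ (invLossN_nonneg hp hz.le))
  have h3 := hp.alphaL_pos
  have h4 := hp.alphaN_pos
  have h5 := hp.beta_pos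
  have h6 := hp.rate_nonneg
  unfold Params.massDensity
  positivity

lemma fZ1_nonneg (hp : p.Admissible) {z : ℝ} (hz : 0 < z) : 0 ≤ p.fZ1 z := by
  rw [fZ1_eq]
  exact mul_nonneg (Real.exp_pos _).le (massDensity_nonneg hp hz)

lemma intervalIntegrable_powerLaw_L (hp : p.Admissible) {z : ℝ} (hz : 0 ≤ z) :
    IntervalIntegrable (fun x => 1 / p.alphaL * (1 / p.beta) ^ (2 / p.alphaL) *
      x ^ (2 / p.alphaL - 1) * p.h (p.invLossL x)) volume 0 z := by
  rw [intervalIntegrable_iff_integrableOn_Ioo_of_le hz]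
  exact integrableOn_powerLaw_density hp.beta_pos hp.alphaL_pos hp.h_measurable hp.h_nonneg
    hp.h_le_one hz

lemma intervalIntegrable_powerLaw_N (hp : p.Admissible) {z : ℝ} (hz : 0 ≤ z) :
    IntervalIntegrable (fun x => 1 / p.alphaN * (1 / p.beta) ^ (2 / p.alphaN) *
      x ^ (2 / p.alphaN - 1) * (1 - p.h (p.invLossN x))) volume 0 z := by
  rw [intervalIntegrable_iff_integrableOn_Ioo_of_le hz]
  exact integrableOn_powerLaw_density (g := fun r => 1 - p.h r) hp.beta_pos hp.alphaN_pos
    (measurable_const.sub hp.h_measurable) (fun r hr => sub_nonneg.2 (hp.h_le_one r hr))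
    (fun r hr => sub_le_self _ (hp.h_nonneg r hr)) hz

lemma intervalIntegrable_massDensity (hp : p.Admissible) {z : ℝ} (hz : 0 ≤ z) :
    IntervalIntegrable p.massDensity volume 0 z :=
  ((intervalIntegrable_powerLaw_L hp hz).add (intervalIntegrable_powerLaw_N hp hz)).const_mul _

lemma cumMass_eq_integral (hp : p.Admissible) {z : ℝ} (hz : 0 ≤ z) :
    p.cumMass z = ∫ x in (0 : ℝ)..z, p.massDensity x := by
  unfold Params.massDensity
  rw [intervalIntegral.integral_const_mul, intervalIntegral.integral_add
    (intervalIntegrable_powerLaw_L hp hz) (intervalIntegrable_powerLaw_N hp hz)]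
  have h1 := integral_powerLaw_density hp.beta_pos hp.alphaL_pos p.h hz
  have h2 := integral_powerLaw_density hp.beta_pos hp.alphaN_pos (fun r => 1 - p.h r) hz
  unfold Params.cumMass Params.invLossL Params.invLossN
  rw [h1, h2]

@[simp] lemma cumMass_zero (hp : p.Admissible) : p.cumMass 0 = 0 := by
  simp [cumMass_eq_integral hp le_rfl]

lemma cumMass_mono (hp : p.Admissible) {s t : ℝ} (hs : 0 ≤ s) (hst : s ≤ t) :
    p.cumMass s ≤ p.cumMass t := by
  rw [cumMass_eq_integral hp hs, cumMass_eq_integral hp (hs.trans hst)]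
  refine intervalIntegral.integral_mono_interval le_rfl hs hst ?_
    (intervalIntegrable_massDensity hp (hs.trans hst))
  exact (ae_restrict_iff' measurableSet_Ioc).2
    (Eventually.of_forall fun z hz => massDensity_nonneg hp hz.1)

lemma cumMass_nonneg (hp : p.Admissible) {s : ℝ} (hs : 0 ≤ s) : 0 ≤ p.cumMass s := by
  simpa [hp] using cumMass_mono hp le_rfl hs

lemma continuousOn_cumMass (hp : p.Admissible) (R : ℝ) : ContinuousOn p.cumMass (Set.Icc 0 R) := by
  rcases lt_or_ge R 0 with hR | hR
  · simp [Set.Icc_eq_empty_of_lt hR]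
  have h := ((intervalIntegrable_massDensity hp hR).absolutelyContinuousOnInterval_intervalIntegral
    Set.left_mem_uIcc).continuousOn
  rw [Set.uIcc_of_le hR] at h
  exact h.congr fun z hz => cumMass_eq_integral hp hz.1

lemma lossIntegral_below (hp : p.Admissible) {s : ℝ} (hs : 0 ≤ s) :
    ENNReal.ofReal (2 * Real.pi * p.lam / p.K) *
      p.lossIntegral (fun l => if l < s then 1 else 0) = ENNReal.ofReal (p.cumMass s) := by
  have h1 := lintegral_ite_mul_id hp.h_measurable hp.h_nonneg hp.h_le_one (invLossL_nonneg hp hs)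
    (fun r hr => lossL_lt_iff hp hr hs)
  have h2 := lintegral_ite_mul_id (g := fun r => 1 - p.h r)
    (measurable_const.sub hp.h_measurable) (fun r hr => sub_nonneg.2 (hp.h_le_one r hr))
    (fun r hr => sub_le_self _ (hp.h_nonneg r hr)) (invLossN_nonneg hp hs)
    (fun r hr => lossN_lt_iff hp hr hs)
  unfold Params.lossIntegral Params.cumMass
  rw [h1, h2, ENNReal.ofReal_mul hp.rate_nonneg, ENNReal.ofReal_add]
  · exact intervalIntegral.integral_nonneg (invLossL_nonneg hp hs) fun r hr =>
      mul_nonneg (hp.h_nonneg r hr.1) hr.1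
  · exact intervalIntegral.integral_nonneg (invLossN_nonneg hp hs) fun r hr =>
      mul_nonneg (sub_nonneg.2 (hp.h_le_one r hr.1)) hr.1

lemma intervalIntegrable_fZ1 (hp : p.Admissible) {z : ℝ} (hz : 0 ≤ z) :
    IntervalIntegrable p.fZ1 volume 0 z := by
  have h : p.fZ1 = fun z => Real.exp (-p.cumMass z) * p.massDensity z := funext fZ1_eq
  rw [h]
  refine (intervalIntegrable_massDensity hp hz).continuousOn_mul ?_
  rw [Set.uIcc_of_le hz]
  exact (continuousOn_cumMass hp z).neg.rexp

/-- The chain rule applied to `-exp (-x)` along the primitive `cumMass` of `massDensity`. -/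
lemma integral_fZ1 (hp : p.Admissible) {z : ℝ} (hz : 0 ≤ z) :
    ∫ x in (0 : ℝ)..z, p.fZ1 x = 1 - Real.exp (-p.cumMass z) := by
  have h := integral_comp_integral_mul (φ := fun x => -Real.exp (-x))
    (φ' := fun x => Real.exp (-x)) (c := 0) (intervalIntegrable_massDensity hp hz)
    (fun x => by simpa using! ((hasDerivAt_neg x).exp).neg) (by fun_prop)
  simp only [zero_add, neg_zero, Real.exp_zero, ← cumMass_eq_integral hp hz] at h
  rw [show 1 - Real.exp (-p.cumMass z) = -Real.exp (-p.cumMass z) - -1 by ring, ← h]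
  refine intervalIntegral.integral_congr fun x hx => ?_
  rw [Set.uIcc_of_le hz] at hx
  simp only [fZ1_eq, cumMass_eq_integral hp hx.1]

end Mass

/-! ### The unit mean exponential law. -/

section Exponential

/-- Multiplying the density of rate 1 by `exp (-c x)` gives `1 / (1 + c)` times the density of rate
`1 + c`. -/
lemma integral_en_mul_expMeasure {c : ℝ} (hc : 0 ≤ c) :
    ∫ x, en (ENNReal.ofReal c * ENNReal.ofReal x) ∂(expMeasure 1) = 1 / (1 + c) := by
  have hm : Measurable fun x : ℝ => en (ENNReal.ofReal c * ENNReal.ofReal x) :=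
    measurable_en.comp (measurable_const.mul ENNReal.measurable_ofReal)
  have hc1 : 0 < 1 + c := by linarith
  rw [integral_eq_lintegral_of_nonneg_ae (Eventually.of_forall fun _ => en_nonneg _)
    hm.aestronglyMeasurable]
  have h : ∫⁻ x, ENNReal.ofReal (en (ENNReal.ofReal c * ENNReal.ofReal x)) ∂(expMeasure 1) =
      ENNReal.ofReal (1 / (1 + c)) := by
    have hpdf : Measurable (exponentialPDF 1) := (measurable_exponentialPDFReal 1).ennreal_ofReal
    have hpdf' : Measurable (exponentialPDF (1 + c)) :=
      (measurable_exponentialPDFReal (1 + c)).ennreal_ofReal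
    have he : expMeasure 1 = volume.withDensity (exponentialPDF 1) := rfl
    rw [he, lintegral_withDensity_eq_lintegral_mul _ hpdf hm.ennreal_ofReal]
    have hx : ∀ x, (exponentialPDF 1 * fun x =>
        ENNReal.ofReal (en (ENNReal.ofReal c * ENNReal.ofReal x))) x =
        ENNReal.ofReal (1 / (1 + c)) * exponentialPDF (1 + c) x := by
      intro x
      rw [Pi.mul_apply]
      rcases lt_or_ge x 0 with h | h
      · rw [exponentialPDF_of_neg h, exponentialPDF_of_neg h, zero_mul, mul_zero]
      · rw [exponentialPDF_of_nonneg h, exponentialPDF_of_nonneg h, ← ENNReal.ofReal_mul hc,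
          en_ofReal (mul_nonneg hc h), ← ENNReal.ofReal_mul (by positivity),
          ← ENNReal.ofReal_mul (by positivity)]
        congr 1
        rw [one_mul, ← Real.exp_add, ← mul_assoc, one_div_mul_cancel hc1.ne', one_mul]
        ring_nf
    simp_rw [hx]
    rw [lintegral_const_mul _ hpdf', lintegral_exponentialPDF_eq_one hc1, mul_one]
  rw [h, ENNReal.toReal_ofReal (by positivity)]

lemma expMeasure_lt_ofReal (s : ℝ≥0∞) :
    expMeasure 1 {x | s < ENNReal.ofReal x} = ENNReal.ofReal (en s) := by
  have : IsProbabilityMeasure (expMeasure 1) := isProbabilityMeasure_expMeasure one_pos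
  by_cases hs : s = ∞
  · simp [hs]
  have h1 : {x | s < ENNReal.ofReal x} = (Set.Iic s.toReal)ᶜ := by
    ext x
    rw [Set.mem_ofPred_eq, ENNReal.lt_ofReal_iff_toReal_lt hs, Set.mem_compl_iff, Set.mem_Iic,
      not_le]
  rw [h1, prob_compl_eq_one_sub measurableSet_Iic, ← ofReal_cdf, cdf_expMeasure_eq one_pos,
    if_pos ENNReal.toReal_nonneg, en_of_ne_top hs, ← ENNReal.ofReal_one,
    ← ENNReal.ofReal_sub _ (sub_nonneg.2 (Real.exp_le_one_iff.2 (by simp)))]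
  congr 1
  rw [one_mul]
  ring

end Exponential

/-! ### Independent fading variables. -/

section Fading

variable {Ω : Type*} [mΩ : MeasurableSpace Ω] {P : Measure Ω} [IsProbabilityMeasure P]
  {F : ℕ → Ω → ℝ}

/-- The σ-algebra generated by the `F k` with `k ∈ I`. -/
abbrev sigmaOf (F : ℕ → Ω → ℝ) (I : Set ℕ) : MeasurableSpace Ω :=
  ⨆ k ∈ I, MeasurableSpace.comap (F k) inferInstance

omit mΩ in
lemma measurable_sigmaOf {I : Set ℕ} {k : ℕ} (hk : k ∈ I) : Measurable[sigmaOf F I] (F k) :=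
  measurable_iff_comap_le.2
    (le_iSup₂_of_le (f := fun k (_ : k ∈ I) => MeasurableSpace.comap (F k) inferInstance) k hk
      le_rfl)

lemma sigmaOf_le (hF : ∀ k, Measurable (F k)) (I : Set ℕ) : sigmaOf F I ≤ mΩ :=
  iSup₂_le fun k _ => measurable_iff_comap_le.1 (hF k)

omit mΩ in
lemma sigmaOf_mono {I J : Set ℕ} (h : I ⊆ J) : sigmaOf F I ≤ sigmaOf F J :=
  iSup₂_le fun k hk =>
    le_iSup₂_of_le (f := fun k (_ : k ∈ J) => MeasurableSpace.comap (F k) inferInstance) k (h hk)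
      le_rfl

omit [IsProbabilityMeasure P] in
lemma indepFun_of_disjoint (hF : ∀ k, Measurable (F k)) (hind : iIndepFun F P) {I J : Set ℕ}
    (hIJ : Disjoint I J) {α β : Type*} [MeasurableSpace α] [MeasurableSpace β] {f : Ω → α}
    {g : Ω → β} (hf : Measurable[sigmaOf F I] f) (hg : Measurable[sigmaOf F J] g) :
    IndepFun f g P := by
  rw [IndepFun_iff_Indep]
  exact indep_of_indep_of_le_right (indep_of_indep_of_le_left
    (indep_iSup_of_disjoint (fun k => measurable_iff_comap_le.1 (hF k)) hind hIJ)
    (measurable_iff_comap_le.1 hf)) (measurable_iff_comap_le.1 hg)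

lemma integral_prod_of_disjoint (hF : ∀ k, Measurable (F k)) (hind : iIndepFun F P)
    {ι : Type*} {I : ι → Set ℕ} (hI : Pairwise (Function.onFun Disjoint I)) {G : ι → Ω → ℝ}
    (hG : ∀ j, Measurable[sigmaOf F (I j)] (G j)) (s : Finset ι) :
    ∫ ω, ∏ j ∈ s, G j ω ∂P = ∏ j ∈ s, ∫ ω, G j ω ∂P := by
  classical
  induction s using Finset.induction_on with
  | empty => simp
  | insert i s hi ih =>
    simp_rw [Finset.prod_insert hi]
    have hs : Measurable[sigmaOf F (⋃ j ∈ s, I j)] fun ω => ∏ j ∈ s, G j ω :=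
      Finset.measurable_fun_prod s fun j hj =>
        (hG j).mono (sigmaOf_mono (Set.subset_biUnion_of_mem (u := I) hj)) le_rfl
    have hd : Disjoint (I i) (⋃ j ∈ s, I j) := by
      rw [Set.disjoint_iUnion₂_right]
      intro j hj
      exact hI (fun h => hi (h ▸ hj))
    have hii := indepFun_of_disjoint hF hind hd (hG i) hs
    rw [hii.integral_fun_mul_eq_mul_integral
      ((hG i).mono (sigmaOf_le hF _) le_rfl).aestronglyMeasurable
      (hs.mono (sigmaOf_le hF _) le_rfl).aestronglyMeasurable, ih]

-- The value `1 / (1 + c)` is written as `en` of a logarithm, so that infinite products over the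
-- links become sums in `[0, ∞]`.
omit [IsProbabilityMeasure P] in
lemma integral_en_mul_fading (hF : ∀ k, Measurable (F k)) (hlaw : ∀ k, P.map (F k) = expMeasure 1)
    (k : ℕ) {c : ℝ} (hc : 0 ≤ c) :
    ∫ ω, en (ENNReal.ofReal c * ENNReal.ofReal (F k ω)) ∂P =
      en (ENNReal.ofReal (Real.log (1 + c))) := by
  have hm : Measurable fun x : ℝ => en (ENNReal.ofReal c * ENNReal.ofReal x) :=
    measurable_en.comp (measurable_const.mul ENNReal.measurable_ofReal)
  have h := integral_map (μ := P) (hF k).aemeasurable hm.aestronglyMeasurable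
  rw [← h, hlaw, integral_en_mul_expMeasure hc, en_ofReal (Real.log_nonneg (by linarith)),
    Real.exp_neg, Real.exp_log (by linarith), one_div]

/-- Laplace transform of a weighted sum of independent exponential fading powers. -/
lemma integral_en_tsum_fading (hF : ∀ k, Measurable (F k)) (hind : iIndepFun F P)
    (hlaw : ∀ k, P.map (F k) = expMeasure 1) {c : ℕ → ℝ} (hc : ∀ k, 0 ≤ c k) :
    ∫ ω, en (∑' k, ENNReal.ofReal (c k) * ENNReal.ofReal (F k ω)) ∂P =
      en (∑' k, ENNReal.ofReal (Real.log (1 + c k))) := by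
  have hterm : ∀ k, Measurable fun ω => ENNReal.ofReal (c k) * ENNReal.ofReal (F k ω) :=
    fun k => measurable_const.mul (hF k).ennreal_ofReal
  have hL := tendsto_integral_en (P := P)
    (f := fun n ω => ∑ k ∈ Finset.range n, ENNReal.ofReal (c k) * ENNReal.ofReal (F k ω))
    (fun n => Finset.measurable_fun_sum _ fun k _ => hterm k)
    (Eventually.of_forall fun ω => ENNReal.tendsto_nat_tsum _)
  have hR := (continuous_en.tendsto _).comp
    (ENNReal.tendsto_nat_tsum fun k => ENNReal.ofReal (Real.log (1 + c k)))
  refine tendsto_nhds_unique hL (hR.congr fun n => ?_)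
  simp only [Function.comp_apply, en_sum]
  rw [integral_prod_of_disjoint hF hind (I := fun k => {k})
    (G := fun k ω => en (ENNReal.ofReal (c k) * ENNReal.ofReal (F k ω)))
    (fun i j hij => Set.disjoint_singleton.2 hij)
    (fun k => measurable_en.comp (measurable_const.mul
      (measurable_sigmaOf (Set.mem_singleton k)).ennreal_ofReal))]
  exact Finset.prod_congr rfl fun k _ => (integral_en_mul_fading hF hlaw k (hc k)).symm

/-- By Fubini, given `S = s` the exponential variable exceeds `s` with probability `en s`, including
`s = ∞`. This is what turns detection probabilities into Laplace transforms. -/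
lemma measureReal_lt_fading {S : Ω → ℝ≥0∞} (hS : Measurable S) {f : Ω → ℝ} (hf : Measurable f)
    (hlaw : P.map f = expMeasure 1) (hind : IndepFun S f P) :
    P.real {ω | S ω < ENNReal.ofReal (f ω)} = ∫ ω, en (S ω) ∂P := by
  have : IsProbabilityMeasure (expMeasure 1) := isProbabilityMeasure_expMeasure one_pos
  have hB : MeasurableSet {q : ℝ≥0∞ × ℝ | q.1 < ENNReal.ofReal q.2} :=
    measurableSet_lt measurable_fst measurable_snd.ennreal_ofReal
  have h := (indepFun_iff_map_prod_eq_prod_map_map hS.aemeasurable hf.aemeasurable).1 hind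
  have h1 := congrArg (fun μ => μ {q : ℝ≥0∞ × ℝ | q.1 < ENNReal.ofReal q.2}) h
  beta_reduce at h1
  rw [Measure.map_apply (hS.prodMk hf) hB, hlaw, Measure.prod_apply hB] at h1
  have h2 : ∀ s : ℝ≥0∞, Prod.mk s ⁻¹' {q : ℝ≥0∞ × ℝ | q.1 < ENNReal.ofReal q.2} =
      {x | s < ENNReal.ofReal x} := fun s => rfl
  simp_rw [h2, expMeasure_lt_ofReal] at h1
  rw [lintegral_map measurable_en.ennreal_ofReal hS] at h1
  rw [integral_eq_lintegral_of_nonneg_ae (Eventually.of_forall fun _ => en_nonneg _)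
    (measurable_en.comp hS).aestronglyMeasurable, ← h1]
  rfl

end Fading

/-! ### Detection in a fixed configuration of marked points. -/

section Configuration

variable {p : Params}

lemma gain_pos (hp : p.Admissible) : 0 < p.gain (2 * Real.pi / p.Ncs) := by
  have hpi := Real.pi_pos
  have hN : (1 : ℝ) ≤ p.Ncs := by exact_mod_cast hp.Ncs_pos
  have hC := hp.C0_pos
  unfold Params.gain
  split_ifs with h
  · exact one_pos
  · have h1 : 2 * Real.pi / p.Ncs < 2 * Real.pi :=
      lt_of_le_of_ne (div_le_self (by positivity) hN) h
    have h2 : 0 < p.frontBack (2 * Real.pi / p.Ncs) :=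
      div_pos (by positivity) (mul_pos hC (sub_pos.2 h1))
    have h3 : 0 < 2 * Real.pi / (p.Ncs : ℝ) := by positivity
    positivity

lemma effNoise_pos (hp : p.Admissible) : 0 < p.effNoise := by
  have hM : (0 : ℝ) < p.Mcs := by exact_mod_cast hp.Mcs_pos
  exact div_pos hp.noise_pos (mul_pos (mul_pos hp.Pb_pos hM) (gain_pos hp))

lemma loss_pos (hp : p.Admissible) {j : Fin p.K} {y : ℂ × Bool} (hy : y.1 ∈ p.bsSector j) :
    0 < p.loss y := by
  have h : 0 < ‖y.1‖ := norm_pos_iff.2 (mem_bsSector_iff.1 hy).1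
  have hβ := hp.beta_pos
  unfold Params.loss Params.lossL Params.lossN
  split_ifs <;> positivity

lemma loss_nonneg (hp : p.Admissible) (y : ℂ × Bool) : 0 ≤ p.loss y := by
  have hβ := hp.beta_pos
  unfold Params.loss Params.lossL Params.lossN
  split_ifs <;> positivity

/-- Minimum path loss in sector `j` of the marked points `y`. -/
noncomputable def Params.minLossAt (p : Params) (j : Fin p.K) (y : ℕ → ℂ × Bool) : ℝ≥0∞ :=
  minLoss p (fun i (y : ℕ → ℂ × Bool) => (y i).1) (fun i y => (y i).2) j y

/-- Detection of sector `j` for the marked points `y` and fading powers `f`. -/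
def Params.DetectedAt (p : Params) (j : Fin p.K) (y : ℕ → ℂ × Bool) (f : ℕ → ℝ) : Prop :=
  Detected p (fun i (_ : ℕ → ℝ) => (y i).1) (fun i _ => (y i).2) (fun i f => f i) j f

open Classical in
/-- Interference in sector `j` from the points with path loss above `z`. -/
noncomputable def Params.interfAt (p : Params) (j : Fin p.K) (z : ℝ≥0∞) (y : ℕ → ℂ × Bool)
    (f : ℕ → ℝ) : ℝ≥0∞ :=
  ∑' k, if (y k).1 ∈ p.bsSector j ∧ z < ENNReal.ofReal (p.loss (y k)) then
    ENNReal.ofReal (f k) / ENNReal.ofReal (p.loss (y k)) else 0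

lemma detectedAt_def {j : Fin p.K} {y : ℕ → ℂ × Bool} {f : ℕ → ℝ} :
    p.DetectedAt j y f ↔ ∃ i, (y i).1 ∈ p.bsSector j ∧
      ENNReal.ofReal (p.loss (y i)) = p.minLossAt j y ∧
      ENNReal.ofReal p.Gam < (ENNReal.ofReal (f i) / ENNReal.ofReal (p.loss (y i))) /
        (p.interfAt j (ENNReal.ofReal (p.loss (y i))) y f + ENNReal.ofReal p.effNoise) :=
  Iff.rfl

/-- The path losses in sector `j` are distinct and do not accumulate. -/
structure Params.Separated (p : Params) (j : Fin p.K) (y : ℕ → ℂ × Bool) : Prop where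
  finite : ∀ t : ℝ, {k | (y k).1 ∈ p.bsSector j ∧ p.loss (y k) < t}.Finite
  injective : ∀ i k, (y i).1 ∈ p.bsSector j → (y k).1 ∈ p.bsSector j →
    p.loss (y i) = p.loss (y k) → i = k

lemma minLossAt_le {j : Fin p.K} {y : ℕ → ℂ × Bool} {i : ℕ} (hi : (y i).1 ∈ p.bsSector j) :
    p.minLossAt j y ≤ ENNReal.ofReal (p.loss (y i)) :=
  iInf₂_le (f := fun i (_ : (y i).1 ∈ p.bsSector j) => ENNReal.ofReal (p.loss (y i))) i hi

lemma minLossAt_lt_iff (hp : p.Admissible) {j : Fin p.K} {y : ℕ → ℂ × Bool} {t : ℝ} :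
    p.minLossAt j y < ENNReal.ofReal t ↔ ∃ i, (y i).1 ∈ p.bsSector j ∧ p.loss (y i) < t := by
  have h : p.minLossAt j y =
    ⨅ (i : ℕ) (_ : (y i).1 ∈ p.bsSector j), ENNReal.ofReal (p.loss (y i)) := rfl
  simp_rw [h, iInf_lt_iff, ENNReal.ofReal_lt_ofReal_iff_of_nonneg (loss_nonneg hp _), exists_prop]

/-- Only finitely many losses lie below `t`, so the infimum is attained. -/
lemma Params.Separated.exists_min (hp : p.Admissible) {j : Fin p.K} {y : ℕ → ℂ × Bool}
    (hy : p.Separated j y) {t : ℝ} (h : p.minLossAt j y < ENNReal.ofReal t) :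
    ∃ i, (y i).1 ∈ p.bsSector j ∧ ENNReal.ofReal (p.loss (y i)) = p.minLossAt j y := by
  obtain ⟨k, hk⟩ := (minLossAt_lt_iff hp).1 h
  obtain ⟨i, hi, hmin⟩ := Set.exists_min_image _ (fun k => p.loss (y k)) (hy.finite t) ⟨k, hk⟩
  refine ⟨i, hi.1, le_antisymm (le_iInf₂ fun l hl => ENNReal.ofReal_le_ofReal ?_)
    (minLossAt_le hi.1)⟩
  by_cases hlt : p.loss (y l) < t
  · exact hmin l ⟨hl, hlt⟩
  · exact hi.2.le.trans (not_lt.1 hlt)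

/-- Exponent of the interference caused by a link with path loss `l` if the serving link has path
loss `t`. -/
noncomputable def Params.interfWeight (p : Params) (t l : ℝ) : ℝ≥0∞ :=
  if t < l then ENNReal.ofReal (Real.log (1 + p.Gam * t / l)) else 0

/-- Probability of detection given the path losses, if the serving path loss is `t`. -/
noncomputable def Params.detectWeight (p : Params) (j : Fin p.K) (t : ℝ) (y : ℕ → ℂ × Bool) : ℝ :=
  en (ENNReal.ofReal (p.Gam * t * p.effNoise) + p.sectorSum j (p.interfWeight t) y)

open Classical in
/-- Relative interference coefficient of point `k` with serving path loss `t`. -/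
noncomputable def Params.interfCoeff (p : Params) (j : Fin p.K) (t : ℝ) (y : ℕ → ℂ × Bool)
    (k : ℕ) : ℝ :=
  if (y k).1 ∈ p.bsSector j ∧ t < p.loss (y k) then p.Gam * t / p.loss (y k) else 0

lemma interfCoeff_nonneg (hp : p.Admissible) (j : Fin p.K) {t : ℝ} (ht : 0 ≤ t)
    (y : ℕ → ℂ × Bool) (k : ℕ) : 0 ≤ p.interfCoeff j t y k := by
  have h1 := hp.Gam_pos
  have h2 := loss_nonneg hp (y k)
  unfold Params.interfCoeff
  split_ifs <;> positivity

lemma sectorSum_interfWeight (j : Fin p.K) (t : ℝ) (y : ℕ → ℂ × Bool) :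
    p.sectorSum j (p.interfWeight t) y =
      ∑' k, ENNReal.ofReal (Real.log (1 + p.interfCoeff j t y k)) := by
  refine tsum_congr fun k => ?_
  unfold Params.interfCoeff Params.interfWeight
  by_cases h : (y k).1 ∈ p.bsSector j
  · rw [Set.indicator_of_mem h]
    by_cases h' : t < p.loss (y k) <;> simp [h, h']
  · simp [h]

/-- Distinct losses make `i` the only candidate in the definition of detection; the SINR inequality
is then multiplied out. -/
lemma detectedAt_iff (hp : p.Admissible) {j : Fin p.K} {y : ℕ → ℂ × Bool}
    (hy : p.Separated j y) {i : ℕ} (hi : (y i).1 ∈ p.bsSector j)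
    (hmin : ENNReal.ofReal (p.loss (y i)) = p.minLossAt j y) (f : ℕ → ℝ) :
    p.DetectedAt j y f ↔ ENNReal.ofReal (p.Gam * p.loss (y i) * p.effNoise) +
      ∑' k, ENNReal.ofReal (p.interfCoeff j (p.loss (y i)) y k) * ENNReal.ofReal (f k) <
        ENNReal.ofReal (f i) := by
  classical
  have hl := loss_pos hp hi
  have hG := hp.Gam_pos
  have hN := effNoise_pos hp
  have h1 : p.DetectedAt j y f ↔ ENNReal.ofReal p.Gam <
      (ENNReal.ofReal (f i) / ENNReal.ofReal (p.loss (y i))) /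
        (p.interfAt j (ENNReal.ofReal (p.loss (y i))) y f + ENNReal.ofReal p.effNoise) := by
    rw [detectedAt_def]
    constructor
    · rintro ⟨k, hk, hkmin, hdet⟩
      have hki : k = i := by
        refine hy.injective k i hk hi ?_
        have : ENNReal.ofReal (p.loss (y k)) = ENNReal.ofReal (p.loss (y i)) :=
          hkmin.trans hmin.symm
        rwa [ENNReal.ofReal_eq_ofReal_iff (loss_nonneg hp _) (loss_nonneg hp _)] at this
      rwa [hki] at hdet
    · exact fun h => ⟨i, hi, hmin, h⟩
  rw [h1]
  set I := p.interfAt j (ENNReal.ofReal (p.loss (y i))) y f with hI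
  have hsum : ∑' k, ENNReal.ofReal (p.interfCoeff j (p.loss (y i)) y k) * ENNReal.ofReal (f k) =
      ENNReal.ofReal (p.Gam * p.loss (y i)) * I := by
    rw [hI, Params.interfAt, ← ENNReal.tsum_mul_left]
    refine tsum_congr fun k => ?_
    simp only [ENNReal.ofReal_lt_ofReal_iff_of_nonneg hl.le]
    unfold Params.interfCoeff
    split_ifs with h
    · have hk := loss_pos hp h.1
      rw [ENNReal.ofReal_div_of_pos hk, div_eq_mul_inv, div_eq_mul_inv, mul_assoc,
        mul_comm (ENNReal.ofReal (p.loss (y k)))⁻¹]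
    · simp
  have hn0 : ENNReal.ofReal p.effNoise ≠ 0 := by simpa using hN
  have hl0 : ENNReal.ofReal (p.loss (y i)) ≠ 0 := by simpa using hl
  have hG0 : ENNReal.ofReal p.Gam ≠ 0 := by simpa using hG
  rw [hsum, ENNReal.ofReal_mul (by positivity), ← mul_add, add_comm _ I,
    ENNReal.ofReal_mul hG.le]
  -- With infinite interference the SINR is 0 and both inequalities fail.
  by_cases hItop : I = ∞
  · rw [hItop, top_add, ENNReal.div_top, ENNReal.mul_top (mul_ne_zero hG0 hl0)]
    simp
  · rw [ENNReal.lt_div_iff_mul_lt (Or.inl (by simp [hn0]))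
      (Or.inl (ENNReal.add_ne_top.2 ⟨hItop, ENNReal.ofReal_ne_top⟩)),
      ENNReal.lt_div_iff_mul_lt (Or.inl hl0) (Or.inl ENNReal.ofReal_ne_top)]
    rw [mul_right_comm]

section Measurability

variable {Ω : Type*} {m : MeasurableSpace Ω} {Y : Ω → ℕ → ℂ × Bool} {f : Ω → ℕ → ℝ}

lemma measurable_minLossAt (hY : ∀ i, Measurable fun ω => Y ω i) (j : Fin p.K) :
    Measurable fun ω => p.minLossAt j (Y ω) := by
  classical
  have h : (fun ω => p.minLossAt j (Y ω)) = fun ω => ⨅ i : ℕ,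
      if (Y ω i).1 ∈ p.bsSector j then ENNReal.ofReal (p.loss (Y ω i)) else ∞ := by
    funext ω
    exact iInf_congr fun i => iInf_eq_if _
  rw [h]
  exact Measurable.iInf fun i => Measurable.ite
    ((measurable_fst.comp (hY i)) (measurableSet_bsSector j))
    (measurable_loss.comp (hY i)).ennreal_ofReal measurable_const

lemma measurableSet_detectedAt (hY : ∀ i, Measurable fun ω => Y ω i)
    (hf : ∀ i, Measurable fun ω => f ω i) (j : Fin p.K) :
    MeasurableSet {ω | p.DetectedAt j (Y ω) (f ω)} := by
  classical
  have hl : ∀ i, Measurable fun ω => ENNReal.ofReal (p.loss (Y ω i)) := fun i =>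
    (measurable_loss.comp (hY i)).ennreal_ofReal
  have hs : ∀ i, MeasurableSet {ω | (Y ω i).1 ∈ p.bsSector j} := fun i =>
    (measurable_fst.comp (hY i)) (measurableSet_bsSector j)
  have hI : ∀ i, Measurable fun ω =>
      p.interfAt j (ENNReal.ofReal (p.loss (Y ω i))) (Y ω) (f ω) := fun i =>
    Measurable.tsum fun k => Measurable.ite ((hs k).inter (measurableSet_lt (hl i) (hl k)))
      ((hf k).ennreal_ofReal.div (hl k)) measurable_const
  have h : {ω | p.DetectedAt j (Y ω) (f ω)} = ⋃ i, ({ω | (Y ω i).1 ∈ p.bsSector j} ∩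
      ({ω | ENNReal.ofReal (p.loss (Y ω i)) = p.minLossAt j (Y ω)} ∩
      {ω | ENNReal.ofReal p.Gam < (ENNReal.ofReal (f ω i) / ENNReal.ofReal (p.loss (Y ω i))) /
        (p.interfAt j (ENNReal.ofReal (p.loss (Y ω i))) (Y ω) (f ω) +
          ENNReal.ofReal p.effNoise)})) := by
    ext ω
    simp only [Set.mem_iUnion]
    exact detectedAt_def
  rw [h]
  exact MeasurableSet.iUnion fun i => (hs i).inter
    ((measurableSet_eq_fun (hl i) (measurable_minLossAt hY j)).inter
      (measurableSet_lt measurable_const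
        (((hf i).ennreal_ofReal.div (hl i)).div ((hI i).add_const _))))

end Measurability

-- Only the fading inside the sector matters. This makes the detection events of different sectors
-- functions of disjoint families of fading variables.
open Classical in
lemma detectedAt_congr {j : Fin p.K} {y : ℕ → ℂ × Bool} {f : ℕ → ℝ} :
    p.DetectedAt j y f ↔
      p.DetectedAt j y fun k => if (y k).1 ∈ p.bsSector j then f k else 0 := by
  rw [detectedAt_def, detectedAt_def]
  refine exists_congr fun i => and_congr_right fun hi => and_congr Iff.rfl ?_
  have h : ∀ z, p.interfAt j z y f =
      p.interfAt j z y fun k => if (y k).1 ∈ p.bsSector j then f k else 0 := by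
    intro z
    refine tsum_congr fun k => ?_
    by_cases h : (y k).1 ∈ p.bsSector j <;> simp [h]
  rw [if_pos hi, h]

end Configuration

/-- The σ-algebra is arbitrary because the lemma is applied to `sigmaOf F {i}ᶜ`. -/
lemma measurable_tsum_ennreal {α : Type*} {m : MeasurableSpace α} {f : ℕ → α → ℝ≥0∞}
    (hf : ∀ i, Measurable (f i)) : Measurable fun x => ∑' i, f i x :=
  Measurable.tsum hf

/-! ### Averaging over the fading, given the configuration. -/

section Conditional

variable {Ω : Type*} [MeasurableSpace Ω] {P : Measure Ω} [IsProbabilityMeasure P] {p : Params}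
  {X : ℕ → Ω → ℂ} {los : ℕ → Ω → Bool} {F : ℕ → Ω → ℝ}

/-- The serving link has coefficient 0 in its own interference, because interfering losses are
strictly larger. Noise plus interference is therefore independent of `F i`, and the detection
probability is its Laplace transform. -/
lemma measureReal_detectedAt (hp : p.Admissible) (hF : ∀ k, Measurable (F k))
    (hind : iIndepFun F P) (hlaw : ∀ k, P.map (F k) = expMeasure 1)
    {j : Fin p.K} {y : ℕ → ℂ × Bool} (hy : p.Separated j y) {i : ℕ}
    (hi : (y i).1 ∈ p.bsSector j) (hmin : ENNReal.ofReal (p.loss (y i)) = p.minLossAt j y) :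
    P.real {ω | p.DetectedAt j y fun k => F k ω} = p.detectWeight j (p.loss (y i)) y := by
  set t := p.loss (y i) with ht
  have ht0 : 0 ≤ t := (loss_pos hp hi).le
  have hci : p.interfCoeff j t y i = 0 := by
    unfold Params.interfCoeff
    rw [if_neg]
    exact fun h => lt_irrefl _ h.2
  have hS : Measurable[sigmaOf F {i}ᶜ] fun ω => ENNReal.ofReal (p.Gam * t * p.effNoise) +
      ∑' k, ENNReal.ofReal (p.interfCoeff j t y k) * ENNReal.ofReal (F k ω) := by
    refine Measurable.const_add (measurable_tsum_ennreal fun k => ?_) _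
    by_cases hk : k = i
    · rw [hk, hci]
      simp only [ENNReal.ofReal_zero, zero_mul]
      exact measurable_const
    · exact measurable_const.mul (measurable_sigmaOf (I := {i}ᶜ) hk).ennreal_ofReal
  have hSF := indepFun_of_disjoint hF hind (Set.disjoint_compl_left_iff_subset.2 subset_rfl) hS
    (measurable_sigmaOf (Set.mem_singleton i))
  simp_rw [detectedAt_iff hp hy hi hmin]
  rw [measureReal_lt_fading (hS.mono (sigmaOf_le hF _) le_rfl) (hF i) (hlaw i) hSF]
  simp_rw [en_add]
  rw [integral_const_mul, integral_en_tsum_fading hF hind hlaw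
    (fun k => interfCoeff_nonneg hp j ht0 y k), ← sectorSum_interfWeight, ← en_add]
  rfl

open Classical in
/-- Probability, given the path losses `y`, that sector `j` is detected with path loss below
`t`. -/
noncomputable def Params.successProb (p : Params) (t : ℝ) (j : Fin p.K) (y : ℕ → ℂ × Bool) : ℝ :=
  if p.minLossAt j y < ENNReal.ofReal t then p.detectWeight j (p.minLossAt j y).toReal y else 0

open Classical in
/-- Indicator that sector `j` is not detected with path loss below `t`. -/
noncomputable def Params.failInd (p : Params) (t : ℝ) (j : Fin p.K) (y : ℕ → ℂ × Bool)
    (f : ℕ → ℝ) : ℝ :=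
  if p.minLossAt j y < ENNReal.ofReal t ∧ p.DetectedAt j y f then 0 else 1

omit [MeasurableSpace Ω] in
lemma measurable_failInd (t : ℝ) (j : Fin p.K) {m : MeasurableSpace Ω} {Y : Ω → ℕ → ℂ × Bool}
    {f : Ω → ℕ → ℝ} (hY : ∀ i, Measurable fun ω => Y ω i) (hf : ∀ i, Measurable fun ω => f ω i) :
    Measurable fun ω => p.failInd t j (Y ω) (f ω) :=
  Measurable.ite ((measurableSet_lt (measurable_minLossAt hY j) measurable_const).inter
    (measurableSet_detectedAt hY hf j)) measurable_const measurable_const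

lemma abs_failInd_le (t : ℝ) (j : Fin p.K) (y : ℕ → ℂ × Bool) (f : ℕ → ℝ) :
    |p.failInd t j y f| ≤ 1 := by
  unfold Params.failInd
  split_ifs <;> simp

lemma integral_failInd (hp : p.Admissible) (hF : ∀ k, Measurable (F k))
    (hind : iIndepFun F P) (hlaw : ∀ k, P.map (F k) = expMeasure 1) (t : ℝ)
    {j : Fin p.K} {y : ℕ → ℂ × Bool} (hy : p.Separated j y) :
    ∫ ω, p.failInd t j y (fun k => F k ω) ∂P = 1 - p.successProb t j y := by
  by_cases h : p.minLossAt j y < ENNReal.ofReal t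
  · obtain ⟨i, hi, hmin⟩ := hy.exists_min hp h
    have hD : MeasurableSet {ω | p.DetectedAt j y fun k => F k ω} :=
      measurableSet_detectedAt (Y := fun _ => y) (fun i => measurable_const) hF j
    have h1 : ∀ ω, p.failInd t j y (fun k => F k ω) =
        1 - {ω | p.DetectedAt j y fun k => F k ω}.indicator (fun _ => (1 : ℝ)) ω := by
      intro ω
      unfold Params.failInd
      by_cases hd : p.DetectedAt j y fun k => F k ω <;> simp [h, hd]
    simp_rw [h1]
    rw [integral_sub (integrable_const _) ((integrable_const _).indicator hD),
      integral_indicator_const _ hD, measureReal_detectedAt hp hF hind hlaw hy hi hmin]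
    unfold Params.successProb
    rw [if_pos h, ← hmin, ENNReal.toReal_ofReal (loss_pos hp hi).le]
    simp
  · have h1 : ∀ ω, p.failInd t j y (fun k => F k ω) = 1 := fun ω => by
      simp [Params.failInd, h]
    simp [h1, Params.successProb, h]

lemma integral_prod_failInd (hp : p.Admissible) (hF : ∀ k, Measurable (F k))
    (hind : iIndepFun F P) (hlaw : ∀ k, P.map (F k) = expMeasure 1) (t : ℝ)
    {y : ℕ → ℂ × Bool} (hy : ∀ j, p.Separated j y) :
    ∫ ω, ∏ j, p.failInd t j y (fun k => F k ω) ∂P = ∏ j, (1 - p.successProb t j y) := by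
  classical
  rw [integral_prod_of_disjoint hF hind (I := fun j => {k | (y k).1 ∈ p.bsSector j})
    (G := fun j ω => p.failInd t j y fun k => F k ω)]
  · exact Finset.prod_congr rfl fun j _ => integral_failInd hp hF hind hlaw t (hy j)
  · exact fun i j hij => Set.disjoint_left.2 fun k hi hj => hij (bsSector_unique hi hj)
  · intro j
    have h : (fun ω => p.failInd t j y fun k => F k ω) = fun ω =>
        p.failInd t j y fun k => if (y k).1 ∈ p.bsSector j then F k ω else 0 := by
      funext ω
      unfold Params.failInd
      rw [detectedAt_congr]
    rw [h]
    refine measurable_failInd t j (fun i => measurable_const) fun k => ?_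
    by_cases hk : (y k).1 ∈ p.bsSector j
    · simp only [hk, if_true]
      exact measurable_sigmaOf (I := {k | (y k).1 ∈ p.bsSector j}) hk
    · simp only [hk, if_false]
      exact measurable_const

lemma measurable_taggedLoss (hX : ∀ i, Measurable (X i)) (hlos : ∀ i, Measurable (los i))
    (hF : ∀ i, Measurable (F i)) : Measurable (taggedLoss p X los F) := by
  classical
  have hY : ∀ i, Measurable fun ω => (X i ω, los i ω) := fun i => (hX i).prodMk (hlos i)
  have h : taggedLoss p X los F = fun ω => ⨅ j : Fin p.K,
      if p.DetectedAt j (fun i => (X i ω, los i ω)) (fun i => F i ω) then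
        p.minLossAt j (fun i => (X i ω, los i ω)) else ∞ := by
    funext ω
    exact iInf_congr fun i => iInf_eq_if _
  rw [h]
  exact Measurable.iInf fun j => Measurable.ite (measurableSet_detectedAt hY hF j)
    (measurable_minLossAt hY j) measurable_const

omit [MeasurableSpace Ω] in
lemma le_taggedLoss_iff {t : ℝ} {ω : Ω} :
    ENNReal.ofReal t ≤ taggedLoss p X los F ω ↔
      ∀ j, p.failInd t j (fun i => (X i ω, los i ω)) (fun i => F i ω) = 1 := by
  have h : taggedLoss p X los F ω = ⨅ (j : Fin p.K)
      (_ : p.DetectedAt j (fun i => (X i ω, los i ω)) (fun i => F i ω)),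
        p.minLossAt j (fun i => (X i ω, los i ω)) := rfl
  rw [h, le_iInf₂_iff]
  refine forall_congr' fun j => ?_
  unfold Params.failInd
  split_ifs with hc
  · simp [hc.2, hc.1]
  · simp only [iff_true]
    exact fun hd => not_lt.1 fun hlt => hc ⟨hlt, hd⟩

/-- Averaging over the fading. -/
theorem IsNetwork.measureReal_le_taggedLoss (hnet : IsNetwork P p X los F) (hp : p.Admissible)
    (hsep : ∀ᵐ ω ∂P, ∀ j, p.Separated j fun i => (X i ω, los i ω)) (t : ℝ) :
    P.real {ω | ENNReal.ofReal t ≤ taggedLoss p X los F ω} =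
      ∫ ω, ∏ j, (1 - p.successProb t j fun i => (X i ω, los i ω)) ∂P := by
  have hF := hnet.fading_measurable
  have hFm : Measurable fun ω (i : ℕ) => F i ω := measurable_pi_lambda _ hF
  have hYm : Measurable fun ω (i : ℕ) => (X i ω, los i ω) :=
    measurable_pi_lambda _ fun i => measurable_marked hnet i
  have hA : MeasurableSet {ω | ENNReal.ofReal t ≤ taggedLoss p X los F ω} :=
    measurableSet_le measurable_const
      (measurable_taggedLoss hnet.poisson.measurable hnet.los_measurable hF)
  let Ψ : (ℕ → ℝ) × (ℕ → ℂ × Bool) → ℝ := fun q => ∏ j, p.failInd t j q.2 q.1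
  have hΨ : Measurable Ψ := Finset.measurable_fun_prod _ fun j _ =>
    measurable_failInd t j (fun i => (measurable_pi_apply i).comp measurable_snd)
      (fun i => (measurable_pi_apply i).comp measurable_fst)
  have hΨ1 : ∀ q, |Ψ q| ≤ 1 := fun q => by
    rw [Finset.abs_prod]
    exact Finset.prod_le_one (fun _ _ => abs_nonneg _) fun j _ => abs_failInd_le _ _ _ _
  have h1 : P.real {ω | ENNReal.ofReal t ≤ taggedLoss p X los F ω} =
      ∫ ω, Ψ (fun i => F i ω, fun i => (X i ω, los i ω)) ∂P := by
    rw [← integral_indicator_one hA]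
    congr 1
    funext ω
    by_cases h : ω ∈ {ω | ENNReal.ofReal t ≤ taggedLoss p X los F ω}
    · rw [Set.indicator_of_mem h]
      exact (Finset.prod_eq_one fun j _ => le_taggedLoss_iff.1 h j).symm
    · rw [Set.indicator_of_notMem h]
      have h' := mt le_taggedLoss_iff.2 h
      push Not at h'
      obtain ⟨j, hj⟩ := h'
      refine (Finset.prod_eq_zero (Finset.mem_univ j) ?_).symm
      unfold Params.failInd at hj ⊢
      split_ifs at hj ⊢ with hc
      · rfl
      · exact absurd rfl hj
  have h2 := (indepFun_iff_map_prod_eq_prod_map_map hFm.aemeasurable hYm.aemeasurable).1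
    hnet.fading_indep_network
  have : IsProbabilityMeasure (P.map fun ω (i : ℕ) => F i ω) :=
    Measure.isProbabilityMeasure_map hFm.aemeasurable
  have : IsProbabilityMeasure (P.map fun ω (i : ℕ) => (X i ω, los i ω)) :=
    Measure.isProbabilityMeasure_map hYm.aemeasurable
  have hint : Integrable Ψ ((P.map fun ω (i : ℕ) => F i ω).prod
      (P.map fun ω (i : ℕ) => (X i ω, los i ω))) :=
    Integrable.of_bound hΨ.aestronglyMeasurable 1 (Eventually.of_forall hΨ1)
  -- Fading and configuration are independent, so the joint law is a product and the fading is
  -- integrated first, at a fixed configuration.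
  rw [h1, ← integral_map (φ := fun ω => ((fun i => F i ω), fun i => (X i ω, los i ω)))
    (hFm.prodMk hYm).aemeasurable hΨ.aestronglyMeasurable, h2, integral_prod_symm _ hint,
    integral_map hYm.aemeasurable hint.integral_prod_right.aestronglyMeasurable]
  refine integral_congr_ae ?_
  filter_upwards [hsep] with ω hω
  rw [integral_map (f := fun x => Ψ (x, fun i => (X i ω, los i ω))) hFm.aemeasurable
    (hΨ.comp measurable_prodMk_right).aestronglyMeasurable]
  exact integral_prod_failInd hp hF hnet.fading_indep hnet.fading_law t hω

end Conditional

/-! ### Exponents of the Laplace functional. -/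

section Intensity

variable {p : Params}

lemma lossIntegral_congr (hp : p.Admissible) {u v : ℝ → ℝ} (h : ∀ l, 0 ≤ l → u l = v l) :
    p.lossIntegral u = p.lossIntegral v := by
  have hβ := hp.beta_pos
  have hL : ∀ r : ℝ, 0 < r → 0 ≤ p.lossL r := fun r hr => by unfold Params.lossL; positivity
  have hN : ∀ r : ℝ, 0 < r → 0 ≤ p.lossN r := fun r hr => by unfold Params.lossN; positivity
  unfold Params.lossIntegral
  congr 1
  · refine setLIntegral_congr_fun measurableSet_Ioi fun r hr => ?_
    rw [h _ (hL r hr)]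
  · refine setLIntegral_congr_fun measurableSet_Ioi fun r hr => ?_
    rw [h _ (hN r hr)]

lemma lossIntegral_add (hp : p.Admissible) {u v : ℝ → ℝ} (hum : Measurable u)
    (hu : ∀ l, 0 ≤ u l) (hv : ∀ l, 0 ≤ v l) :
    p.lossIntegral (fun l => u l + v l) = p.lossIntegral u + p.lossIntegral v := by
  have hh := hp.h_measurable
  have hL : Measurable p.lossL := measurable_lossL
  have hN : Measurable p.lossN := measurable_lossN
  have h1 : ∫⁻ r in Set.Ioi (0 : ℝ), ENNReal.ofReal ((u (p.lossL r) + v (p.lossL r)) * p.h r * r) =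
      (∫⁻ r in Set.Ioi (0 : ℝ), ENNReal.ofReal (u (p.lossL r) * p.h r * r)) +
        ∫⁻ r in Set.Ioi (0 : ℝ), ENNReal.ofReal (v (p.lossL r) * p.h r * r) := by
    rw [← lintegral_add_left (by fun_prop)]
    refine setLIntegral_congr_fun measurableSet_Ioi fun r hr => ?_
    have hr0 : (0 : ℝ) < r := hr
    have := hp.h_nonneg r hr0.le
    have := hu (p.lossL r)
    have := hv (p.lossL r)
    rw [← ENNReal.ofReal_add (by positivity) (by positivity)]
    ring_nf
  have h2 : ∫⁻ r in Set.Ioi (0 : ℝ),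
        ENNReal.ofReal ((u (p.lossN r) + v (p.lossN r)) * (1 - p.h r) * r) =
      (∫⁻ r in Set.Ioi (0 : ℝ), ENNReal.ofReal (u (p.lossN r) * (1 - p.h r) * r)) +
        ∫⁻ r in Set.Ioi (0 : ℝ), ENNReal.ofReal (v (p.lossN r) * (1 - p.h r) * r) := by
    rw [← lintegral_add_left (by fun_prop)]
    refine setLIntegral_congr_fun measurableSet_Ioi fun r hr => ?_
    have hr0 : (0 : ℝ) < r := hr
    have := sub_nonneg.2 (hp.h_le_one r hr0.le)
    have := hu (p.lossN r)
    have := hv (p.lossN r)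
    rw [← ENNReal.ofReal_add (by positivity) (by positivity)]
    ring_nf
  unfold Params.lossIntegral
  rw [h1, h2]
  ring

lemma lossIntegral_const_mul (hp : p.Admissible) {u : ℝ → ℝ} (hum : Measurable u) {c : ℝ}
    (hc : 0 ≤ c) : p.lossIntegral (fun l => c * u l) = ENNReal.ofReal c * p.lossIntegral u := by
  have hh := hp.h_measurable
  have hL : Measurable p.lossL := measurable_lossL
  have hN : Measurable p.lossN := measurable_lossN
  unfold Params.lossIntegral
  rw [mul_add, ← lintegral_const_mul _ (by fun_prop), ← lintegral_const_mul _ (by fun_prop)]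
  simp_rw [← ENNReal.ofReal_mul hc, mul_assoc]

lemma lossIntegral_cell (hp : p.Admissible) {a b : ℝ} (ha : 0 ≤ a) (hab : a ≤ b) :
    ENNReal.ofReal (2 * Real.pi * p.lam / p.K) *
      p.lossIntegral (fun l => if a ≤ l ∧ l < b then 1 else 0) =
        ENNReal.ofReal (p.cumMass b - p.cumMass a) := by
  have h1 : p.lossIntegral (fun l => if l < b then 1 else 0) =
      p.lossIntegral (fun l => if l < a then 1 else 0) +
        p.lossIntegral (fun l => if a ≤ l ∧ l < b then 1 else 0) := by
    rw [← lossIntegral_add hp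
      (Measurable.ite measurableSet_Iio measurable_const measurable_const)
      (fun l => by split_ifs <;> norm_num) (fun l => by split_ifs <;> norm_num)]
    refine lossIntegral_congr hp fun l _ => ?_
    by_cases h1 : l < a
    · simp [h1, h1.trans_le hab, not_le.2 h1]
    · simp [h1, not_lt.1 h1]
  have h2 := lossIntegral_below hp (ha.trans hab)
  rw [h1, mul_add, lossIntegral_below hp ha] at h2
  rw [ENNReal.ofReal_sub _ (cumMass_nonneg hp ha), ← h2,
    ENNReal.add_sub_cancel_left ENNReal.ofReal_ne_top]

/-- Exponent for the event that no path loss is below `s`, with interference from the path losses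
above `t`. -/
noncomputable def Params.gapWeight (p : Params) (s t l : ℝ) : ℝ≥0∞ :=
  if l < s then ∞ else p.interfWeight t l

lemma measurable_interfWeight (t : ℝ) : Measurable (p.interfWeight t) :=
  Measurable.ite measurableSet_Ioi (Real.measurable_log.comp
    (measurable_const.add (measurable_const.div measurable_id))).ennreal_ofReal measurable_const

lemma measurable_gapWeight (s t : ℝ) : Measurable (p.gapWeight s t) :=
  Measurable.ite measurableSet_Iio measurable_const (measurable_interfWeight t)

/-- Weight `∞` below `s` contributes 1, and above `t` one has `1 - 1 / (1 + Γ t / l) = Γ t / (Γ t +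
l)`; as `s ≤ t`, the two ranges are disjoint. -/
lemma one_sub_en_gapWeight (hp : p.Admissible) {s t l : ℝ} (ht : 0 < t) (hst : s ≤ t) :
    1 - en (p.gapWeight s t l) =
      (if l < s then 1 else 0) + if t < l then p.Gam * t / (p.Gam * t + l) else 0 := by
  have hG := hp.Gam_pos
  unfold Params.gapWeight Params.interfWeight
  by_cases h1 : l < s
  · simp [h1, not_lt.2 (h1.le.trans hst)]
  · by_cases h2 : t < l
    · have hl : 0 < l := ht.trans h2
      have h3 : 0 < p.Gam * t / l := by positivity
      simp only [h1, h2, if_true, if_false, zero_add]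
      rw [en_ofReal (Real.log_nonneg (by linarith)), Real.exp_neg, Real.exp_log (by linarith)]
      field_simp
      ring
    · simp [h1, h2]

lemma lintegral_ite_lt {f g : ℝ → ℝ} {t b c : ℝ} (hb : 0 ≤ b)
    (hf : ∀ r, 0 ≤ r → (t < f r ↔ b < r)) :
    ∫⁻ r in Set.Ioi (0 : ℝ), ENNReal.ofReal ((if t < f r then c / (c + f r) else 0) * g r * r) =
      ∫⁻ r in Set.Ioi b, ENNReal.ofReal (c * g r * r / (c + f r)) := by
  rw [← lintegral_indicator measurableSet_Ioi, ← lintegral_indicator measurableSet_Ioi]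
  congr 1
  funext r
  by_cases hr : 0 < r
  · have hr' := hf r hr.le
    rw [Set.indicator_of_mem (Set.mem_Ioi.2 hr)]
    by_cases hrb : b < r
    · rw [Set.indicator_of_mem (Set.mem_Ioi.2 hrb), if_pos (hr'.2 hrb)]
      ring_nf
    · rw [Set.indicator_of_notMem (fun h => hrb (Set.mem_Ioi.1 h)), if_neg (fun h => hrb (hr'.1 h))]
      simp
  · rw [Set.indicator_of_notMem (fun h => hr (Set.mem_Ioi.1 h)),
      Set.indicator_of_notMem (fun h => hr (hb.trans_lt (Set.mem_Ioi.1 h)))]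

/-- The part of the exponent below `s` gives the void probability, the part above `t` gives `V`; the
factorization reflects the independence of the two ranges. -/
lemma en_lossIntegral_gapWeight (hp : p.Admissible) {s t : ℝ} (hs : 0 ≤ s) (ht : 0 < t)
    (hst : s ≤ t) :
    en (ENNReal.ofReal (2 * Real.pi * p.lam / p.K) *
      p.lossIntegral fun l => 1 - en (p.gapWeight s t l)) =
        Real.exp (-p.cumMass s) * p.V t p.Gam (p.lam / p.K) := by
  have hG := hp.Gam_pos
  simp_rw [one_sub_en_gapWeight hp ht hst]
  have hadd := lossIntegral_add hp (u := fun l => if l < s then 1 else 0)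
    (v := fun l => if t < l then p.Gam * t / (p.Gam * t + l) else 0)
    (Measurable.ite measurableSet_Iio measurable_const measurable_const)
    (fun l => by split_ifs <;> norm_num) (fun l => by
      split_ifs with h
      · have : 0 < l := ht.trans h
        positivity
      · exact le_rfl)
  rw [hadd, mul_add, lossIntegral_below hp hs, en_add, en_ofReal (cumMass_nonneg hp hs)]
  congr 1
  unfold Params.V Params.lossIntegral
  rw [lintegral_ite_lt (invLossL_nonneg hp ht.le) (fun r hr => lt_lossL_iff hp hr ht.le),
    lintegral_ite_lt (g := fun r => 1 - p.h r) (invLossN_nonneg hp ht.le)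
      (fun r hr => lt_lossN_iff hp hr ht.le), ← mul_div_assoc]
  rfl

end Intensity

/-! ### Means of the detection weights. -/

section GapLaplace

variable {Ω : Type*} [MeasurableSpace Ω] {P : Measure Ω} [IsProbabilityMeasure P] {p : Params}
  {X : ℕ → Ω → ℂ} {los : ℕ → Ω → Bool} {F : ℕ → Ω → ℝ}

/-- The detection weight on the event that no path loss in sector `j` is below `s`. -/
noncomputable def Params.gapLaplace (p : Params) (j : Fin p.K) (s t : ℝ) (y : ℕ → ℂ × Bool) : ℝ :=
  en (ENNReal.ofReal (p.Gam * t * p.effNoise) + p.sectorSum j (p.gapWeight s t) y)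

-- A single loss below `s` has weight `∞` and kills the exponential. Subtracting the value at `(t,
-- t)` from that at `(s, t)` thus isolates the event that the minimum lies in `[s, t)`.
open Classical in
lemma gapLaplace_eq (hp : p.Admissible) (j : Fin p.K) (s t : ℝ) (y : ℕ → ℂ × Bool) :
    p.gapLaplace j s t y =
      if p.minLossAt j y < ENNReal.ofReal s then 0 else p.detectWeight j t y := by
  unfold Params.gapLaplace Params.detectWeight
  split_ifs with h
  · obtain ⟨i, hi, hlt⟩ := (minLossAt_lt_iff hp).1 h
    have : p.sectorSum j (p.gapWeight s t) y = ∞ := by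
      refine ENNReal.tsum_eq_top_of_eq_top ⟨i, ?_⟩
      rw [Set.indicator_of_mem hi]
      simp [Params.gapWeight, hlt]
    simp [this]
  · congr 2
    refine tsum_congr fun i => ?_
    by_cases hi : (y i).1 ∈ p.bsSector j
    · rw [Set.indicator_of_mem hi, Set.indicator_of_mem hi]
      have : ¬ p.loss (y i) < s := fun hlt => h ((minLossAt_lt_iff hp).2 ⟨i, hi, hlt⟩)
      simp [Params.gapWeight, this]
    · rw [Set.indicator_of_notMem hi, Set.indicator_of_notMem hi]

lemma measurable_gapLaplace (j : Fin p.K) (s t : ℝ) : Measurable (p.gapLaplace j s t) :=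
  measurable_en.comp (measurable_const.add (measurable_sectorSum j (measurable_gapWeight s t)))

/-- Expectation of products over the sectors of exponential functionals. -/
lemma IsNetwork.integral_prod_en_add (hnet : IsNetwork P p X los F) (hp : p.Admissible)
    {w : Fin p.K → ℝ → ℝ≥0∞} (hw : ∀ j, Measurable (w j)) (c : Fin p.K → ℝ≥0∞) :
    ∫ ω, ∏ j, en (c j + p.sectorSum j (w j) fun i => (X i ω, los i ω)) ∂P =
      ∏ j, en (c j + ENNReal.ofReal (2 * Real.pi * p.lam / p.K) *
        p.lossIntegral fun l => 1 - en (w j l)) := by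
  simp_rw [en_add, Finset.prod_mul_distrib]
  rw [integral_const_mul, hnet.integral_prod_en_sectorSum hp hw]

lemma IsNetwork.integral_en_sectorSum (hnet : IsNetwork P p X los F) (hp : p.Admissible)
    (j : Fin p.K) {w : ℝ → ℝ≥0∞} (hw : Measurable w) (c : ℝ≥0∞) :
    ∫ ω, en (c + p.sectorSum j w fun i => (X i ω, los i ω)) ∂P =
      en (c + ENNReal.ofReal (2 * Real.pi * p.lam / p.K) *
        p.lossIntegral fun l => 1 - en (w l)) := by
  classical
  -- Zero weight and zero constant in the other sectors make their factors 1.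
  have h := hnet.integral_prod_en_add hp (w := fun i => if i = j then w else fun _ => 0)
    (fun i => by split_ifs; exacts [hw, measurable_const]) (fun i => if i = j then c else 0)
  have h0 : ∀ i, i ≠ j → ∀ ω, en ((if i = j then c else 0) +
      p.sectorSum i (if i = j then w else fun _ => 0) fun i => (X i ω, los i ω)) = 1 := by
    intro i hi ω
    simp [hi, Params.sectorSum]
  have h1 : ∀ i, i ≠ j → en ((if i = j then c else 0) +
      ENNReal.ofReal (2 * Real.pi * p.lam / p.K) *
        p.lossIntegral fun l => 1 - en ((if i = j then w else fun _ => 0) l)) = 1 := by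
    intro i hi
    simp [hi, Params.lossIntegral]
  rw [Finset.prod_eq_single j (fun i _ hi => h1 i hi) (by simp)] at h
  have h2 : ∀ ω, ∏ i, en ((if i = j then c else 0) +
      p.sectorSum i (if i = j then w else fun _ => 0) fun i => (X i ω, los i ω)) =
      en (c + p.sectorSum j w fun i => (X i ω, los i ω)) := fun ω => by
    rw [Finset.prod_eq_single j (fun i _ hi => h0 i hi ω) (by simp)]
    simp
  simp_rw [h2] at h
  simpa using h

lemma en_gapWeight_eq (hp : p.Admissible) {s t : ℝ} (hs : 0 ≤ s) (ht : 0 < t) (hst : s ≤ t) :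
    en (ENNReal.ofReal (p.Gam * t * p.effNoise) + ENNReal.ofReal (2 * Real.pi * p.lam / p.K) *
      p.lossIntegral fun l => 1 - en (p.gapWeight s t l)) =
        Real.exp (-p.cumMass s) * p.Ptilde t := by
  have hG := hp.Gam_pos
  have hN := effNoise_pos hp
  rw [en_add, en_lossIntegral_gapWeight hp hs ht hst, en_ofReal (by positivity)]
  unfold Params.Ptilde
  ring

lemma IsNetwork.integral_detectWeight (hnet : IsNetwork P p X los F) (hp : p.Admissible)
    (j : Fin p.K) {t : ℝ} (ht : 0 < t) :
    ∫ ω, p.detectWeight j t (fun i => (X i ω, los i ω)) ∂P = p.Ptilde t := by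
  have h := hnet.integral_en_sectorSum hp j (measurable_gapWeight (p := p) 0 t)
    (ENNReal.ofReal (p.Gam * t * p.effNoise))
  rw [en_gapWeight_eq hp le_rfl ht ht.le, cumMass_zero hp, neg_zero, Real.exp_zero, one_mul] at h
  rw [← h]
  congr 1
  funext ω
  have := gapLaplace_eq hp j 0 t fun i => (X i ω, los i ω)
  simp only [ENNReal.ofReal_zero, not_lt_zero, if_false] at this
  exact this.symm

end GapLaplace

/-! ### Almost surely the path losses are distinct and locally finite. -/

section Separation

variable {Ω : Type*} [MeasurableSpace Ω] {P : Measure Ω} [IsProbabilityMeasure P] {p : Params}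
  {X : ℕ → Ω → ℂ} {los : ℕ → Ω → Bool} {F : ℕ → Ω → ℝ}

/-- The weight `c` on the path losses in `[a, b)`. -/
noncomputable def cellWeight (a b : ℝ) (c : ℝ≥0∞) (l : ℝ) : ℝ≥0∞ := if a ≤ l ∧ l < b then c else 0

lemma measurable_cellWeight (a b : ℝ) (c : ℝ≥0∞) : Measurable (cellWeight a b c) :=
  Measurable.ite measurableSet_Ico measurable_const measurable_const

lemma IsNetwork.integral_en_cellWeight (hnet : IsNetwork P p X los F) (hp : p.Admissible)
    (j : Fin p.K) {a b : ℝ} (ha : 0 ≤ a) (hab : a ≤ b) (c : ℝ≥0∞) :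
    ∫ ω, en (p.sectorSum j (cellWeight a b c) fun i => (X i ω, los i ω)) ∂P =
      Real.exp (-((1 - en c) * (p.cumMass b - p.cumMass a))) := by
  have h := hnet.integral_en_sectorSum hp j (measurable_cellWeight a b c) 0
  simp only [zero_add] at h
  have hc := sub_nonneg.2 (en_le_one c)
  have h1 : ∀ l, 1 - en (cellWeight a b c l) = (1 - en c) * if a ≤ l ∧ l < b then 1 else 0 := by
    intro l
    unfold cellWeight
    split_ifs <;> simp
  simp_rw [h1] at h
  rw [lossIntegral_const_mul hp (Measurable.ite measurableSet_Ico measurable_const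
    measurable_const) hc, mul_left_comm, lossIntegral_cell hp ha hab, ← ENNReal.ofReal_mul hc,
    en_ofReal (mul_nonneg hc (sub_nonneg.2 (cumMass_mono hp ha hab)))] at h
  exact h

/-- A nonnegative combination of exponential functionals that is at least `1` if there are two
points with path loss in `[a, b)`. -/
noncomputable def Params.pairBound (p : Params) (j : Fin p.K) (a b : ℝ) (y : ℕ → ℂ × Bool) : ℝ :=
  2 - 4 * en (p.sectorSum j (cellWeight a b (enInv (1 / 2))) y) +
    2 * en (p.sectorSum j (cellWeight a b ∞) y)

lemma en_enInv_half : en (enInv (1 / 2)) = 1 / 2 := en_enInv (by norm_num) (by norm_num)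

/-- With `N` points in the cell the bound equals `2 - 4 * 2 ^ (-N) + 2 * 1_{N = 0}`: it vanishes for
`N = 0, 1` and is at least 1 from `N = 2` on. Being built from `en`, its mean is given by the
Laplace functional. -/
lemma pairBound_nonneg (j : Fin p.K) (a b : ℝ) (y : ℕ → ℂ × Bool) : 0 ≤ p.pairBound j a b y := by
  unfold Params.pairBound
  by_cases h : ∃ i, (y i).1 ∈ p.bsSector j ∧ a ≤ p.loss (y i) ∧ p.loss (y i) < b
  · obtain ⟨i, hi, hl⟩ := h
    have h1 : enInv (1 / 2) ≤ p.sectorSum j (cellWeight a b (enInv (1 / 2))) y := by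
      refine le_trans (le_of_eq ?_) (ENNReal.le_tsum i)
      rw [Set.indicator_of_mem hi, cellWeight, if_pos hl]
    have h2 := en_antitone h1
    rw [en_enInv_half] at h2
    linarith [en_nonneg (p.sectorSum j (cellWeight a b ∞) y)]
  · have h0 : ∀ c, p.sectorSum j (cellWeight a b c) y = 0 := by
      intro c
      refine ENNReal.tsum_eq_zero.2 fun i => ?_
      by_cases hi : (y i).1 ∈ p.bsSector j
      · rw [Set.indicator_of_mem hi, cellWeight, if_neg fun hl => h ⟨i, hi, hl⟩]
      · rw [Set.indicator_of_notMem hi]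
    rw [h0, h0]
    norm_num

lemma one_le_pairBound (j : Fin p.K) {a b : ℝ} {y : ℕ → ℂ × Bool} {i k : ℕ} (hik : i ≠ k)
    (hi : (y i).1 ∈ p.bsSector j) (hk : (y k).1 ∈ p.bsSector j)
    (hli : a ≤ p.loss (y i) ∧ p.loss (y i) < b) (hlk : a ≤ p.loss (y k) ∧ p.loss (y k) < b) :
    1 ≤ p.pairBound j a b y := by
  have h1 : enInv (1 / 2) + enInv (1 / 2) ≤
      p.sectorSum j (cellWeight a b (enInv (1 / 2))) y := by
    refine le_trans (le_of_eq ?_) (ENNReal.sum_le_tsum {i, k})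
    rw [Finset.sum_pair hik, Set.indicator_of_mem hi, Set.indicator_of_mem hk, cellWeight,
      cellWeight, if_pos hli, if_pos hlk]
  have h2 := en_antitone h1
  rw [en_add, en_enInv_half] at h2
  unfold Params.pairBound
  linarith [en_nonneg (p.sectorSum j (cellWeight a b ∞) y)]

/-- The left side is `2 (1 - exp (-m / 2)) ^ 2`, and `1 - exp (-m / 2) ≤ m / 2`. -/
lemma two_mul_sq_le {m : ℝ} (hm : 0 ≤ m) :
    2 - 4 * Real.exp (-((1 - 1 / 2) * m)) + 2 * Real.exp (-((1 - 0) * m)) ≤ m ^ 2 := by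
  have h1 : Real.exp (-((1 - 0) * m)) = Real.exp (-((1 - 1 / 2) * m)) ^ 2 := by
    rw [← Real.exp_nat_mul]; push_cast; ring_nf
  rw [h1]
  have h2 := Real.add_one_le_exp (-((1 - 1 / 2) * m))
  have h3 : Real.exp (-((1 - 1 / 2) * m)) ≤ 1 := Real.exp_le_one_iff.2 (by linarith)
  nlinarith

lemma IsNetwork.measureReal_pair_le (hnet : IsNetwork P p X los F) (hp : p.Admissible)
    (j : Fin p.K) {a b : ℝ} (ha : 0 ≤ a) (hab : a ≤ b) :
    P.real {ω | 1 ≤ p.pairBound j a b fun i => (X i ω, los i ω)} ≤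
      (p.cumMass b - p.cumMass a) ^ 2 := by
  have hYm : Measurable fun ω (i : ℕ) => (X i ω, los i ω) :=
    measurable_pi_lambda _ fun i => measurable_marked hnet i
  have hint : ∀ c, Integrable
      (fun ω => en (p.sectorSum j (cellWeight a b c) fun i => (X i ω, los i ω))) P := fun c =>
    integrable_en_comp ((measurable_sectorSum j (measurable_cellWeight a b c)).comp hYm)
  have hint' : Integrable (fun ω => p.pairBound j a b fun i => (X i ω, los i ω)) P :=
    ((integrable_const _).sub ((hint _).const_mul 4)).add ((hint _).const_mul 2)
  have h := mul_meas_ge_le_integral_of_nonneg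
    (Eventually.of_forall fun ω => pairBound_nonneg j a b fun i => (X i ω, los i ω)) hint' 1
  rw [one_mul] at h
  refine h.trans ?_
  unfold Params.pairBound
  have h1 : Integrable (fun ω => 2 -
      4 * en (p.sectorSum j (cellWeight a b (enInv (1 / 2))) fun i => (X i ω, los i ω))) P :=
    (integrable_const _).sub ((hint _).const_mul 4)
  rw [integral_add h1 ((hint _).const_mul 2),
    integral_sub (integrable_const _) ((hint _).const_mul 4), integral_const_mul,
    integral_const_mul, hnet.integral_en_cellWeight hp j ha hab,
    hnet.integral_en_cellWeight hp j ha hab, en_enInv_half, en_top]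
  simpa using two_mul_sq_le (sub_nonneg.2 (cumMass_mono hp ha hab))

/-- Two points in sector `j` with the same path loss below `R`. -/
def Params.HasTie (p : Params) (j : Fin p.K) (R : ℝ) (y : ℕ → ℂ × Bool) : Prop :=
  ∃ i k, i ≠ k ∧ (y i).1 ∈ p.bsSector j ∧ (y k).1 ∈ p.bsSector j ∧
    p.loss (y i) = p.loss (y k) ∧ p.loss (y i) < R

lemma exists_cell {R l : ℝ} (hl : 0 ≤ l) (hlR : l < R) {n : ℕ} (hn : 0 < n) :
    ∃ m < n, R * m / n ≤ l ∧ l < R * (m + 1 : ℕ) / n := by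
  have hR : 0 < R := hl.trans_lt hlR
  have hn' : (0 : ℝ) < n := by exact_mod_cast hn
  refine ⟨⌊l * n / R⌋₊, ?_, ?_, ?_⟩
  · rw [Nat.floor_lt (by positivity), div_lt_iff₀ hR, mul_comm]
    exact mul_lt_mul_of_pos_left hlR hn'
  · rw [div_le_iff₀ hn']
    have := Nat.floor_le (show 0 ≤ l * n / R by positivity)
    rwa [le_div_iff₀ hR, mul_comm] at this
  · rw [lt_div_iff₀ hn']
    have := Nat.lt_floor_add_one (l * n / R)
    rw [div_lt_iff₀ hR, mul_comm _ R] at this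
    exact_mod_cast this

/-- Tied points share a cell. A union bound over the cells gives `∑ (Δ cumMass) ^ 2`, at most `ε`
times a telescoping sum. -/
lemma IsNetwork.measureReal_hasTie_le (hnet : IsNetwork P p X los F) (hp : p.Admissible)
    (j : Fin p.K) {R : ℝ} (hR : 0 < R) {n : ℕ} (hn : 0 < n) {ε : ℝ}
    (hε : ∀ m < n, p.cumMass (R * (m + 1 : ℕ) / n) - p.cumMass (R * m / n) ≤ ε) :
    P.real {ω | p.HasTie j R fun i => (X i ω, los i ω)} ≤ ε * p.cumMass R := by
  have hn' : (0 : ℝ) < n := by exact_mod_cast hn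
  have hstep : ∀ m : ℕ, R * m / n ≤ R * (m + 1 : ℕ) / n := fun m => by
    push_cast
    gcongr
    linarith
  have hsub : {ω | p.HasTie j R fun i => (X i ω, los i ω)} ⊆ ⋃ m ∈ Finset.range n,
      {ω | 1 ≤ p.pairBound j (R * m / n) (R * (m + 1 : ℕ) / n) fun i => (X i ω, los i ω)} := by
    rintro ω ⟨i, k, hik, hi, hk, heq, hlt⟩
    obtain ⟨m, hm, hc⟩ := exists_cell (loss_nonneg hp _) hlt hn
    simp only [Set.mem_iUnion, Finset.mem_range]
    exact ⟨m, hm, one_le_pairBound j hik hi hk hc (heq ▸ hc)⟩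
  calc _ ≤ _ := measureReal_mono hsub (measure_ne_top _ _)
    _ ≤ ∑ m ∈ Finset.range n, P.real {ω | 1 ≤ p.pairBound j (R * m / n) (R * (m + 1 : ℕ) / n)
          fun i => (X i ω, los i ω)} := measureReal_biUnion_finset_le _ _
    _ ≤ ∑ m ∈ Finset.range n,
          ε * (p.cumMass (R * (m + 1 : ℕ) / n) - p.cumMass (R * m / n)) := by
        refine Finset.sum_le_sum fun m hm => ?_
        refine (hnet.measureReal_pair_le hp j (by positivity) (hstep m)).trans ?_
        rw [sq]
        exact mul_le_mul_of_nonneg_right (hε m (Finset.mem_range.1 hm))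
          (sub_nonneg.2 (cumMass_mono hp (by positivity) (hstep m)))
    _ = ε * p.cumMass R := by
        rw [← Finset.mul_sum, Finset.sum_range_sub (fun m : ℕ => p.cumMass (R * m / n)),
          mul_div_cancel_right₀ _ hn'.ne']
        simp [cumMass_zero hp]

lemma IsNetwork.measure_hasTie (hnet : IsNetwork P p X los F) (hp : p.Admissible)
    (j : Fin p.K) {R : ℝ} (hR : 0 < R) :
    P {ω | p.HasTie j R fun i => (X i ω, los i ω)} = 0 := by
  rw [← measureReal_eq_zero_iff]
  refine le_antisymm ?_ measureReal_nonneg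
  have hM := cumMass_nonneg hp hR.le
  refine le_of_forall_pos_le_add fun δ hδ => ?_
  rw [zero_add]
  have hu := isCompact_Icc.uniformContinuousOn_of_continuous (continuousOn_cumMass hp R)
  rw [Metric.uniformContinuousOn_iff] at hu
  -- Uniform continuity of `cumMass` makes the cell masses small; the `+ 1` avoids dividing by a
  -- vanishing total mass.
  obtain ⟨η, hη, h⟩ := hu (δ / (p.cumMass R + 1)) (by positivity)
  obtain ⟨n, hn⟩ := exists_nat_gt (R / η)
  have hn0 : (0 : ℝ) < n := (div_pos hR hη).trans hn
  have hn1 : 0 < n := by exact_mod_cast hn0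
  rw [div_lt_iff₀ hη] at hn
  have hmem : ∀ m : ℕ, m ≤ n → R * m / n ∈ Set.Icc 0 R := fun m hm => by
    refine ⟨by positivity, ?_⟩
    rw [div_le_iff₀ hn0]
    exact mul_le_mul_of_nonneg_left (by exact_mod_cast hm) hR.le
  refine (hnet.measureReal_hasTie_le hp j hR hn1 (ε := δ / (p.cumMass R + 1))
    fun m hm => ?_).trans ?_
  · refine (le_abs_self _).trans (h _ (hmem _ hm) _ (hmem _ hm.le) ?_).le
    rw [Real.dist_eq, ← sub_div, ← mul_sub]
    push_cast
    rw [add_sub_cancel_left, mul_one, abs_of_pos (by positivity), div_lt_iff₀ hn0, mul_comm]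
    exact hn
  · rw [div_mul_eq_mul_div, div_le_iff₀ (by positivity)]
    nlinarith

-- The number of points in the ball has a Poisson law, which does not charge `∞`.
omit [IsProbabilityMeasure P] in
lemma IsNetwork.ae_finite_ball (hnet : IsNetwork P p X los F) (R : ℝ) :
    ∀ᵐ ω ∂P, {i | X i ω ∈ Metric.ball 0 R}.Finite := by
  have hfin : (ENNReal.ofReal p.lam • (volume : Measure ℂ)) (Metric.ball 0 R) < ∞ := by
    rw [Measure.smul_apply, smul_eq_mul]
    exact ENNReal.mul_lt_top ENNReal.ofReal_lt_top measure_ball_lt_top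
  have hlaw := hnet.poisson.law _ (measurableSet_ball (x := (0 : ℂ)) (ε := R)) hfin
  have h := congrArg (fun μ => μ {∞}) hlaw
  beta_reduce at h
  rw [Measure.map_apply (measurable_countIn hnet.poisson.measurable measurableSet_ball)
    (measurableSet_singleton _), Measure.map_apply (measurable_of_countable _)
    (measurableSet_singleton _)] at h
  have h0 : (fun n : ℕ => (n : ℝ≥0∞)) ⁻¹' {∞} = ∅ := by
    ext n
    simp
  rw [h0, measure_empty] at h
  have h' : ∀ᵐ ω ∂P, countIn X (Metric.ball 0 R) ω ≠ ∞ := by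
    rw [ae_iff]
    simpa using! h
  filter_upwards [h'] with ω hω
  have := ENNReal.finite_const_le_of_tsum_ne_top hω one_ne_zero
  refine this.subset fun i hi => ?_
  rw [Set.mem_ofPred_eq, Set.indicator_of_mem (show X i ω ∈ Metric.ball 0 R from hi)]

/-- Almost surely, the path losses in each sector are distinct and do not accumulate. -/
theorem IsNetwork.ae_separated (hnet : IsNetwork P p X los F) (hp : p.Admissible) :
    ∀ᵐ ω ∂P, ∀ j, p.Separated j fun i => (X i ω, los i ω) := by
  have h1 : ∀ᵐ ω ∂P, ∀ n : ℕ, {i | X i ω ∈ Metric.ball 0 (n : ℝ)}.Finite :=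
    ae_all_iff.2 fun n => hnet.ae_finite_ball n
  have h2 : ∀ᵐ ω ∂P, ∀ (j : Fin p.K) (n : ℕ), ¬ p.HasTie j (n + 1) fun i => (X i ω, los i ω) := by
    refine ae_all_iff.2 fun j => ae_all_iff.2 fun n => ?_
    rw [ae_iff]
    simpa using hnet.measure_hasTie hp j (R := (n : ℝ) + 1) (by positivity)
  filter_upwards [h1, h2] with ω hfin htie j
  refine ⟨fun t => ?_, fun i k hi hk heq => ?_⟩
  · rcases lt_or_ge t 0 with ht | ht
    · refine Set.Finite.subset Set.finite_empty fun k hk => ?_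
      exact absurd (hk.2.trans ht) (not_lt.2 (loss_nonneg hp _))
    -- A loss below `t` confines the point to a ball, whichever its LOS state.
    obtain ⟨n, hn⟩ := exists_nat_gt (max (p.invLossL t) (p.invLossN t))
    refine (hfin n).subset fun k hk => ?_
    rw [Set.mem_ofPred_eq, mem_ball_zero_iff]
    have hk2 := hk.2
    unfold Params.loss at hk2
    split_ifs at hk2
    · exact ((lossL_lt_iff hp (norm_nonneg _) ht).1 hk2).trans ((le_max_left _ _).trans_lt hn)
    · exact ((lossN_lt_iff hp (norm_nonneg _) ht).1 hk2).trans ((le_max_right _ _).trans_lt hn)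
  · by_contra hik
    obtain ⟨n, hn⟩ := exists_nat_gt (p.loss (X i ω, los i ω))
    exact htie j n ⟨i, k, hik, hi, hk, heq, hn.trans (by linarith)⟩

end Separation

/-! ### Right-continuity of the detection weight in the serving loss. -/

section RightContinuity

variable {Ω : Type*} [MeasurableSpace Ω] {P : Measure Ω} [IsProbabilityMeasure P] {p : Params}
  {X : ℕ → Ω → ℂ} {los : ℕ → Ω → Bool} {F : ℕ → Ω → ℝ}

lemma interfWeight_mono (hp : p.Admissible) {z t l : ℝ} (hz : 0 < z) (hzt : z ≤ t)
    (h : z < l → t < l) : p.interfWeight z l ≤ p.interfWeight t l := by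
  have hG := hp.Gam_pos
  unfold Params.interfWeight
  by_cases hzl : z < l
  · have hl : 0 < l := hz.trans hzl
    rw [if_pos hzl, if_pos (h hzl)]
    gcongr
  · rw [if_neg hzl]
    exact zero_le

lemma interfWeight_le_mul (hp : p.Admissible) {z t l : ℝ} (hz : 0 < z) (hzt : z ≤ t) :
    p.interfWeight t l ≤ ENNReal.ofReal (t / z) * p.interfWeight z l := by
  have hG := hp.Gam_pos
  have ht : 0 < t := hz.trans_le hzt
  unfold Params.interfWeight
  by_cases htl : t < l
  · have hl : 0 < l := ht.trans htl
    rw [if_pos htl, if_pos (hzt.trans_lt htl), ← ENNReal.ofReal_mul (by positivity)]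
    apply ENNReal.ofReal_le_ofReal
    have ha : 0 ≤ p.Gam * z / l := by positivity
    -- Bernoulli: `1 + (t / z) s ≤ (1 + s) ^ (t / z)` with `s = Γ z / l`, so the logarithm grows at
    -- most by the factor `t / z`.
    have h1 := one_add_mul_self_le_rpow_one_add (s := p.Gam * z / l) (by linarith)
      ((one_le_div hz).2 hzt)
    rw [← Real.log_rpow (by positivity)]
    apply Real.log_le_log (by positivity)
    convert h1 using 2
    field_simp
  · rw [if_neg htl]
    exact zero_le

/-- For `t` slightly above `z` no loss lies in `(z, t]`, so each weight is at least its value at `z`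
and at most `t / z` times it. This sandwich also covers infinite sums. From the left a point of loss
exactly `z` would still interfere, so only the right limit is claimed. -/
lemma tendsto_sectorSum_interfWeight (hp : p.Admissible) {j : Fin p.K} {y : ℕ → ℂ × Bool}
    (hy : p.Separated j y) {z : ℝ} (hz : 0 < z) :
    Tendsto (fun t => p.sectorSum j (p.interfWeight t) y) (𝓝[>] z)
      (𝓝 (p.sectorSum j (p.interfWeight z) y)) := by
  have hup : Tendsto (fun t => ENNReal.ofReal (t / z) * p.sectorSum j (p.interfWeight z) y)
      (𝓝[>] z) (𝓝 (p.sectorSum j (p.interfWeight z) y)) := by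
    have h1 : Tendsto (fun t : ℝ => ENNReal.ofReal (t / z)) (𝓝[>] z) (𝓝 1) := by
      have h2 : Tendsto (fun t : ℝ => ENNReal.ofReal (t / z)) (𝓝 z) (𝓝 (ENNReal.ofReal (z / z))) :=
        (ENNReal.continuous_ofReal.comp (continuous_id.div_const z)).tendsto z
      rw [div_self hz.ne', ENNReal.ofReal_one] at h2
      exact h2.mono_left nhdsWithin_le_nhds
    simpa using ENNReal.Tendsto.mul_const (b := p.sectorSum j (p.interfWeight z) y) h1
      (Or.inl one_ne_zero)
  have hgap : ∀ᶠ t in 𝓝[>] z, ∀ k, (y k).1 ∈ p.bsSector j → z < p.loss (y k) → t < p.loss (y k) := by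
    have h1 : ∀ᶠ t in 𝓝[>] z, ∀ k ∈ {k | (y k).1 ∈ p.bsSector j ∧ p.loss (y k) < z + 1},
        z < p.loss (y k) → t < p.loss (y k) := by
      rw [Filter.eventually_all_finite (hy.finite (z + 1))]
      intro k _
      by_cases hk : z < p.loss (y k)
      · filter_upwards [mem_nhdsWithin_of_mem_nhds (Iio_mem_nhds hk)] with t ht _ using ht
      · exact Eventually.of_forall fun t h => absurd h hk
    filter_upwards [h1, mem_nhdsWithin_of_mem_nhds (Iio_mem_nhds (lt_add_one z))] with t ht ht1 k hk hzk
    by_cases hlt : p.loss (y k) < z + 1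
    · exact ht k ⟨hk, hlt⟩ hzk
    · exact lt_of_lt_of_le ht1 (not_lt.1 hlt)
  refine tendsto_of_tendsto_of_tendsto_of_le_of_le' tendsto_const_nhds hup ?_ ?_
  · filter_upwards [hgap, self_mem_nhdsWithin] with t ht htz
    refine ENNReal.tsum_le_tsum fun k => ?_
    by_cases hk : (y k).1 ∈ p.bsSector j
    · rw [Set.indicator_of_mem hk, Set.indicator_of_mem hk]
      exact interfWeight_mono hp hz (le_of_lt htz) (ht k hk)
    · rw [Set.indicator_of_notMem hk, Set.indicator_of_notMem hk]
  · filter_upwards [self_mem_nhdsWithin] with t htz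
    unfold Params.sectorSum
    rw [← ENNReal.tsum_mul_left]
    refine ENNReal.tsum_le_tsum fun k => ?_
    by_cases hk : (y k).1 ∈ p.bsSector j
    · rw [Set.indicator_of_mem hk, Set.indicator_of_mem hk]
      exact interfWeight_le_mul hp hz (le_of_lt htz)
    · rw [Set.indicator_of_notMem hk, Set.indicator_of_notMem hk, mul_zero]

lemma tendsto_detectWeight (hp : p.Admissible) {j : Fin p.K} {y : ℕ → ℂ × Bool}
    (hy : p.Separated j y) {z : ℝ} (hz : 0 < z) :
    Tendsto (fun t => p.detectWeight j t y) (𝓝[>] z) (𝓝 (p.detectWeight j z y)) := by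
  have h1 : Continuous fun t : ℝ => ENNReal.ofReal (p.Gam * t * p.effNoise) :=
    ENNReal.continuous_ofReal.comp (by fun_prop)
  exact (continuous_en.tendsto _).comp
    (((h1.tendsto z).mono_left nhdsWithin_le_nhds).add (tendsto_sectorSum_interfWeight hp hy hz))

lemma measurable_detectWeight (j : Fin p.K) (t : ℝ) : Measurable (p.detectWeight j t) :=
  measurable_en.comp (measurable_const.add (measurable_sectorSum j (measurable_interfWeight t)))

/-- `Ptilde` is the mean of `detectWeight` in any one sector, so it inherits right-continuity by
dominated convergence. -/
lemma IsNetwork.tendsto_Ptilde (hnet : IsNetwork P p X los F) (hp : p.Admissible) {z : ℝ}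
    (hz : 0 < z) : Tendsto p.Ptilde (𝓝[>] z) (𝓝 (p.Ptilde z)) := by
  have hYm : Measurable fun ω (i : ℕ) => (X i ω, los i ω) :=
    measurable_pi_lambda _ fun i => measurable_marked hnet i
  have j : Fin p.K := ⟨0, hp.K_pos⟩
  have h : Tendsto (fun t => ∫ ω, p.detectWeight j t (fun i => (X i ω, los i ω)) ∂P) (𝓝[>] z)
      (𝓝 (∫ ω, p.detectWeight j z (fun i => (X i ω, los i ω)) ∂P)) := by
    refine tendsto_integral_filter_of_dominated_convergence (fun _ => 1)
      (Eventually.of_forall fun t => ((measurable_detectWeight j t).comp hYm).aestronglyMeasurable)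
      (Eventually.of_forall fun t => Eventually.of_forall fun ω => abs_en_le _)
      (integrable_const _) ?_
    filter_upwards [hnet.ae_separated hp] with ω hω
    exact tendsto_detectWeight hp (hω j) hz
  rw [hnet.integral_detectWeight hp j hz] at h
  refine h.congr' ?_
  filter_upwards [self_mem_nhdsWithin] with t ht
  exact hnet.integral_detectWeight hp j (hz.trans ht)

lemma Ptilde_nonneg (z : ℝ) : 0 ≤ p.Ptilde z := mul_nonneg (Real.exp_pos _).le (en_nonneg _)

lemma Ptilde_le_one (hp : p.Admissible) {z : ℝ} (hz : 0 ≤ z) : p.Ptilde z ≤ 1 := by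
  have hG := hp.Gam_pos
  have hN := effNoise_pos hp
  refine mul_le_one₀ (Real.exp_le_one_iff.2 ?_) (en_nonneg _) (en_le_one _)
  have : 0 ≤ p.Gam * z * p.effNoise := by positivity
  linarith

end RightContinuity

/-! ### Step functions sampled at right endpoints. -/

section Step

open Classical in
/-- Approximation of `g` on `[0, R)` by the values of `g` at the right ends of `n` equal cells. -/
noncomputable def stepApprox (g : ℝ → ℝ) (R : ℝ) (n : ℕ) (l : ℝ) : ℝ :=
  ∑ m ∈ Finset.range n, if R * m / n ≤ l ∧ l < R * (m + 1 : ℕ) / n then g (R * (m + 1 : ℕ) / n) else 0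

/-- The cells are disjoint, so only the one containing `l` contributes. Its right end is strictly
larger than `l`, which is why right-continuity suffices for convergence. -/
lemma exists_stepApprox_eq (g : ℝ → ℝ) {R l : ℝ} (hl : 0 ≤ l) (hlR : l < R) {n : ℕ} (hn : 0 < n) :
    ∃ t, l < t ∧ t ≤ l + R / n ∧ stepApprox g R n l = g t := by
  have hR : 0 < R := hl.trans_lt hlR
  have hn' : (0 : ℝ) < n := by exact_mod_cast hn
  obtain ⟨m, hm, h1, h2⟩ := exists_cell hl hlR hn
  refine ⟨_, h2, ?_, ?_⟩
  · have : R * (m + 1 : ℕ) / n = R * m / n + R / n := by push_cast; ring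
    linarith
  · unfold stepApprox
    rw [Finset.sum_eq_single m, if_pos ⟨h1, h2⟩]
    · intro k _ hkm
      rw [if_neg]
      rintro ⟨h3, h4⟩
      have h5 := h3.trans_lt h2
      have h6 := h1.trans_lt h4
      rw [div_lt_div_iff_of_pos_right hn', mul_lt_mul_iff_right₀ hR, Nat.cast_lt] at h5 h6
      omega
    · intro hm'
      exact absurd (Finset.mem_range.2 hm) hm'

lemma tendsto_stepApprox {g : ℝ → ℝ} {R l : ℝ} (hl : 0 ≤ l) (hlR : l < R)
    (hg : Tendsto g (𝓝[>] l) (𝓝 (g l))) :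
    Tendsto (fun n => stepApprox g R (n + 1) l) atTop (𝓝 (g l)) := by
  choose t ht1 ht2 ht3 using fun n : ℕ => exists_stepApprox_eq g hl hlR (Nat.succ_pos n)
  have h0 : Tendsto (fun n : ℕ => l + R / ((n + 1 : ℕ) : ℝ)) atTop (𝓝 l) := by
    have := (tendsto_const_div_atTop_nhds_zero_nat R).comp (tendsto_add_atTop_nat 1)
    simpa using this.const_add l
  have h1 : Tendsto t atTop (𝓝[>] l) :=
    tendsto_nhdsWithin_iff.2 ⟨tendsto_of_tendsto_of_tendsto_of_le_of_le tendsto_const_nhds h0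
      (fun n => (ht1 n).le) ht2, Eventually.of_forall ht1⟩
  exact (hg.comp h1).congr fun n => (ht3 n).symm

lemma measurable_stepApprox (g : ℝ → ℝ) (R : ℝ) (n : ℕ) : Measurable (stepApprox g R n) :=
  Finset.measurable_fun_sum _ fun _ _ => Measurable.ite measurableSet_Ico measurable_const
    measurable_const

end Step

/-! ### Riemann sums for the detection probability. -/

section Riemann

variable {Ω : Type*} [MeasurableSpace Ω] {P : Measure Ω} [IsProbabilityMeasure P] {p : Params}
  {X : ℕ → Ω → ℂ} {los : ℕ → Ω → Bool} {F : ℕ → Ω → ℝ}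

lemma integrableOn_fZ1 (hp : p.Admissible) {R : ℝ} (hR : 0 ≤ R) :
    IntegrableOn p.fZ1 (Set.Ico 0 R) := by
  rw [integrableOn_Ico_iff_integrableOn_Ioo]
  exact (intervalIntegrable_iff_integrableOn_Ioo_of_le hR).1 (intervalIntegrable_fZ1 hp hR)

lemma setIntegral_fZ1_Ico (hp : p.Admissible) {s t : ℝ} (hs : 0 ≤ s) (hst : s ≤ t) :
    ∫ z in Set.Ico s t, p.fZ1 z = Real.exp (-p.cumMass s) - Real.exp (-p.cumMass t) := by
  rw [integral_Ico_eq_integral_Ioo, ← integral_Ioc_eq_integral_Ioo,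
    ← intervalIntegral.integral_of_le hst,
    ← intervalIntegral.integral_interval_sub_left (intervalIntegrable_fZ1 hp (hs.trans hst))
      (intervalIntegrable_fZ1 hp hs), integral_fZ1 hp hs, integral_fZ1 hp (hs.trans hst)]
  ring

lemma integral_stepApprox_mul_fZ1 (hp : p.Admissible) (g : ℝ → ℝ) {R : ℝ} (hR : 0 < R) (n : ℕ) :
    ∫ z in Set.Ico 0 R, stepApprox g R n z * p.fZ1 z =
      ∑ m ∈ Finset.range n, (Real.exp (-p.cumMass (R * m / n)) -
        Real.exp (-p.cumMass (R * (m + 1 : ℕ) / n))) * g (R * (m + 1 : ℕ) / n) := by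
  classical
  have hterm : ∀ z, stepApprox g R n z * p.fZ1 z = ∑ m ∈ Finset.range n,
      g (R * (m + 1 : ℕ) / n) *
        (Set.Ico (R * m / n) (R * (m + 1 : ℕ) / n)).indicator p.fZ1 z := by
    intro z
    unfold stepApprox
    rw [Finset.sum_mul]
    refine Finset.sum_congr rfl fun m _ => ?_
    by_cases h : R * m / n ≤ z ∧ z < R * (m + 1 : ℕ) / n
    · rw [if_pos h, Set.indicator_of_mem (Set.mem_Ico.2 h)]
    · rw [if_neg h, Set.indicator_of_notMem (fun h' => h (Set.mem_Ico.1 h'))]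
      simp
  simp_rw [hterm]
  rw [integral_finsetSum _ fun m _ =>
    ((integrableOn_fZ1 hp hR.le).integrable.indicator measurableSet_Ico).const_mul _]
  refine Finset.sum_congr rfl fun m hm => ?_
  have hm' : m < n := Finset.mem_range.1 hm
  have hn' : (0 : ℝ) < n := by exact_mod_cast (Nat.zero_le m).trans_lt hm'
  have h0 : 0 ≤ R * m / n := by positivity
  have h1 : R * (m + 1 : ℕ) / n ≤ R := by
    rw [div_le_iff₀ hn']
    exact mul_le_mul_of_nonneg_left (by exact_mod_cast hm') hR.le
  have h2 : R * m / n ≤ R * (m + 1 : ℕ) / n := by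
    push_cast
    gcongr
    linarith
  rw [integral_const_mul, setIntegral_indicator measurableSet_Ico,
    Set.inter_eq_self_of_subset_right (Set.Ico_subset_Ico h0 h1), setIntegral_fZ1_Ico hp h0 h2,
    mul_comm]

lemma norm_stepApprox_Ptilde_le (hp : p.Admissible) {R : ℝ} {z : ℝ} (hz : z ∈ Set.Ico 0 R) (n : ℕ) :
    ‖stepApprox p.Ptilde R (n + 1) z‖ ≤ 1 := by
  obtain ⟨t, ht, _, h⟩ := exists_stepApprox_eq p.Ptilde hz.1 hz.2 (Nat.succ_pos n)
  rw [h, Real.norm_eq_abs, abs_of_nonneg (Ptilde_nonneg t)]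
  exact Ptilde_le_one hp (hz.1.trans ht.le)

lemma IsNetwork.ae_tendsto_stepApprox (hnet : IsNetwork P p X los F) (hp : p.Admissible) (R : ℝ) :
    ∀ᵐ z ∂volume.restrict (Set.Ico 0 R),
      Tendsto (fun n => stepApprox p.Ptilde R (n + 1) z * p.fZ1 z) atTop
        (𝓝 (p.Ptilde z * p.fZ1 z)) := by
  -- Right-continuity of `Ptilde` is known only at positive points; the origin is a null set.
  have h0 : ∀ᵐ z : ℝ ∂volume.restrict (Set.Ico 0 R), z ≠ 0 :=
    ae_restrict_of_ae (Measure.ae_ne volume 0)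
  filter_upwards [h0, ae_restrict_mem measurableSet_Ico] with z hz hzR
  exact (tendsto_stepApprox hzR.1 hzR.2
    (hnet.tendsto_Ptilde hp (lt_of_le_of_ne hzR.1 hz.symm))).mul_const _

/-- Measurability comes from the limit of the step functions, integrability from `0 ≤ Ptilde ≤ 1`.
-/
lemma IsNetwork.integrableOn_Ptilde_mul_fZ1_Ico (hnet : IsNetwork P p X los F) (hp : p.Admissible)
    {R : ℝ} (hR : 0 ≤ R) : IntegrableOn (fun z => p.Ptilde z * p.fZ1 z) (Set.Ico 0 R) := by
  have hf := integrableOn_fZ1 hp hR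
  have hm : AEStronglyMeasurable (fun z => p.Ptilde z * p.fZ1 z)
      (volume.restrict (Set.Ico 0 R)) :=
    aestronglyMeasurable_of_tendsto_ae atTop
      (fun n => (measurable_stepApprox p.Ptilde R (n + 1)).aestronglyMeasurable.mul
        hf.aestronglyMeasurable) (hnet.ae_tendsto_stepApprox hp R)
  refine Integrable.mono hf hm ((ae_restrict_iff' measurableSet_Ico).2
    (Eventually.of_forall fun z hz => ?_))
  rw [norm_mul, Real.norm_eq_abs, abs_of_nonneg (Ptilde_nonneg z)]
  exact mul_le_of_le_one_left (norm_nonneg _) (Ptilde_le_one hp hz.1)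

lemma IsNetwork.tendsto_sum_Ptilde (hnet : IsNetwork P p X los F) (hp : p.Admissible)
    {R : ℝ} (hR : 0 < R) :
    Tendsto (fun n : ℕ => ∑ m ∈ Finset.range (n + 1),
      (Real.exp (-p.cumMass (R * m / (n + 1 : ℕ))) -
        Real.exp (-p.cumMass (R * (m + 1 : ℕ) / (n + 1 : ℕ)))) *
          p.Ptilde (R * (m + 1 : ℕ) / (n + 1 : ℕ))) atTop
      (𝓝 (∫ z in Set.Ico 0 R, p.Ptilde z * p.fZ1 z)) := by
  have hf := integrableOn_fZ1 hp hR.le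
  have h := tendsto_integral_of_dominated_convergence (μ := volume.restrict (Set.Ico 0 R))
    (F := fun n z => stepApprox p.Ptilde R (n + 1) z * p.fZ1 z) (fun z => ‖p.fZ1 z‖)
    (fun n => (measurable_stepApprox p.Ptilde R (n + 1)).aestronglyMeasurable.mul
        hf.aestronglyMeasurable) hf.norm
    (fun n => (ae_restrict_iff' measurableSet_Ico).2 (Eventually.of_forall fun z hz => by
      rw [norm_mul]
      exact mul_le_of_le_one_left (norm_nonneg _) (norm_stepApprox_Ptilde_le hp hz n)))
    (hnet.ae_tendsto_stepApprox hp R)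
  exact h.congr fun n => integral_stepApprox_mul_fZ1 hp p.Ptilde hR (n + 1)

end Riemann

/-- By multilinearity, factorization for every choice of one term per index extends to linear
combinations. It carries sector independence from exponentials to differences of `gapLaplace`. -/
lemma integral_prod_sum_of_forall {Ω ι Q : Type*} [MeasurableSpace Ω] {P : Measure Ω} [Fintype ι]
    [Fintype Q] {A : ι → Q → Ω → ℝ} {a : Q → ℝ} (c : Q → ℝ)
    (hint : ∀ q : ι → Q, Integrable (fun ω => ∏ j, A j (q j) ω) P)
    (hA : ∀ q : ι → Q, ∫ ω, ∏ j, A j (q j) ω ∂P = ∏ j, a (q j)) :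
    ∫ ω, ∏ j, ∑ q, c q * A j q ω ∂P = ∏ _j : ι, ∑ q, c q * a q := by
  classical
  simp_rw [Finset.prod_univ_sum, Finset.prod_mul_distrib]
  rw [integral_finsetSum _ fun q _ => (hint q).const_mul _]
  exact Finset.sum_congr rfl fun q _ => by rw [integral_const_mul, hA]

/-! ### Law of the tagged path loss and its density. -/

section Assembly

variable {Ω : Type*} [MeasurableSpace Ω] {P : Measure Ω} [IsProbabilityMeasure P] {p : Params}
  {X : ℕ → Ω → ℂ} {los : ℕ → Ω → Bool} {F : ℕ → Ω → ℝ}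

/-- Discretization of `Params.successProb` with `n` cells. -/
noncomputable def Params.successApprox (p : Params) (R : ℝ) (n : ℕ) (j : Fin p.K)
    (y : ℕ → ℂ × Bool) : ℝ :=
  ∑ m ∈ Finset.range n,
    (p.gapLaplace j (R * m / n) (R * (m + 1 : ℕ) / n) y -
      p.gapLaplace j (R * (m + 1 : ℕ) / n) (R * (m + 1 : ℕ) / n) y)

lemma measurable_successApprox (R : ℝ) (n : ℕ) (j : Fin p.K) :
    Measurable (p.successApprox R n j) :=
  Finset.measurable_fun_sum _ fun _ _ =>
    (measurable_gapLaplace j _ _).sub (measurable_gapLaplace j _ _)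

lemma successApprox_eq_zero (hp : p.Admissible) {R : ℝ} (hR : 0 ≤ R) (n : ℕ) {j : Fin p.K}
    {y : ℕ → ℂ × Bool} (h : ¬ p.minLossAt j y < ENNReal.ofReal R) :
    p.successApprox R n j y = 0 := by
  refine Finset.sum_eq_zero fun m hm => ?_
  have hm' : m < n := Finset.mem_range.1 hm
  have hn' : (0 : ℝ) < n := by exact_mod_cast (Nat.zero_le m).trans_lt hm'
  have h1 : R * (m + 1 : ℕ) / n ≤ R := by
    rw [div_le_iff₀ hn']
    exact mul_le_mul_of_nonneg_left (by exact_mod_cast hm') hR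
  have h2 : R * m / n ≤ R := by
    rw [div_le_iff₀ hn']
    exact mul_le_mul_of_nonneg_left (by exact_mod_cast hm'.le) hR
  rw [gapLaplace_eq hp, gapLaplace_eq hp, if_neg, if_neg, sub_self]
  · exact fun h' => h (h'.trans_le (ENNReal.ofReal_le_ofReal h1))
  · exact fun h' => h (h'.trans_le (ENNReal.ofReal_le_ofReal h2))

/-- The two terms of a cell cancel unless the minimal loss `l` lies in it; then the detection weight
at the right end remains. -/
lemma successApprox_eq_stepApprox (hp : p.Admissible) (R : ℝ) (n : ℕ) {j : Fin p.K}
    {y : ℕ → ℂ × Bool} {l : ℝ} (hl : 0 ≤ l) (h : ENNReal.ofReal l = p.minLossAt j y) :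
    p.successApprox R n j y = stepApprox (fun t => p.detectWeight j t y) R n l := by
  refine Finset.sum_congr rfl fun m _ => ?_
  rw [gapLaplace_eq hp, gapLaplace_eq hp, ← h]
  simp only [ENNReal.ofReal_lt_ofReal_iff_of_nonneg hl]
  by_cases h1 : l < R * m / n
  · have h2 : l < R * (m + 1 : ℕ) / n := by
      -- For `n = 0` the quotient is 0 by convention, against `0 ≤ l`.
      rcases Nat.eq_zero_or_pos n with hn | hn
      · simp [hn] at h1
        exact absurd h1 (not_lt.2 hl)
      have hn' : (0 : ℝ) < n := by exact_mod_cast hn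
      have hR : 0 < R := by
        by_contra hR
        have : R * m / n ≤ 0 := div_nonpos_of_nonpos_of_nonneg
          (mul_nonpos_of_nonpos_of_nonneg (not_lt.1 hR) (by positivity)) hn'.le
        linarith
      refine h1.trans_le ?_
      push_cast
      gcongr
      linarith
    rw [if_pos h1, if_pos h2, if_neg (fun h => absurd h1 (not_lt.2 h.1)), sub_self]
  · by_cases h2 : l < R * (m + 1 : ℕ) / n
    · rw [if_neg h1, if_pos h2, if_pos ⟨not_lt.1 h1, h2⟩, sub_zero]
    · rw [if_neg h1, if_neg h2, if_neg (fun h => h2 h.2), sub_self]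

lemma abs_one_sub_successApprox_le (hp : p.Admissible) {R : ℝ} (hR : 0 ≤ R) (n : ℕ) {j : Fin p.K}
    {y : ℕ → ℂ × Bool} (hy : p.Separated j y) : |1 - p.successApprox R (n + 1) j y| ≤ 1 := by
  by_cases h : p.minLossAt j y < ENNReal.ofReal R
  · obtain ⟨i, hi, hmin⟩ := hy.exists_min hp h
    have hl := loss_nonneg hp (y i)
    rw [← hmin, ENNReal.ofReal_lt_ofReal_iff_of_nonneg hl] at h
    obtain ⟨t, _, _, ht⟩ := exists_stepApprox_eq (fun t => p.detectWeight j t y) hl h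
      (Nat.succ_pos n)
    rw [successApprox_eq_stepApprox hp R (n + 1) hl hmin, ht, abs_le]
    have h0 : 0 ≤ p.detectWeight j t y := en_nonneg _
    have h1 : p.detectWeight j t y ≤ 1 := en_le_one _
    constructor <;> linarith
  · rw [successApprox_eq_zero hp hR _ h]
    simp

lemma tendsto_successApprox (hp : p.Admissible) {R : ℝ} (hR : 0 ≤ R) {j : Fin p.K}
    {y : ℕ → ℂ × Bool} (hy : p.Separated j y) :
    Tendsto (fun n => p.successApprox R (n + 1) j y) atTop (𝓝 (p.successProb R j y)) := by
  unfold Params.successProb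
  by_cases h : p.minLossAt j y < ENNReal.ofReal R
  · obtain ⟨i, hi, hmin⟩ := hy.exists_min hp h
    have hl := loss_pos hp hi
    rw [if_pos h, ← hmin, ENNReal.toReal_ofReal hl.le]
    rw [← hmin, ENNReal.ofReal_lt_ofReal_iff_of_nonneg hl.le] at h
    simp_rw [successApprox_eq_stepApprox hp R _ hl.le hmin]
    exact tendsto_stepApprox hl.le h (tendsto_detectWeight hp hy hl)
  · rw [if_neg h]
    simp_rw [successApprox_eq_zero hp hR _ h]
    exact tendsto_const_nhds

/-- Endpoints `(s, t)` of the functional `Params.gapLaplace` used for cell `m`. -/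
noncomputable def cellEnds (R : ℝ) (n : ℕ) (q : Fin n × Bool) : ℝ × ℝ :=
  (if q.2 = true then R * ((q.1 : ℕ) : ℝ) / n else R * ((q.1 : ℕ) + 1 : ℕ) / n,
    R * ((q.1 : ℕ) + 1 : ℕ) / n)

lemma IsNetwork.integral_prod_successApprox (hnet : IsNetwork P p X los F) (hp : p.Admissible)
    {R : ℝ} (hR : 0 < R) (n : ℕ) :
    ∫ ω, ∏ j, (1 - p.successApprox R n j fun i => (X i ω, los i ω)) ∂P =
      (1 - ∑ m ∈ Finset.range n, (Real.exp (-p.cumMass (R * m / n)) -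
        Real.exp (-p.cumMass (R * (m + 1 : ℕ) / n))) * p.Ptilde (R * (m + 1 : ℕ) / n)) ^ p.K := by
  classical
  have hYm : Measurable fun ω (i : ℕ) => (X i ω, los i ω) :=
    measurable_pi_lambda _ fun i => measurable_marked hnet i
  -- `1 - successApprox` as a linear combination: `none` is the constant 1, `(m, true)` the term
  -- `gapLaplace s t` with coefficient -1, and `(m, false)` the term `gapLaplace t t` with
  -- coefficient 1.
  let w : Option (Fin n × Bool) → ℝ → ℝ≥0∞ := fun o => o.elim (fun _ => 0) fun q =>
    p.gapWeight (cellEnds R n q).1 (cellEnds R n q).2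
  let k : Option (Fin n × Bool) → ℝ≥0∞ := fun o => o.elim 0 fun q =>
    ENNReal.ofReal (p.Gam * (cellEnds R n q).2 * p.effNoise)
  let c : Option (Fin n × Bool) → ℝ := fun o => o.elim 1 fun q => if q.2 = true then -1 else 1
  have hw : ∀ o, Measurable (w o) := by
    intro o
    cases o with
    | none => exact measurable_const
    | some q => exact measurable_gapWeight _ _
  have hmeas : ∀ j o, Measurable fun ω => k o + p.sectorSum j (w o) fun i => (X i ω, los i ω) :=
    fun j o => measurable_const.add ((measurable_sectorSum j (hw o)).comp hYm)
  have key := integral_prod_sum_of_forall (P := P) (ι := Fin p.K)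
    (A := fun j o ω => en (k o + p.sectorSum j (w o) fun i => (X i ω, los i ω)))
    (a := fun o => en (k o + ENNReal.ofReal (2 * Real.pi * p.lam / p.K) *
        p.lossIntegral fun l => 1 - en (w o l))) c
    (fun q => by
      simp_rw [← en_sum]
      exact integrable_en_comp (Finset.measurable_fun_sum _ fun j _ => hmeas j (q j)))
    (fun q => hnet.integral_prod_en_add hp (fun j => hw (q j)) fun j => k (q j))
  rw [Finset.prod_const, Finset.card_univ, Fintype.card_fin] at key
  have hL : ∀ (j : Fin p.K) ω, ∑ o, c o * en (k o + p.sectorSum j (w o) fun i => (X i ω, los i ω)) =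
      1 - p.successApprox R n j fun i => (X i ω, los i ω) := by
    intro j ω
    rw [Fintype.sum_option, Fintype.sum_prod_type, Params.successApprox, Finset.sum_range,
      sub_eq_add_neg, ← Finset.sum_neg_distrib]
    congr 1
    · simp [c, k, w, Params.sectorSum]
    · refine Finset.sum_congr rfl fun m _ => ?_
      rw [Fintype.sum_bool]
      simp only [c, k, w, Option.elim_some, cellEnds, if_true, Bool.false_eq_true, if_false,
        Params.gapLaplace]
      ring
  have hR' : ∑ o, c o * en (k o + ENNReal.ofReal (2 * Real.pi * p.lam / p.K) *
        p.lossIntegral fun l => 1 - en (w o l)) =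
      1 - ∑ m ∈ Finset.range n, (Real.exp (-p.cumMass (R * m / n)) -
        Real.exp (-p.cumMass (R * (m + 1 : ℕ) / n))) * p.Ptilde (R * (m + 1 : ℕ) / n) := by
    rw [Fintype.sum_option, Fintype.sum_prod_type, Finset.sum_range, sub_eq_add_neg,
      ← Finset.sum_neg_distrib]
    congr 1
    · simp [c, k, w, Params.lossIntegral]
    · refine Finset.sum_congr rfl fun m _ => ?_
      have hn' : (0 : ℝ) < n := by exact_mod_cast (Nat.zero_le _).trans_lt m.2
      have h0 : 0 ≤ R * ((m : ℕ) : ℝ) / n := by positivity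
      have h1 : 0 < R * ((m : ℕ) + 1 : ℕ) / n := by positivity
      have h2 : R * ((m : ℕ) : ℝ) / n ≤ R * ((m : ℕ) + 1 : ℕ) / n := by
        push_cast
        gcongr
        linarith
      rw [Fintype.sum_bool]
      simp only [c, k, w, Option.elim_some, cellEnds, if_true, Bool.false_eq_true, if_false]
      rw [en_gapWeight_eq hp h0 h1 h2, en_gapWeight_eq hp h1.le h1 le_rfl]
      ring
  rw [hR'] at key
  rw [← key]
  simp_rw [hL]

/-- The distribution of the path loss to the tagged base station. -/
theorem IsNetwork.measureReal_le_taggedLoss_eq (hnet : IsNetwork P p X los F) (hp : p.Admissible)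
    {R : ℝ} (hR : 0 < R) :
    P.real {ω | ENNReal.ofReal R ≤ taggedLoss p X los F ω} =
      (1 - ∫ z in Set.Ico 0 R, p.Ptilde z * p.fZ1 z) ^ p.K := by
  have hYm : Measurable fun ω (i : ℕ) => (X i ω, los i ω) :=
    measurable_pi_lambda _ fun i => measurable_marked hnet i
  have hsep := hnet.ae_separated hp
  rw [hnet.measureReal_le_taggedLoss hp hsep]
  have hL : Tendsto (fun n : ℕ =>
      ∫ ω, ∏ j, (1 - p.successApprox R (n + 1) j fun i => (X i ω, los i ω)) ∂P) atTop
      (𝓝 (∫ ω, ∏ j, (1 - p.successProb R j fun i => (X i ω, los i ω)) ∂P)) := by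
    refine tendsto_integral_of_dominated_convergence (fun _ => 1) (fun n =>
      (Finset.measurable_fun_prod _ fun j _ => measurable_const.sub
        ((measurable_successApprox R (n + 1) j).comp hYm)).aestronglyMeasurable)
      (integrable_const _) (fun n => ?_) ?_
    · filter_upwards [hsep] with ω hω
      rw [Real.norm_eq_abs, Finset.abs_prod]
      exact Finset.prod_le_one (fun _ _ => abs_nonneg _) fun j _ =>
        abs_one_sub_successApprox_le hp hR.le n (hω j)
    · filter_upwards [hsep] with ω hω
      exact tendsto_finsetProd _ fun j _ => (tendsto_successApprox hp hR.le (hω j)).const_sub 1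
  refine tendsto_nhds_unique hL ?_
  simp_rw [hnet.integral_prod_successApprox hp hR]
  exact ((hnet.tendsto_sum_Ptilde hp hR).const_sub 1).pow _

lemma setIntegral_Ico_eq_interval (f : ℝ → ℝ) {R : ℝ} (hR : 0 ≤ R) :
    ∫ z in Set.Ico 0 R, f z = ∫ z in (0 : ℝ)..R, f z := by
  rw [integral_Ico_eq_integral_Ioo, ← integral_Ioc_eq_integral_Ioo,
    intervalIntegral.integral_of_le hR]

lemma Ptilde_mul_fZ1_nonneg (hp : p.Admissible) {z : ℝ} (hz : 0 < z) :
    0 ≤ p.Ptilde z * p.fZ1 z := mul_nonneg (Ptilde_nonneg z) (fZ1_nonneg hp hz)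

lemma IsNetwork.intervalIntegrable_Ptilde_mul_fZ1 (hnet : IsNetwork P p X los F)
    (hp : p.Admissible) {R : ℝ} (hR : 0 ≤ R) :
    IntervalIntegrable (fun z => p.Ptilde z * p.fZ1 z) volume 0 R :=
  (intervalIntegrable_iff_integrableOn_Ico_of_le hR).2 (hnet.integrableOn_Ptilde_mul_fZ1_Ico hp hR)

lemma IsNetwork.integral_Ptilde_mul_fZ1_le_one (hnet : IsNetwork P p X los F)
    (hp : p.Admissible) {R : ℝ} (hR : 0 ≤ R) :
    ∫ z in (0 : ℝ)..R, p.Ptilde z * p.fZ1 z ≤ 1 := by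
  have h : ∫ z in (0 : ℝ)..R, p.Ptilde z * p.fZ1 z ≤ ∫ z in (0 : ℝ)..R, p.fZ1 z :=
    intervalIntegral.integral_mono_on_of_le_Ioo hR (hnet.intervalIntegrable_Ptilde_mul_fZ1 hp hR)
      (intervalIntegrable_fZ1 hp hR) fun z hz =>
        mul_le_of_le_one_left (fZ1_nonneg hp hz.1) (Ptilde_le_one hp hz.1.le)
  rw [integral_fZ1 hp hR] at h
  linarith [Real.exp_pos (-p.cumMass R)]

lemma IsNetwork.integrableOn_Ptilde_mul_fZ1 (hnet : IsNetwork P p X los F)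
    (hp : p.Admissible) : IntegrableOn (fun z => p.Ptilde z * p.fZ1 z) (Set.Ioi 0) := by
  refine integrableOn_Ioi_of_intervalIntegral_norm_bounded (l := atTop) (b := fun n : ℕ => (n : ℝ))
    1 0 (fun n => ?_) tendsto_natCast_atTop_atTop (Eventually.of_forall fun n => ?_)
  · exact (hnet.intervalIntegrable_Ptilde_mul_fZ1 hp n.cast_nonneg).1
  · refine le_trans (le_of_eq ?_) (hnet.integral_Ptilde_mul_fZ1_le_one hp n.cast_nonneg)
    refine intervalIntegral.integral_congr_ae (Eventually.of_forall fun z hz => ?_)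
    rw [Set.uIoc_of_le n.cast_nonneg] at hz
    exact Real.norm_of_nonneg (Ptilde_mul_fZ1_nonneg hp hz.1)

/-- Removing the tail from the full integral leaves `∫₀ᴿ`, the probability that a given sector is
detected with loss below `R`. -/
lemma IsNetwork.Ptail_add_one_sub_Pdet (hnet : IsNetwork P p X los F) (hp : p.Admissible)
    {R : ℝ} (hR : 0 ≤ R) :
    p.Ptail R + 1 - p.Pdet = 1 - ∫ z in (0 : ℝ)..R, p.Ptilde z * p.fZ1 z := by
  have h := intervalIntegral.integral_Ioi_sub_Ioi (hnet.integrableOn_Ptilde_mul_fZ1 hp) hR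
  unfold Params.Ptail Params.Pdet
  linarith

lemma IsNetwork.Ptail_add_one_sub_Pdet_nonneg (hnet : IsNetwork P p X los F) (hp : p.Admissible)
    {R : ℝ} (hR : 0 ≤ R) : 0 ≤ p.Ptail R + 1 - p.Pdet := by
  rw [hnet.Ptail_add_one_sub_Pdet hp hR]
  linarith [hnet.integral_Ptilde_mul_fZ1_le_one hp hR]

lemma IsNetwork.measureReal_le_taggedLoss_eq_pow (hnet : IsNetwork P p X los F)
    (hp : p.Admissible) {R : ℝ} (hR : 0 ≤ R) :
    P.real {ω | ENNReal.ofReal R ≤ taggedLoss p X los F ω} = (p.Ptail R + 1 - p.Pdet) ^ p.K := by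
  rw [hnet.Ptail_add_one_sub_Pdet hp hR]
  rcases hR.eq_or_lt with rfl | hR
  · simp
  · rw [hnet.measureReal_le_taggedLoss_eq hp hR, setIntegral_Ico_eq_interval _ hR.le]

lemma IsNetwork.fZ0_nonneg (hnet : IsNetwork P p X los F) (hp : p.Admissible)
    {z : ℝ} (hz : 0 < z) : 0 ≤ p.fZ0 z := by
  unfold Params.fZ0
  have h1 := hnet.Ptail_add_one_sub_Pdet_nonneg hp hz.le
  have h2 := Ptilde_nonneg (p := p) z
  have h3 := fZ1_nonneg hp hz
  positivity

lemma IsNetwork.integrableOn_fZ0 (hnet : IsNetwork P p X los F) (hp : p.Admissible)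
    {R : ℝ} (hR : 0 ≤ R) : IntervalIntegrable p.fZ0 volume 0 R ∧
    ∫ z in (0 : ℝ)..R, p.fZ0 z = 1 - (p.Ptail R + 1 - p.Pdet) ^ p.K := by
  have hq := hnet.intervalIntegrable_Ptilde_mul_fZ1 hp hR
  have heq : Set.EqOn (fun z => (p.K * (1 + -∫ x in (0 : ℝ)..z, p.Ptilde x * p.fZ1 x) ^ (p.K - 1)) *
      (p.Ptilde z * p.fZ1 z)) p.fZ0 (Set.uIcc 0 R) := by
    intro z hz
    rw [Set.uIcc_of_le hR] at hz
    unfold Params.fZ0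
    rw [hnet.Ptail_add_one_sub_Pdet hp hz.1]
    ring
  constructor
  · refine IntervalIntegrable.congr (fun z hz => heq (Set.uIoc_subset_uIcc hz)) ?_
    refine hq.continuousOn_mul ?_
    have := (hq.absolutelyContinuousOnInterval_intervalIntegral
      (Set.left_mem_uIcc (a := (0 : ℝ)) (b := R))).continuousOn
    exact continuousOn_const.mul ((continuousOn_const.add this.neg).pow _)
  -- `fZ0` is the derivative of `-x ^ K` along `x = 1 - ∫₀ᶻ Ptilde fZ1`, hence `c = 1` and the
  -- negated integrand.
  · have h := integral_comp_integral_mul (φ := fun x => -x ^ p.K)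
      (φ' := fun x => -(p.K * x ^ (p.K - 1))) (c := 1) hq.neg
      (fun x => (hasDerivAt_pow p.K x).neg) (by fun_prop)
    rw [← intervalIntegral.integral_congr heq, hnet.Ptail_add_one_sub_Pdet hp hR]
    simp only [Pi.neg_apply, intervalIntegral.integral_neg] at h
    rw [show 1 - (1 - ∫ z in (0 : ℝ)..R, p.Ptilde z * p.fZ1 z) ^ p.K =
      -(1 + -∫ z in (0 : ℝ)..R, p.Ptilde z * p.fZ1 z) ^ p.K - -1 ^ p.K by
        rw [one_pow, ← sub_eq_add_neg]; ring, ← h]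
    refine intervalIntegral.integral_congr fun z _ => ?_
    ring

lemma IsNetwork.setLIntegral_fZ0_Ico (hnet : IsNetwork P p X los F) (hp : p.Admissible)
    {a b : ℝ} (ha : 0 ≤ a) (hab : a ≤ b) :
    ∫⁻ z in Set.Ico a b ∩ Set.Ioi 0, ENNReal.ofReal (p.fZ0 z) =
      ENNReal.ofReal ((p.Ptail a + 1 - p.Pdet) ^ p.K - (p.Ptail b + 1 - p.Pdet) ^ p.K) := by
  have hA := hnet.integrableOn_fZ0 hp ha
  have hB := hnet.integrableOn_fZ0 hp (ha.trans hab)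
  have hi : IntervalIntegrable p.fZ0 volume a b := hA.1.symm.trans hB.1
  have h1 : ∫ z in a..b, p.fZ0 z =
      (p.Ptail a + 1 - p.Pdet) ^ p.K - (p.Ptail b + 1 - p.Pdet) ^ p.K := by
    rw [← intervalIntegral.integral_interval_sub_left hB.1 hA.1, hA.2, hB.2]
    ring
  have h2 : (Set.Ico a b ∩ Set.Ioi 0 : Set ℝ) =ᵐ[volume] Set.Ioc a b := by
    have h3 : (Set.Ico a b ∩ Set.Ioi 0 : Set ℝ) =ᵐ[volume] (Set.Ico a b ∩ Set.Ici 0 : Set ℝ) :=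
      (ae_eq_refl _).inter Ioi_ae_eq_Ici
    have h4 : Set.Ico a b ∩ Set.Ici 0 = Set.Ico a b :=
      Set.inter_eq_left.2 fun z hz => ha.trans hz.1
    rw [h4] at h3
    exact h3.trans Ico_ae_eq_Ioc
  rw [setLIntegral_congr h2, ← h1, intervalIntegral.integral_of_le hab,
    ofReal_integral_eq_lintegral_ofReal hi.1 ((ae_restrict_iff' measurableSet_Ioc).2
      (Eventually.of_forall fun z hz => hnet.fZ0_nonneg hp (ha.trans_lt hz.1)))]

lemma IsNetwork.measure_taggedLoss_mem_Ico (hnet : IsNetwork P p X los F) (hp : p.Admissible)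
    {a b : ℝ} (ha : 0 ≤ a) (hab : a ≤ b) :
    P {ω | taggedLoss p X los F ω ≠ ∞ ∧ (taggedLoss p X los F ω).toReal ∈ Set.Ico a b} =
      ENNReal.ofReal ((p.Ptail a + 1 - p.Pdet) ^ p.K - (p.Ptail b + 1 - p.Pdet) ^ p.K) := by
  have hm := measurable_taggedLoss (p := p) hnet.poisson.measurable hnet.los_measurable
    hnet.fading_measurable
  have hset : {ω | taggedLoss p X los F ω ≠ ∞ ∧ (taggedLoss p X los F ω).toReal ∈ Set.Ico a b} =
      {ω | ENNReal.ofReal a ≤ taggedLoss p X los F ω} \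
        {ω | ENNReal.ofReal b ≤ taggedLoss p X los F ω} := by
    ext ω
    simp only [Set.mem_ofPred_eq, Set.mem_sdiff, Set.mem_Ico, not_le]
    constructor
    · rintro ⟨h, h1, h2⟩
      exact ⟨(ENNReal.ofReal_le_iff_le_toReal h).2 h1, (ENNReal.lt_ofReal_iff_toReal_lt h).2 h2⟩
    · rintro ⟨h1, h2⟩
      have h := (h2.trans ENNReal.ofReal_lt_top).ne
      exact ⟨h, (ENNReal.ofReal_le_iff_le_toReal h).1 h1, (ENNReal.lt_ofReal_iff_toReal_lt h).1 h2⟩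
  have hsub : {ω | ENNReal.ofReal b ≤ taggedLoss p X los F ω} ⊆
      {ω | ENNReal.ofReal a ≤ taggedLoss p X los F ω} :=
    fun ω h => (ENNReal.ofReal_le_ofReal hab).trans h
  rw [hset, ← ofReal_measureReal, measureReal_sdiff hsub (measurableSet_le measurable_const hm),
    hnet.measureReal_le_taggedLoss_eq_pow hp ha,
    hnet.measureReal_le_taggedLoss_eq_pow hp (ha.trans hab)]

lemma IsNetwork.measure_taggedLoss_mem (hnet : IsNetwork P p X los F) (hp : p.Admissible)
    {A : Set ℝ} (hA : MeasurableSet A) :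
    P {ω | taggedLoss p X los F ω ≠ ∞ ∧ (taggedLoss p X los F ω).toReal ∈ A} =
      ∫⁻ z in A ∩ Set.Ioi 0, ENNReal.ofReal (p.fZ0 z) := by
  have hm := measurable_taggedLoss (p := p) hnet.poisson.measurable hnet.los_measurable
    hnet.fading_measurable
  let μ : Measure ℝ := (P.restrict {ω | taggedLoss p X los F ω ≠ ∞}).map
    fun ω => (taggedLoss p X los F ω).toReal
  let ν : Measure ℝ := (volume.restrict (Set.Ioi 0)).withDensity fun z => ENNReal.ofReal (p.fZ0 z)
  have hμ : ∀ B, MeasurableSet B → μ B =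
      P {ω | taggedLoss p X los F ω ≠ ∞ ∧ (taggedLoss p X los F ω).toReal ∈ B} := by
    intro B hB
    rw [Measure.map_apply hm.ennreal_toReal hB, Measure.restrict_apply (hm.ennreal_toReal hB),
      Set.inter_comm]
    rfl
  have hν : ∀ B, MeasurableSet B → ν B = ∫⁻ z in B ∩ Set.Ioi 0, ENNReal.ofReal (p.fZ0 z) := by
    intro B hB
    rw [withDensity_apply _ hB, Measure.restrict_restrict hB]
  have hμν : μ = ν := by
    have : IsFiniteMeasure μ := Measure.isFiniteMeasure_map _ _
    -- Half-open intervals determine the measure. Both measures ignore negative numbers, so the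
    -- endpoints may be replaced by their positive parts.
    refine Measure.ext_of_Ico μ ν fun a b hab => ?_
    rw [hμ _ measurableSet_Ico, hν _ measurableSet_Ico]
    have h1 : {ω | taggedLoss p X los F ω ≠ ∞ ∧ (taggedLoss p X los F ω).toReal ∈ Set.Ico a b} =
        {ω | taggedLoss p X los F ω ≠ ∞ ∧
          (taggedLoss p X los F ω).toReal ∈ Set.Ico (max a 0) (max b 0)} := by
      ext ω
      have h0 : 0 ≤ (taggedLoss p X los F ω).toReal := ENNReal.toReal_nonneg
      simp only [Set.mem_ofPred_eq, Set.mem_Ico, max_le_iff, lt_max_iff, h0, and_true,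
        not_lt.2 h0, or_false]
    have h2 : Set.Ico a b ∩ Set.Ioi 0 = Set.Ico (max a 0) (max b 0) ∩ Set.Ioi 0 := by
      ext z
      simp only [Set.mem_inter_iff, Set.mem_Ico, Set.mem_Ioi, max_le_iff, lt_max_iff]
      constructor
      · rintro ⟨⟨h1, h2⟩, h3⟩
        exact ⟨⟨⟨h1, h3.le⟩, Or.inl h2⟩, h3⟩
      · rintro ⟨⟨h1, h2⟩, h3⟩
        exact ⟨⟨h1.1, h2.resolve_right (not_lt.2 h3.le)⟩, h3⟩
    have hab' : max a 0 ≤ max b 0 := max_le_max_right 0 hab.le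
    rw [h1, h2, hnet.measure_taggedLoss_mem_Ico hp (le_max_right _ _) hab',
      hnet.setLIntegral_fZ0_Ico hp (le_max_right _ _) hab']
  rw [← hμ A hA, ← hν A hA, hμν]

end Assembly

end MmWave

theorem mainTheorem5 {Ω : Type*} [MeasurableSpace Ω] (P : Measure Ω) [IsProbabilityMeasure P]
    (p : MmWave.Params) (hp : p.Admissible)
    (X : ℕ → Ω → ℂ) (los : ℕ → Ω → Bool) (F : ℕ → Ω → ℝ)
    (hnet : MmWave.IsNetwork P p X los F) :
    Measurable (MmWave.taggedLoss p X los F) ∧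
    IntegrableOn (fun z => p.Ptilde z * p.fZ1 z) (Set.Ioi 0) ∧
    (∀ z₀ : ℝ, 0 ≤ z₀ →
      P.real {ω | ENNReal.ofReal z₀ ≤ MmWave.taggedLoss p X los F ω} =
        (p.Ptail z₀ + 1 - p.Pdet) ^ p.K) ∧
    (∀ z₀ : ℝ, 0 < z₀ → 0 ≤ p.fZ0 z₀) ∧
    (∀ A : Set ℝ, MeasurableSet A →
      P {ω | MmWave.taggedLoss p X los F ω ≠ ∞ ∧
          (MmWave.taggedLoss p X los F ω).toReal ∈ A} =
        ∫⁻ z in A ∩ Set.Ioi 0, ENNReal.ofReal (p.fZ0 z)) :=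
  ⟨MmWave.measurable_taggedLoss hnet.poisson.measurable hnet.los_measurable hnet.fading_measurable,
    hnet.integrableOn_Ptilde_mul_fZ1 hp,
    fun _ hz => hnet.measureReal_le_taggedLoss_eq_pow hp hz,
    fun _ hz => hnet.fZ0_nonneg hp hz,
    fun _ hA => hnet.measure_taggedLoss_mem hp hA⟩
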